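/- Let $b>0$, let $a_3,b_1,b_2,r$ be real constants with $b_1,b_2,r>0$ and $a_3^2b_2<1$, and let $a\in L^\infty(\mathbb{R}^+)$ be real-valued, where $\mathbb{R}^+=(0,\infty)$. Let $L^2_b(\mathbb{R}^+)$ be the space of (classes of) functions $u:\mathbb{R}^+\to\mathbb{R}$ with $\|u\|_{L^2_b}:=\|u e^{bx}\|_{L^2(\mathbb{R}^+)}<\infty$, and consider the linear system $$ \left\{ \begin{array}{l} u_{t}+u_{xxx}+a_{3}v_{xxx}+a(x)u=0,\\ b_{1}v_{t}+v_{xxx}+b_{2}a_{3}u_{xxx}+rv_{x}+a(x)v=0,\qquad x,t>0,\\ u(0,t)=v(0,t)=0,\quad t>0,\\ u(x,0)=u_{0}(x),\ v(x,0)=v_{0}(x),\quad x>0. \end{array} \right.\qquad (1) $$ Let $A$ be the operator in $[L^2_b(\mathbb{R}^+)]^2$ given by $$ A\begin{pmatrix}u\\ v\end{pmatrix}= \begin{pmatrix} -u_{xxx}-a_3v_{xxx}-a u\\[1mm] -\frac{1}{b_1}v_{xxx}-\frac{a_3b_2}{b_1}u_{xxx}-\frac{r}{b_1}v_x-\frac{1}{b_1}a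 v \end{pmatrix}, $$ $$ D(A)=\left\{U=(u,v)\in[L^2_b(\mathbb{R}^+)]^2:\ \partial_x^iU\in[L^2_b(\mathbb{R}^+)]^2\ (1\le i\le 3)\ \text{in the weak sense},\ U(0)=0\right\}. $$ Then $A$ is the infinitesimal generator of a strongly continuous semigroup $(S(t))_{t\ge0}$ of bounded operators on $[L^2_b(\mathbb{R}^+)]^2$, and the following hold. (i) For every $U_0=(u_0,v_0)\in[L^2_b(\mathbb{R}^+)]^2$, $U(t)=S(t)U_0$ is the unique weak solution of (1) in $C([0,\infty);[L^2_b(\mathbb{R}^+)]^2)$. Here $U=(u,v)\in C([0,\infty);[L^2_b(\mathbb{R}^+)]^2)$ is called a weak solution if for all $t\ge0$ and all $\varphi,\psi\in C_c^\infty([0,\infty))$ with $\varphi(0)=\varphi'(0)=\psi(0)=\psi'(0)=0$, $$ \int_0^\infty u(t)\varphi\,dx=\int_0^\infty u_0\varphi\,dx+\int_0^t\!\!\int_0^\infty\left[(u+a_3v)\varphi'''-a u\varphi\right]dx\,ds, $$ $$ b_1\int_0^\infty v(t)\psi\,dx=b_1\int_0^\infty v_0\psi\,dx+\int_0^t\!\!\int_0^\infty\left[(v+b_2a_3u)\psi'''+r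 v\psi'-a v\psi\right]dx\,ds . $$ (ii) If $U_0\in D(A)$, then $U(t)=S(t)U_0$ is the unique classical solution of (1), that is, the unique $U\in C([0,\infty);D(A))\cap C^1([0,\infty);[L^2_b(\mathbb{R}^+)]^2)$, where $D(A)$ carries the graph norm, with $U'(t)=AU(t)$ for all $t\ge0$ and $U(0)=U_0$. -/

import Mathlib

open MeasureTheory Set Filter Topology
open scoped ContDiff

noncomputable section

namespace KatoKdV

/-- The measure `e^{2bx} dx` on `(0, ∞)`. -/
def katoMeasure (b : ℝ) : Measure ℝ :=
  (volume.restrict (Ioi (0 : ℝ))).withDensity (fun x => ENNReal.ofReal (Real.exp (2 * b * x)))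

/-- `L²_b(ℝ⁺)`: (classes of) functions `u` on `(0, ∞)` with `u e^{bx} ∈ L²(0, ∞)`,
normed by `‖u e^{bx}‖_{L²}`. -/
abbrev L2b (b : ℝ) : Type := Lp ℝ 2 (katoMeasure b)

/-- `[L²_b(ℝ⁺)]²` as a Hilbert direct sum. -/
abbrev L2bSq (b : ℝ) : Type := WithLp 2 (L2b b × L2b b)

/-- `w` is the weak (distributional) derivative `∂ₓⁱ u` on the open half-line `(0, ∞)`. -/
def HasWeakDeriv {b : ℝ} (i : ℕ) (u w : L2b b) : Prop :=
  ∀ φ : ℝ → ℝ, ContDiff ℝ ∞ φ → HasCompactSupport φ → tsupport φ ⊆ Ioi (0 : ℝ) →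
    ∫ x in Ioi (0 : ℝ), u x * iteratedDeriv i φ x
      = (-1) ^ i * ∫ x in Ioi (0 : ℝ), w x * φ x

open Classical in
/-- The weak derivative `∂ₓⁱ u` if it exists in `L²_b(ℝ⁺)` (it is then unique), otherwise `0`. -/
def weakDeriv {b : ℝ} (i : ℕ) (u : L2b b) : L2b b :=
  if h : ∃ w : L2b b, HasWeakDeriv i u w then h.choose else 0

/-- The boundary condition `u(0) = 0`, read on the representative continuous up to `0`. -/
def VanishesAtZero {b : ℝ} (u : L2b b) : Prop :=
  ∃ g : ℝ → ℝ, ContinuousOn g (Ici 0) ∧ g 0 = 0 ∧ ∀ᵐ x ∂(volume.restrict (Ioi (0 : ℝ))), u x = g x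

/-! ### Weak derivatives are unique and linear -/

lemma ac_katoMeasure (b : ℝ) : volume.restrict (Ioi (0 : ℝ)) ≪ katoMeasure b := by
  refine withDensity_absolutelyContinuous' (by fun_prop) ?_
  filter_upwards with x
  simp [Real.exp_pos]

lemma katoMeasure_ac (b : ℝ) : katoMeasure b ≪ volume.restrict (Ioi (0 : ℝ)) :=
  withDensity_absolutelyContinuous _ _

lemma lintegral_lt_top {b : ℝ} (u : L2b b) :
    ∫⁻ x in Ioi (0 : ℝ), ENNReal.ofReal (Real.exp (2 * b * x)) * ‖u x‖ₑ ^ (2 : ℝ) < ⊤ := by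
  have h := lintegral_rpow_enorm_lt_top_of_eLpNorm_lt_top (by norm_num) (by norm_num)
    (Lp.memLp u).2
  have e := lintegral_withDensity_eq_lintegral_mul_non_measurable₀
    (volume.restrict (Ioi (0 : ℝ))) (f := fun x => ENNReal.ofReal (Real.exp (2 * b * x)))
    (by fun_prop) (by simp) (fun x => ‖u x‖ₑ ^ (2 : ℝ))
  change ∫⁻ x, ‖u x‖ₑ ^ (2 : ℝ) ∂(katoMeasure b) = _ at e
  simp only [ENNReal.toReal_ofNat, e] at h
  simpa using h

/-- An element of `L²_b` is locally integrable on `(0, ∞)`; in fact square integrable on every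
bounded part of it. -/
lemma memLp_restrict {b : ℝ} (u : L2b b) (R : ℝ) :
    MemLp u 2 ((volume.restrict (Ioi (0 : ℝ))).restrict (Icc (-R) R)) := by
  refine ⟨((Lp.aestronglyMeasurable u).mono_ac (ac_katoMeasure b)).mono_measure
    Measure.restrict_le_self, ?_⟩
  rw [eLpNorm_lt_top_iff_lintegral_rpow_enorm_lt_top (by norm_num) (by norm_num)]
  set c : ℝ := Real.exp (-(2 * |b| * |R|)) with hc
  have hcpos : 0 < c := Real.exp_pos _
  have h1 : ENNReal.ofReal c *
      ∫⁻ x in Icc (-R) R, ‖u x‖ₑ ^ (2 : ℝ) ∂(volume.restrict (Ioi (0 : ℝ))) < ⊤ := by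
    refine lt_of_le_of_lt ?_ (lintegral_lt_top u)
    rw [← lintegral_const_mul' _ _ (by simp)]
    refine le_trans ?_ (setLIntegral_le_lintegral (Icc (-R) R) _)
    refine setLIntegral_mono' measurableSet_Icc fun x hx => ?_
    refine mul_le_mul_left (ENNReal.ofReal_le_ofReal ?_) _
    rw [hc, Real.exp_le_exp]
    have hxR : |x| ≤ |R| := (abs_le.2 hx).trans (le_abs_self R)
    have : |b * x| ≤ |b| * |R| := by
      rw [abs_mul]; gcongr
    have := neg_abs_le (b * x)
    linarith
  by_contra hcon
  have hcon' := not_lt_top_iff.1 hcon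
  simp only [ENNReal.toReal_ofNat] at hcon'
  rw [hcon', ENNReal.mul_top (by simpa using hcpos)] at h1
  exact absurd h1 (lt_irrefl _)

lemma integrable_mul_of_compact {b : ℝ} (u : L2b b) {ψ : ℝ → ℝ} (hψ : Continuous ψ)
    (hs : HasCompactSupport ψ) :
    Integrable (fun x => u x * ψ x) (volume.restrict (Ioi (0 : ℝ))) := by
  obtain ⟨R, hR⟩ := hs.isCompact.isBounded.subset_closedBall 0
  have hR' : tsupport ψ ⊆ Icc (-R) R := by simpa [Real.closedBall_eq_Icc] using hR
  have h2 : MemLp ψ 2 ((volume.restrict (Ioi (0 : ℝ))).restrict (Icc (-R) R)) :=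
    (hψ.memLp_of_hasCompactSupport hs (μ := volume) (p := 2)).mono_measure
      (Measure.restrict_le_self.trans Measure.restrict_le_self)
  have h3 : IntegrableOn (fun x => u x * ψ x) (Icc (-R) R) (volume.restrict (Ioi (0 : ℝ))) :=
    (memLp_restrict u R).integrable_mul h2
  refine (integrableOn_iff_integrable_of_support_subset ?_).1 h3
  intro x hx
  refine hR' (subset_tsupport _ ?_)
  simp only [Function.mem_support] at hx ⊢
  exact fun h => hx (by simp [h])

lemma hasCompactSupport_iteratedDeriv {φ : ℝ → ℝ} (hs : HasCompactSupport φ) (i : ℕ) :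
    HasCompactSupport (iteratedDeriv i φ) := by
  induction i with
  | zero => simpa using hs
  | succ n ih => rw [iteratedDeriv_succ]; exact ih.deriv

lemma coe_add {b : ℝ} (u v : L2b b) :
    ∀ᵐ x ∂(volume.restrict (Ioi (0 : ℝ))), (u + v : L2b b) x = u x + v x :=
  (ac_katoMeasure b).ae_le (Lp.coeFn_add u v)

lemma coe_smul {b : ℝ} (c : ℝ) (u : L2b b) :
    ∀ᵐ x ∂(volume.restrict (Ioi (0 : ℝ))), (c • u : L2b b) x = c * u x :=
  (ac_katoMeasure b).ae_le (Lp.coeFn_smul c u)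

lemma integral_add_mul {b : ℝ} (u v : L2b b) {ψ : ℝ → ℝ} (hψ : Continuous ψ)
    (hs : HasCompactSupport ψ) :
    ∫ x in Ioi (0 : ℝ), (u + v : L2b b) x * ψ x
      = (∫ x in Ioi (0 : ℝ), u x * ψ x) + ∫ x in Ioi (0 : ℝ), v x * ψ x := by
  rw [← integral_add (integrable_mul_of_compact u hψ hs) (integrable_mul_of_compact v hψ hs)]
  refine integral_congr_ae ?_
  filter_upwards [coe_add u v] with x hx
  rw [hx]; ring

lemma integral_smul_mul {b : ℝ} (c : ℝ) (u : L2b b) (ψ : ℝ → ℝ) :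
    ∫ x in Ioi (0 : ℝ), (c • u : L2b b) x * ψ x = c * ∫ x in Ioi (0 : ℝ), u x * ψ x := by
  rw [← integral_const_mul]
  refine integral_congr_ae ?_
  filter_upwards [coe_smul c u] with x hx
  rw [hx]; ring

lemma HasWeakDeriv.add {b : ℝ} {i : ℕ} {u v w z : L2b b} (h : HasWeakDeriv i u w)
    (h' : HasWeakDeriv i v z) : HasWeakDeriv i (u + v) (w + z) := by
  intro φ hφ hc hs
  have hd : Continuous (iteratedDeriv i φ) :=
    hφ.continuous_iteratedDeriv i (by exact_mod_cast le_top)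
  rw [integral_add_mul u v hd (hasCompactSupport_iteratedDeriv hc i),
    integral_add_mul w z hφ.continuous hc, h φ hφ hc hs, h' φ hφ hc hs]
  ring

lemma HasWeakDeriv.smul {b : ℝ} {i : ℕ} {u w : L2b b} (c : ℝ) (h : HasWeakDeriv i u w) :
    HasWeakDeriv i (c • u) (c • w) := by
  intro φ hφ hc hs
  rw [integral_smul_mul, integral_smul_mul, h φ hφ hc hs]
  ring

lemma HasWeakDeriv.unique {b : ℝ} {i : ℕ} {u w z : L2b b} (h : HasWeakDeriv i u w)
    (h' : HasWeakDeriv i u z) : w = z := by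
  have key : ∀ᵐ x ∂(volume : Measure ℝ), x ∈ Ioi (0 : ℝ) → w x - z x = 0 := by
    refine isOpen_Ioi.ae_eq_zero_of_integral_contDiff_smul_eq_zero ?_ ?_
    · rw [locallyIntegrableOn_iff isOpen_Ioi.isLocallyClosed]
      intro k hk hkc
      obtain ⟨R, hR⟩ := hkc.isBounded.subset_closedBall 0
      have hR' : k ⊆ Icc (-R) R := by simpa [Real.closedBall_eq_Icc] using hR
      have hle : volume.restrict k ≤ (volume.restrict (Ioi (0 : ℝ))).restrict (Icc (-R) R) := by
        rw [Measure.restrict_restrict measurableSet_Icc]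
        exact Measure.restrict_mono (subset_inter hR' hk) le_rfl
      have : IsFiniteMeasure (volume.restrict k) := ⟨by simpa using hkc.measure_lt_top⟩
      exact (((memLp_restrict w R).mono_measure hle).integrable (by norm_num)).sub
        (((memLp_restrict z R).mono_measure hle).integrable (by norm_num))
    · intro g hg hgc hgs
      have e : ∫ x in Ioi (0 : ℝ), w x * g x = ∫ x in Ioi (0 : ℝ), z x * g x := by
        have := (h g hg hgc hgs).symm.trans (h' g hg hgc hgs)
        exact mul_left_cancel₀ (pow_ne_zero i (by norm_num)) this
      have e2 : ∫ x, g x • (w x - z x) = ∫ x in Ioi (0 : ℝ), g x • (w x - z x) := by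
        refine (setIntegral_eq_integral_of_forall_compl_eq_zero fun x hx => ?_).symm
        have : g x = 0 := image_eq_zero_of_notMem_tsupport fun hx' => hx (hgs hx')
        simp [this]
      rw [e2]
      have e3 : ∫ x in Ioi (0 : ℝ), g x • (w x - z x)
          = (∫ x in Ioi (0 : ℝ), w x * g x) - ∫ x in Ioi (0 : ℝ), z x * g x := by
        rw [← integral_sub (integrable_mul_of_compact w hg.continuous hgc)
          (integrable_mul_of_compact z hg.continuous hgc)]
        congr 1
        ext x
        simp only [smul_eq_mul]; ring
      rw [e3, e, sub_self]
  refine Lp.ext ((katoMeasure_ac b).ae_le ?_)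
  refine (ae_restrict_iff' measurableSet_Ioi).2 ?_
  filter_upwards [key] with x hx hx0
  exact sub_eq_zero.1 (hx hx0)

lemma HasWeakDeriv.weakDeriv_eq {b : ℝ} {i : ℕ} {u w : L2b b} (h : HasWeakDeriv i u w) :
    weakDeriv i u = w := by
  have hex : ∃ w : L2b b, HasWeakDeriv i u w := ⟨w, h⟩
  rw [weakDeriv, dif_pos hex]
  exact hex.choose_spec.unique h

lemma hasWeakDeriv_weakDeriv {b : ℝ} {i : ℕ} {u : L2b b} (h : ∃ w : L2b b, HasWeakDeriv i u w) :
    HasWeakDeriv i u (weakDeriv i u) := by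
  obtain ⟨w, hw⟩ := h
  rwa [hw.weakDeriv_eq]

/-! ### The operator -/

/-- `{u ∈ L²_b : ∂ₓⁱ u ∈ L²_b for 1 ≤ i ≤ 3 and u(0) = 0}`. -/
def scalarDomain (b : ℝ) : Submodule ℝ (L2b b) where
  carrier := {u | (∀ i : ℕ, 1 ≤ i → i ≤ 3 → ∃ w : L2b b, HasWeakDeriv i u w) ∧ VanishesAtZero u}
  add_mem' := by
    rintro u v ⟨hu, g, hg, hg0, hug⟩ ⟨hv, k, hk, hk0, hvk⟩
    refine ⟨fun i h1 h3 => ?_, fun x => g x + k x, hg.add hk, by simp [hg0, hk0], ?_⟩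
    · obtain ⟨w, hw⟩ := hu i h1 h3
      obtain ⟨z, hz⟩ := hv i h1 h3
      exact ⟨w + z, hw.add hz⟩
    · filter_upwards [hug, hvk, coe_add u v] with x h1 h2 h3
      rw [h3, h1, h2]
  zero_mem' := by
    have h0 : ∀ᵐ x ∂(volume.restrict (Ioi (0 : ℝ))), (0 : L2b b) x = 0 :=
      (ac_katoMeasure b).ae_le (Lp.coeFn_zero ℝ 2 (katoMeasure b))
    refine ⟨fun i _ _ => ⟨0, ?_⟩, fun _ => 0, continuousOn_const, rfl, h0⟩
    intro φ _ _ _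
    have e : ∀ ψ : ℝ → ℝ, ∫ x in Ioi (0 : ℝ), (0 : L2b b) x * ψ x = 0 := fun ψ => by
      have := integral_smul_mul (b := b) 0 0 ψ
      simpa using this
    rw [e, e, mul_zero]
  smul_mem' := by
    rintro c u ⟨hu, g, hg, hg0, hug⟩
    refine ⟨fun i h1 h3 => ?_, fun x => c * g x, continuousOn_const.mul hg, by simp [hg0], ?_⟩
    · obtain ⟨w, hw⟩ := hu i h1 h3
      exact ⟨c • w, hw.smul c⟩
    · filter_upwards [hug, coe_smul c u] with x h1 h2
      rw [h2, h1]

/-- `∂ₓⁱ`, `1 ≤ i ≤ 3`, as a linear map on the functions of `scalarDomain`. -/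
def derivMap (b : ℝ) (i : ℕ) (h1 : 1 ≤ i) (h3 : i ≤ 3) : scalarDomain b →ₗ[ℝ] L2b b where
  toFun u := weakDeriv i (u : L2b b)
  map_add' u v := ((hasWeakDeriv_weakDeriv (u.2.1 i h1 h3)).add
    (hasWeakDeriv_weakDeriv (v.2.1 i h1 h3))).weakDeriv_eq
  map_smul' c u := ((hasWeakDeriv_weakDeriv (u.2.1 i h1 h3)).smul c).weakDeriv_eq

lemma memLp_mul {b : ℝ} {a : ℝ → ℝ} (ha : MemLp a ⊤ (volume.restrict (Ioi (0 : ℝ)))) (u : L2b b) :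
    MemLp (fun x => a x * u x) 2 (katoMeasure b) := by
  have ha' : MemLp a ⊤ (katoMeasure b) :=
    ⟨ha.1.mono_ac (katoMeasure_ac b),
      (eLpNormEssSup_mono_measure a (katoMeasure_ac b)).trans_lt (by simpa using ha.2)⟩
  exact (Lp.memLp u).mul ha'

/-- Multiplication by `a ∈ L^∞(ℝ⁺)` on `L²_b(ℝ⁺)`. -/
def mulMap (b : ℝ) (a : ℝ → ℝ) (ha : MemLp a ⊤ (volume.restrict (Ioi (0 : ℝ)))) :
    L2b b →ₗ[ℝ] L2b b where
  toFun u := (memLp_mul ha u).toLp _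
  map_add' u v := by
    rw [← MemLp.toLp_add]
    refine MemLp.toLp_congr _ _ ?_
    filter_upwards [Lp.coeFn_add u v] with x hx
    change a x * (u + v : L2b b) x = a x * u x + a x * v x
    rw [hx, Pi.add_apply, mul_add]
  map_smul' c u := by
    rw [RingHom.id_apply, ← MemLp.toLp_const_smul]
    refine MemLp.toLp_congr _ _ ?_
    filter_upwards [Lp.coeFn_smul c u] with x hx
    change a x * (c • u : L2b b) x = c * (a x * u x)
    rw [hx, Pi.smul_apply, smul_eq_mul]
    ring

/-- `D(A)`: pairs `U = (u, v)` with `∂ₓⁱ U ∈ [L²_b]²` for `1 ≤ i ≤ 3` and `U(0) = 0`. -/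
def opDomain (b : ℝ) : Submodule ℝ (L2bSq b) :=
  ((scalarDomain b).prod (scalarDomain b)).comap
    (WithLp.linearEquiv 2 ℝ (L2b b × L2b b)).toLinearMap

/-- The first component of an element of `D(A)`. -/
def fstMap (b : ℝ) : opDomain b →ₗ[ℝ] scalarDomain b where
  toFun U := ⟨(U : L2bSq b).fst, U.2.1⟩
  map_add' _ _ := rfl
  map_smul' _ _ := rfl

/-- The second component of an element of `D(A)`. -/
def sndMap (b : ℝ) : opDomain b →ₗ[ℝ] scalarDomain b where
  toFun U := ⟨(U : L2bSq b).snd, U.2.2⟩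
  map_add' _ _ := rfl
  map_smul' _ _ := rfl

/-- The unbounded operator on `[L²_b(ℝ⁺)]²` with domain `D(A)` and
`A (u, v) = ( -u_xxx - a₃ v_xxx - a u,
  -(1/b₁) v_xxx - (a₃ b₂ / b₁) u_xxx - (r/b₁) v_x - (1/b₁) a v )`. -/
def kdvOp (b a₃ b₁ b₂ r : ℝ) (a : ℝ → ℝ) (ha : MemLp a ⊤ (volume.restrict (Ioi (0 : ℝ)))) :
    L2bSq b →ₗ.[ℝ] L2bSq b where
  domain := opDomain b
  toFun :=
    let D1 := derivMap b 1 (by norm_num) (by norm_num)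
    let D3 := derivMap b 3 (by norm_num) (by norm_num)
    let u := fstMap b
    let v := sndMap b
    let M := mulMap b a ha ∘ₗ (scalarDomain b).subtype
    (WithLp.linearEquiv 2 ℝ (L2b b × L2b b)).symm.toLinearMap ∘ₗ
      LinearMap.prod
        (-(D3 ∘ₗ u) - a₃ • (D3 ∘ₗ v) - M ∘ₗ u)
        (-((1 / b₁) • (D3 ∘ₗ v)) - (a₃ * b₂ / b₁) • (D3 ∘ₗ u) - (r / b₁) • (D1 ∘ₗ v)
          - (1 / b₁) • (M ∘ₗ v))

/-- The formula for the operator, written out. -/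
lemma kdvOp_apply (b a₃ b₁ b₂ r : ℝ) (a : ℝ → ℝ)
    (ha : MemLp a ⊤ (volume.restrict (Ioi (0 : ℝ)))) (U : (kdvOp b a₃ b₁ b₂ r a ha).domain) :
    kdvOp b a₃ b₁ b₂ r a ha U = WithLp.toLp 2
      (-(weakDeriv 3 (U : L2bSq b).fst) - a₃ • weakDeriv 3 (U : L2bSq b).snd
          - mulMap b a ha (U : L2bSq b).fst,
        -((1 / b₁) • weakDeriv 3 (U : L2bSq b).snd)
          - (a₃ * b₂ / b₁) • weakDeriv 3 (U : L2bSq b).fst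
          - (r / b₁) • weakDeriv 1 (U : L2bSq b).snd
          - (1 / b₁) • mulMap b a ha (U : L2bSq b).snd) := rfl

/-! ### Semigroups -/

/-- `(S t)_{t ≥ 0}` is a strongly continuous semigroup of bounded operators (values at `t < 0` are
irrelevant). -/
structure IsC0Semigroup {X : Type*} [NormedAddCommGroup X] [NormedSpace ℝ X]
    (S : ℝ → X →L[ℝ] X) : Prop where
  zero : S 0 = ContinuousLinearMap.id ℝ X
  add : ∀ s t : ℝ, 0 ≤ s → 0 ≤ t → S (s + t) = S s ∘L S t
  tendsto : ∀ x : X, Tendsto (fun t => S t x) (𝓝[>] 0) (𝓝 x)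

/-- `A` is the infinitesimal generator of `S`: `x ∈ D(A)` with `A x = y` exactly when
`(S t x - x) / t → y` as `t → 0⁺`. -/
def IsInfinitesimalGenerator {X : Type*} [NormedAddCommGroup X] [NormedSpace ℝ X]
    (A : X →ₗ.[ℝ] X) (S : ℝ → X →L[ℝ] X) : Prop :=
  ∀ x y : X, (x, y) ∈ A.graph ↔ Tendsto (fun t : ℝ => t⁻¹ • (S t x - x)) (𝓝[>] 0) (𝓝 y)

/-! ### Solutions of the linear system -/

/-- Test functions in space: restrictions to `[0, ∞)` of compactly supported smooth functions with
`φ(0) = φ'(0) = 0`. -/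
structure IsTestFunction (φ : ℝ → ℝ) : Prop where
  smooth : ContDiff ℝ ∞ φ
  compact : HasCompactSupport φ
  zero : φ 0 = 0
  deriv_zero : deriv φ 0 = 0

/-- Weak solutions in `C([0, ∞); [L²_b]²)` of
`u_t + u_xxx + a₃ v_xxx + a u = 0`, `b₁ v_t + v_xxx + b₂ a₃ u_xxx + r v_x + a v = 0`,
`u(0, t) = v(0, t) = 0`, `(u, v)(·, 0) = U₀`: each equation is multiplied by a test function,
integrated over `(0, ∞) × (0, t)` and integrated by parts in `x`. Since the test functions need
not have a vanishing second derivative at `0`, this includes the boundary condition. -/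
structure IsWeakSolution (b a₃ b₁ b₂ r : ℝ) (a : ℝ → ℝ) (U₀ : L2bSq b) (U : ℝ → L2bSq b) :
    Prop where
  continuousOn : ContinuousOn U (Ici 0)
  fst_eq : ∀ φ : ℝ → ℝ, IsTestFunction φ → ∀ t : ℝ, 0 ≤ t →
    ∫ x in Ioi (0 : ℝ), (U t).fst x * φ x
      = (∫ x in Ioi (0 : ℝ), U₀.fst x * φ x)
        + ∫ s in (0 : ℝ)..t, ∫ x in Ioi (0 : ℝ),
            (((U s).fst x + a₃ * (U s).snd x) * iteratedDeriv 3 φ x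
              - a x * (U s).fst x * φ x)
  snd_eq : ∀ ψ : ℝ → ℝ, IsTestFunction ψ → ∀ t : ℝ, 0 ≤ t →
    b₁ * ∫ x in Ioi (0 : ℝ), (U t).snd x * ψ x
      = (b₁ * ∫ x in Ioi (0 : ℝ), U₀.snd x * ψ x)
        + ∫ s in (0 : ℝ)..t, ∫ x in Ioi (0 : ℝ),
            (((U s).snd x + b₂ * a₃ * (U s).fst x) * iteratedDeriv 3 ψ x
              + r * (U s).snd x * deriv ψ x - a x * (U s).snd x * ψ x)

/-- Classical solutions of `U' = A U`, `U(0) = U₀` on `[0, ∞)`: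
`U ∈ C([0, ∞); D(A)) ∩ C¹([0, ∞); X)`, where `D(A)` carries the graph norm. Here `F t = A (U t)`;
its continuity is that of `U` in `D(A)` and of `U'` in `X`. -/
def IsClassicalSolution {X : Type*} [NormedAddCommGroup X] [NormedSpace ℝ X]
    (A : X →ₗ.[ℝ] X) (U₀ : X) (U : ℝ → X) : Prop :=
  U 0 = U₀ ∧ ContinuousOn U (Ici 0) ∧
    ∃ F : ℝ → X, ContinuousOn F (Ici 0) ∧ ∀ t : ℝ, 0 ≤ t →
      (U t, F t) ∈ A.graph ∧ HasDerivWithinAt U (F t) (Ici 0) t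

end KatoKdV

end

/-!
The operator `A` is shown to be quasi-dissipative with quasi-dissipative adjoint in a suitable
energy, so that it generates a semigroup by the Lumer–Phillips theorem, and its weak formulation is
shown to describe its graph exactly.

**The half-line without Sobolev spaces.** For `b > 0` the formula `(I w)(x) = -∫ₓ^∞ w` defines a
bounded operator `I = primOp` on `L²_b`, and a function of `L²_b` has the weak derivative `w` of
order `i` if and only if it equals `Iⁱ w` (`hasWeakDeriv_iff`): nothing but zero in `L²_b` has
a vanishing weak derivative, because a polynomial is not integrable. Hence `D(A)` consists of the
pairs `(I³ w₁, I³ w₂)` whose traces at `0` vanish, and the trace of `I w` is the inner product of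
`w` with the vector `traceVec = -e^{-2bx}`. All further computations rest on two identities in
`L²_b`, collected in `IsDecayingPrimitive`: integration by parts for `I` (`primOp_polar`), with a
boundary term, and for its adjoint (`adjoint_primOp_add`), without one.

**Dissipativity.** For a single function with `u(0) = 0` the identities give
`-⟪u''', u⟫ ≤ 4b³ ‖u‖²`. In the energy `b₂ ‖u‖² + b₁ ‖v‖²` the coupling matrix becomes symmetric,
and positive definite because `a₃² b₂ < 1`; completing squares reduces the system to the scalar
estimate (`IsDecayingPrimitive.system_inner_le`). The adjoint system is treated in the same way on
the side of `I*` (`IsDecayingPrimitive.system_adjoint_eq_zero`), which shows that `c - A` has dense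
range for large `c`. The terms `a u`, `a v` and `r v_x` only shift the constants.

**Generation.** A closed quasi-dissipative operator with `c - A` of dense range for all large `c`
has resolvents, and the exponentials of its Yosida approximations converge to the semigroup
(`exists_semigroup_of_quasiDissipative`, `exists_generatedBy`).

**Solutions.** A pair `(U, F)` is in the graph of `A` if and only if the weak equations
hold against all admissible test functions (`mem_graph_kdvOp_iff_weak`): interior test functions
give the regularity, and one test function with `φ''(0) ≠ 0` gives the boundary condition. In
particular the graph is closed, and a weak solution is exactly a continuous curve `U` with
`(∫₀ᵗ U, U(t) - U₀)` in the graph of `A` for all `t` (`isWeakSolution_iff`). Orbits of the semigroup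
have this property, and the energy estimate gives uniqueness for `∫₀ᵗ U` and hence for `U`; the same
estimate gives uniqueness of classical solutions.
-/

namespace KatoKdV

open scoped RealInnerProductSpace

section Semigroup

variable {H : Type*} [NormedAddCommGroup H] [InnerProductSpace ℝ H]

/-! ### The energy estimate -/

/-- Energy estimate: a curve with `⟪F', F⟫ ≤ κ ‖F‖²` grows at most like `exp (κ t)`. -/
lemma norm_le_exp_mul_of_inner_deriv_le {F F' : ℝ → H} {κ : ℝ}
    (hd : ∀ t, 0 ≤ t → HasDerivWithinAt F (F' t) (Ici 0) t)
    (hle : ∀ t, 0 ≤ t → ⟪F' t, F t⟫ ≤ κ * ‖F t‖ ^ 2) {t : ℝ} (ht : 0 ≤ t) :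
    ‖F t‖ ≤ Real.exp (κ * t) * ‖F 0‖ := by
  set g : ℝ → ℝ := fun t => Real.exp (-(2 * κ * t)) * ‖F t‖ ^ 2 with hg
  have hgd : ∀ t, 0 ≤ t → HasDerivWithinAt g
      (Real.exp (-(2 * κ * t)) * (-(2 * κ)) * ‖F t‖ ^ 2
        + Real.exp (-(2 * κ * t)) * (2 * ⟪F t, F' t⟫)) (Ici 0) t := fun t ht => by
    have h1 : HasDerivAt (fun t : ℝ => Real.exp (-(2 * κ * t)))
        (Real.exp (-(2 * κ * t)) * (-(2 * κ))) t := by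
      have := (((hasDerivAt_id t).const_mul (2 * κ)).neg).exp
      simpa using this
    exact h1.hasDerivWithinAt.mul (hd t ht).norm_sq
  have hanti : AntitoneOn g (Ici 0) := by
    refine antitoneOn_of_deriv_nonpos (convex_Ici 0)
      (fun t ht => (hgd t ht).continuousWithinAt) ?_ ?_
    · intro t ht
      rw [interior_Ici] at ht ⊢
      exact ((hgd t (le_of_lt ht)).mono Ioi_subset_Ici_self).differentiableWithinAt
    · intro t ht
      rw [interior_Ici] at ht
      rw [((hgd t (le_of_lt ht)).hasDerivAt (Ici_mem_nhds ht)).deriv]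
      have h1 := hle t (le_of_lt ht)
      rw [real_inner_comm] at h1
      have h2 := Real.exp_pos (-(2 * κ * t))
      nlinarith
  have h0 := hanti (mem_Ici.2 le_rfl) (mem_Ici.2 ht) ht
  simp only [hg, mul_zero, neg_zero, Real.exp_zero, one_mul] at h0
  have h1 : ‖F t‖ ^ 2 ≤ (Real.exp (κ * t) * ‖F 0‖) ^ 2 := by
    have e : Real.exp (κ * t) ^ 2 * Real.exp (-(2 * κ * t)) = 1 := by
      rw [← Real.exp_nat_mul, ← Real.exp_add, Real.exp_eq_one_iff]; push_cast; ring
    calc ‖F t‖ ^ 2 = Real.exp (κ * t) ^ 2 * (Real.exp (-(2 * κ * t)) * ‖F t‖ ^ 2) := by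
          rw [← mul_assoc, e, one_mul]
      _ ≤ Real.exp (κ * t) ^ 2 * ‖F 0‖ ^ 2 := by gcongr
      _ = _ := by ring
  exact le_of_sq_le_sq h1 (by positivity)

/-! ### Resolvents of dissipative relations -/

/-- The linear relation `G` (the graph of an operator) satisfies `⟪A x, x⟫ ≤ κ ‖x‖²`. -/
def QuasiDissipative (κ : ℝ) (G : Submodule ℝ (H × H)) : Prop :=
  ∀ x y : H, (x, y) ∈ G → ⟪y, x⟫ ≤ κ * ‖x‖ ^ 2

/-- `R = (c - A)⁻¹`, where `G` is the graph of `A`. -/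
def IsResolvent (G : Submodule ℝ (H × H)) (c : ℝ) (R : H →L[ℝ] H) : Prop :=
  ∀ f x : H, (x, c • x - f) ∈ G ↔ x = R f

lemma QuasiDissipative.norm_le {κ c : ℝ} {G : Submodule ℝ (H × H)} (hG : QuasiDissipative κ G)
    (hc : κ < c) {x f : H} (h : (x, c • x - f) ∈ G) : ‖x‖ ≤ (c - κ)⁻¹ * ‖f‖ := by
  have h1 := hG _ _ h
  rw [inner_sub_left, real_inner_smul_left, real_inner_self_eq_norm_sq] at h1
  have h2 := real_inner_le_norm f x
  have h3 : 0 < c - κ := sub_pos.2 hc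
  rw [← div_eq_inv_mul, le_div_iff₀ h3]
  rcases (norm_nonneg x).eq_or_lt with h0 | h0
  · rw [← h0]; simp
  · refine le_of_mul_le_mul_right ?_ h0
    nlinarith

/-- If the range of `c - A` is dense, it is everything, since `A` is closed and `c - A` is
bounded below. -/
lemma exists_resolvent [CompleteSpace H] {κ c : ℝ} {G : Submodule ℝ (H × H)}
    (hG : QuasiDissipative κ G) (hcl : IsClosed (G : Set (H × H))) (hc : κ < c)
    (hdense : ∀ g : H, (∀ x y : H, (x, y) ∈ G → ⟪c • x - y, g⟫ = 0) → g = 0) :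
    ∃ R : H →L[ℝ] H, IsResolvent G c R ∧ ∀ f, ‖R f‖ ≤ (c - κ)⁻¹ * ‖f‖ := by
  have hpos : 0 < (c - κ)⁻¹ := inv_pos.2 (sub_pos.2 hc)
  let Φ : G →L[ℝ] H :=
    (c • ContinuousLinearMap.fst ℝ H H - ContinuousLinearMap.snd ℝ H H) ∘L G.subtypeL
  have hΦ : ∀ p : G, Φ p = c • p.1.1 - p.1.2 := fun p => rfl
  have hb1 : ∀ p : G, ‖p.1.1‖ ≤ (c - κ)⁻¹ * ‖Φ p‖ := fun p => by
    refine hG.norm_le hc ?_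
    rw [hΦ, sub_sub_cancel]; exact p.2
  have hb : ∀ p : G, ‖p‖ ≤ (1 + |c| * (c - κ)⁻¹ + (c - κ)⁻¹) * ‖Φ p‖ := fun p => by
    have h1 := hb1 p
    have h2 : ‖p.1.2‖ ≤ |c| * ‖p.1.1‖ + ‖Φ p‖ := by
      have : p.1.2 = c • p.1.1 - Φ p := by rw [hΦ, sub_sub_cancel]
      rw [this]
      refine (norm_sub_le _ _).trans_eq ?_
      rw [norm_smul, Real.norm_eq_abs]
    have h3 : |c| * ‖p.1.1‖ ≤ |c| * ((c - κ)⁻¹ * ‖Φ p‖) := by gcongr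
    have h4 := norm_nonneg (Φ p)
    have h5 : 0 ≤ |c| * ((c - κ)⁻¹ * ‖Φ p‖) := by positivity
    have h6 : 0 ≤ (c - κ)⁻¹ * ‖Φ p‖ := by positivity
    change max ‖p.1.1‖ ‖p.1.2‖ ≤ _
    refine max_le ?_ ?_ <;> nlinarith
  have hinj : Function.Injective Φ := by
    refine (injective_iff_map_eq_zero Φ).2 fun p hp => ?_
    have := hb p
    rw [hp, norm_zero, mul_zero] at this
    exact norm_le_zero_iff.1 this
  have hcomp : CompleteSpace G := hcl.completeSpace_coe
  have hrange : IsClosed (Set.range Φ) := by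
    refine (Φ.antilipschitz_of_bound (K := ⟨1 + |c| * (c - κ)⁻¹ + (c - κ)⁻¹, by positivity⟩)
      fun p => hb p).isClosed_range Φ.uniformContinuous
  have hrc : CompleteSpace (LinearMap.range (Φ : G →ₗ[ℝ] H)) := by
    have : IsClosed ((LinearMap.range (Φ : G →ₗ[ℝ] H) : Submodule ℝ H) : Set H) := by
      rwa [LinearMap.coe_range]
    exact this.completeSpace_coe
  have hsurj : Function.Surjective Φ := by
    have htop : LinearMap.range (Φ : G →ₗ[ℝ] H) = ⊤ := by
      rw [← Submodule.orthogonal_eq_bot_iff, Submodule.eq_bot_iff]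
      intro g hg
      refine hdense g fun x y hxy => ?_
      exact (Submodule.mem_orthogonal _ _).1 hg _ ⟨⟨(x, y), hxy⟩, rfl⟩
    exact LinearMap.range_eq_top.1 htop
  let e : G ≃ₗ[ℝ] H := LinearEquiv.ofBijective (Φ : G →ₗ[ℝ] H) ⟨hinj, hsurj⟩
  have he : ∀ f, Φ (e.symm f) = f := fun f => e.apply_symm_apply f
  let R₀ : H →ₗ[ℝ] H := (LinearMap.fst ℝ H H ∘ₗ G.subtype) ∘ₗ e.symm.toLinearMap
  have hR₀ : ∀ f, R₀ f = (e.symm f).1.1 := fun f => rfl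
  have hb2 : ∀ f, ‖R₀ f‖ ≤ (c - κ)⁻¹ * ‖f‖ := fun f => by
    have := hb1 (e.symm f)
    rwa [he, ← hR₀] at this
  have hR : ∀ f, R₀.mkContinuous (c - κ)⁻¹ hb2 f = (e.symm f).1.1 := hR₀
  refine ⟨R₀.mkContinuous (c - κ)⁻¹ hb2, fun f x => ⟨fun h => ?_, fun h => ?_⟩, hb2⟩
  · have : e.symm f = ⟨(x, c • x - f), h⟩ := by
      apply hinj; rw [he, hΦ]; simp
    rw [hR, this]
  · rw [hR] at h
    have h2 := he f
    rw [hΦ, ← h] at h2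
    have : (e.symm f).1 = (x, c • x - f) := by
      ext
      · exact h.symm
      · simp only; nth_rewrite 2 [← h2]; abel
    rw [← this]; exact (e.symm f).2

/-- Resolvents commute, by the resolvent identity. -/
lemma IsResolvent.commute {G : Submodule ℝ (H × H)} {c d : ℝ} {R Q : H →L[ℝ] H}
    (hR : IsResolvent G c R) (hQ : IsResolvent G d Q) : Commute R Q := by
  have key : ∀ {c d : ℝ} {R Q : H →L[ℝ] H}, IsResolvent G c R → IsResolvent G d Q → ∀ f,
      Q f + (d - c) • R (Q f) = R f := by
    intro c d R Q hR hQ f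
    refine (hR _ _).1 ?_
    have h1 := (hQ f _).2 rfl
    have h2 := (hR (Q f) _).2 rfl
    convert G.add_mem h1 (G.smul_mem (d - c) h2) using 1
    ext <;> simp only [Prod.fst_add, Prod.snd_add, Prod.smul_fst, Prod.smul_snd]
    module
  rcases eq_or_ne c d with rfl | hcd
  · have : R = Q := by
      ext f
      have := key hR hQ f
      simpa using this.symm
    rw [this]
  · ext f
    have h1 := key hR hQ f
    have h2 := key hQ hR f
    have h3 : (d - c) • (R (Q f) - Q (R f)) = 0 := by
      have : (d - c) • (R (Q f) - Q (R f))
        = (Q f + (d - c) • R (Q f)) + (R f + (c - d) • Q (R f)) - Q f - R f := by module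
      rw [this, h1, h2]; abel
    have := (smul_eq_zero.1 h3).resolve_left (sub_ne_zero.2 hcd.symm)
    exact sub_eq_zero.1 this

/-! ### Exponentials of bounded dissipative operators -/

lemma hasDerivAt_exp_apply [CompleteSpace H] (A : H →L[ℝ] H) (x : H) (t : ℝ) :
    HasDerivAt (fun s : ℝ => NormedSpace.exp (s • A) x) (NormedSpace.exp (t • A) (A x)) t := by
  simpa using (hasDerivAt_exp_smul_const A t).clm_apply (hasDerivAt_const t x)

lemma hasDerivAt_exp_apply' [CompleteSpace H] (A : H →L[ℝ] H) (x : H) (t : ℝ) :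
    HasDerivAt (fun s : ℝ => NormedSpace.exp (s • A) x) (A (NormedSpace.exp (t • A) x)) t := by
  simpa using (hasDerivAt_exp_smul_const' A t).clm_apply (hasDerivAt_const t x)

lemma norm_exp_apply_le [CompleteSpace H] {A : H →L[ℝ] H} {κ : ℝ}
    (hA : ∀ x, ⟪A x, x⟫ ≤ κ * ‖x‖ ^ 2) {t : ℝ} (ht : 0 ≤ t) (x : H) :
    ‖NormedSpace.exp (t • A) x‖ ≤ Real.exp (κ * t) * ‖x‖ := by
  have := norm_le_exp_mul_of_inner_deriv_le (F := fun t => NormedSpace.exp (t • A) x)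
    (fun t _ => (hasDerivAt_exp_apply' A x t).hasDerivWithinAt) (fun t _ => hA _) ht
  simpa using this

/-- Two commuting quasi-dissipative generators give close semigroups where they are close. -/
lemma norm_exp_apply_sub_le [CompleteSpace H] {A B : H →L[ℝ] H} {κ : ℝ} (hAB : Commute A B)
    (hA : ∀ x, ⟪A x, x⟫ ≤ κ * ‖x‖ ^ 2) (hB : ∀ x, ⟪B x, x⟫ ≤ κ * ‖x‖ ^ 2) {t : ℝ} (ht : 0 ≤ t)
    (x : H) :
    ‖NormedSpace.exp (t • A) x - NormedSpace.exp (t • B) x‖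
      ≤ Real.exp (κ * t) * ‖A x - B x‖ * t := by
  have hd : ∀ s, HasDerivAt
      (fun s : ℝ => NormedSpace.exp (s • A) (NormedSpace.exp ((t - s) • B) x))
      (NormedSpace.exp (s • A) (NormedSpace.exp ((t - s) • B) (A x - B x))) s := fun s => by
    have h1 : HasDerivAt (fun s : ℝ => NormedSpace.exp ((t - s) • B) x)
        (-(NormedSpace.exp ((t - s) • B) (B x))) s := by
      have := (hasDerivAt_exp_apply B x (t - s)).scomp s ((hasDerivAt_id s).const_sub t)
      simpa [Function.comp_def] using this
    have h2 := (hasDerivAt_exp_smul_const A s).clm_apply h1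
    convert h2 using 1
    have hc : A (NormedSpace.exp ((t - s) • B) x) = NormedSpace.exp ((t - s) • B) (A x) := by
      have h3 : Commute A (NormedSpace.exp ((t - s) • B)) := (hAB.smul_right _).exp_right
      exact congrArg (fun T : H →L[ℝ] H => T x) h3.eq
    rw [mul_apply_eq_comp, hc, map_sub, map_sub, map_neg, sub_eq_add_neg]
  have hb : ∀ s ∈ Icc 0 t,
      ‖NormedSpace.exp (s • A) (NormedSpace.exp ((t - s) • B) (A x - B x))‖
        ≤ Real.exp (κ * t) * ‖A x - B x‖ := fun s hs => by
    refine (norm_exp_apply_le hA hs.1 _).trans ?_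
    calc _ ≤ Real.exp (κ * s) * (Real.exp (κ * (t - s)) * ‖A x - B x‖) := by
          gcongr; exact norm_exp_apply_le hB (sub_nonneg.2 hs.2) _
      _ = _ := by rw [← mul_assoc, ← Real.exp_add]; ring_nf
  have := Convex.norm_image_sub_le_of_norm_hasDerivWithin_le
    (fun s _ => (hd s).hasDerivWithinAt) hb (convex_Icc 0 t) (left_mem_Icc.2 ht)
    (right_mem_Icc.2 ht)
  simpa [abs_of_nonneg ht] using this

/-! ### The generation theorem -/

/-- If commuting bounded operators with a common dissipativity bound converge on a dense set,
their exponentials converge strongly, locally uniformly in time. -/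
lemma uniformCauchySeqOn_exp [CompleteSpace H] {A : ℕ → H →L[ℝ] H} {κ : ℝ} (hκ : 0 ≤ κ)
    (hcomm : ∀ m n, Commute (A m) (A n)) (hA : ∀ n x, ⟪A n x, x⟫ ≤ κ * ‖x‖ ^ 2) {D : Set H}
    (hD : Dense D) (hconv : ∀ x ∈ D, ∃ y, Tendsto (fun n => A n x) atTop (𝓝 y)) (T : ℝ) (x : H) :
    UniformCauchySeqOn (fun n (t : ℝ) => NormedSpace.exp (t • A n) x) atTop (Icc 0 T) := by
  rw [Metric.uniformCauchySeqOn_iff]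
  intro ε hε
  set C := Real.exp (κ * |T|) with hC
  have hCpos : 0 < C := Real.exp_pos _
  have hCt : ∀ t ∈ Icc 0 T, Real.exp (κ * t) ≤ C := fun t ht => by
    rw [hC, Real.exp_le_exp]; exact mul_le_mul_of_nonneg_left (ht.2.trans (le_abs_self T)) hκ
  obtain ⟨x', hx', hxx'⟩ := hD.exists_dist_lt x (show 0 < ε / (4 * C) by positivity)
  obtain ⟨y, hy⟩ := hconv x' hx'
  obtain ⟨N, hN⟩ := Metric.cauchySeq_iff.1 hy.cauchySeq (ε / (4 * C * (|T| + 1))) (by positivity)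
  refine ⟨N, fun m hm n hn t ht => ?_⟩
  rw [dist_eq_norm] at hxx' ⊢
  have h1 : ∀ k, ‖NormedSpace.exp (t • A k) (x - x')‖ ≤ ε / 4 := fun k => by
    refine (norm_exp_apply_le (hA k) ht.1 _).trans ?_
    calc _ ≤ C * (ε / (4 * C)) := by gcongr; exact hCt t ht
      _ = ε / 4 := by field_simp
  have h2 : ‖NormedSpace.exp (t • A m) x' - NormedSpace.exp (t • A n) x'‖ ≤ ε / 4 := by
    refine (norm_exp_apply_sub_le (hcomm m n) (hA m) (hA n) ht.1 x').trans ?_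
    have h3 := hN m hm n hn
    rw [dist_eq_norm] at h3
    calc _ ≤ C * (ε / (4 * C * (|T| + 1))) * (|T| + 1) := by
          have : t ≤ |T| + 1 := by linarith [ht.2, le_abs_self T]
          have := hCt t ht
          have := ht.1
          gcongr
      _ = ε / 4 := by field_simp
  have h4 : NormedSpace.exp (t • A m) x - NormedSpace.exp (t • A n) x
      = NormedSpace.exp (t • A m) (x - x') - NormedSpace.exp (t • A n) (x - x')
        + (NormedSpace.exp (t • A m) x' - NormedSpace.exp (t • A n) x') := by
    simp only [map_sub]; abel
  rw [h4]
  have h5 := norm_add_le (NormedSpace.exp (t • A m) (x - x')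
    - NormedSpace.exp (t • A n) (x - x'))
    (NormedSpace.exp (t • A m) x' - NormedSpace.exp (t • A n) x')
  have h6 := norm_sub_le (NormedSpace.exp (t • A m) (x - x'))
    (NormedSpace.exp (t • A n) (x - x'))
  linarith [h1 m, h1 n]

/-- The limit semigroup of commuting exponentials: strongly continuous, of growth `exp (κ t)`, and
with `S t x - x = ∫₀ᵗ S s y ds` whenever `A n x → y`. -/
lemma exists_limit_semigroup [CompleteSpace H] {A : ℕ → H →L[ℝ] H} {κ : ℝ} (hκ : 0 ≤ κ)
    (hcomm : ∀ m n, Commute (A m) (A n)) (hA : ∀ n x, ⟪A n x, x⟫ ≤ κ * ‖x‖ ^ 2) {D : Set H}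
    (hD : Dense D) (hconv : ∀ x ∈ D, ∃ y, Tendsto (fun n => A n x) atTop (𝓝 y)) :
    ∃ S : ℝ → H →L[ℝ] H, S 0 = ContinuousLinearMap.id ℝ H ∧
      (∀ s t, 0 ≤ s → 0 ≤ t → S (s + t) = S s ∘L S t) ∧
      (∀ t, 0 ≤ t → ∀ x, ‖S t x‖ ≤ Real.exp (κ * t) * ‖x‖) ∧
      (∀ x, ContinuousOn (fun t => S t x) (Ici 0)) ∧
      ∀ x y, Tendsto (fun n => A n x) atTop (𝓝 y) → ∀ t, 0 ≤ t →
        ∫ s in (0 : ℝ)..t, S s y = S t x - x := by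
  have hcauchy := uniformCauchySeqOn_exp hκ hcomm hA hD hconv
  have hex : ∀ t : ℝ, 0 ≤ t → ∃ T : H →L[ℝ] H,
      ∀ x, Tendsto (fun n => NormedSpace.exp (t • A n) x) atTop (𝓝 (T x)) := fun t ht => by
    have hl : ∀ x, ∃ y, Tendsto (fun n => NormedSpace.exp (t • A n) x) atTop (𝓝 y) := fun x =>
      cauchySeq_tendsto_of_complete ((hcauchy t x).cauchySeq (right_mem_Icc.2 ht))
    choose f hf using hl
    exact ⟨continuousLinearMapOfTendsto (fun n => NormedSpace.exp (t • A n))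
      (tendsto_pi_nhds.2 hf), hf⟩
  choose! S hS using hex
  have hbound : ∀ t, 0 ≤ t → ∀ x, ‖S t x‖ ≤ Real.exp (κ * t) * ‖x‖ := fun t ht x =>
    le_of_tendsto (hS t ht x).norm (Eventually.of_forall fun n => norm_exp_apply_le (hA n) ht x)
  have hunif : ∀ x T, TendstoUniformlyOn (fun n (t : ℝ) => NormedSpace.exp (t • A n) x)
      (fun t => S t x) atTop (Icc 0 T) := fun x T =>
    (hcauchy T x).tendstoUniformlyOn_of_tendsto fun t ht => hS t ht.1 x
  have hcont : ∀ x, ContinuousOn (fun t => S t x) (Ici 0) := fun x t ht => by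
    have h1 : ContinuousOn (fun t => S t x) (Icc 0 (t + 1)) :=
      (hunif x (t + 1)).continuousOn (Frequently.of_forall fun n s _ =>
        (hasDerivAt_exp_apply (A n) x s).continuousAt.continuousWithinAt)
    refine (h1 t ⟨ht, by linarith⟩).mono_of_mem_nhdsWithin ?_
    filter_upwards [self_mem_nhdsWithin, mem_nhdsWithin_of_mem_nhds (Iio_mem_nhds (lt_add_one t))]
      with s hs hs' using ⟨hs, le_of_lt hs'⟩
  refine ⟨S, ?_, ?_, hbound, hcont, ?_⟩
  · ext x
    refine tendsto_nhds_unique (hS 0 le_rfl x) ?_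
    simp
  · intro s t hs ht
    ext x
    refine tendsto_nhds_unique (hS (s + t) (add_nonneg hs ht) x) ?_
    have h1 : ∀ n, NormedSpace.exp ((s + t) • A n) x
        = NormedSpace.exp (s • A n) (NormedSpace.exp (t • A n) x - S t x)
          + NormedSpace.exp (s • A n) (S t x) := fun n => by
      let _ : NormedAlgebra ℚ (H →L[ℝ] H) := NormedAlgebra.restrictScalars ℚ ℝ _
      rw [add_smul, NormedSpace.exp_add_of_commute
        (((Commute.refl (A n)).smul_left s).smul_right t), map_sub]
      simp
    simp only [h1]
    have h2 : Tendsto (fun n => NormedSpace.exp (s • A n)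
        (NormedSpace.exp (t • A n) x - S t x)) atTop (𝓝 0) := by
      refine squeeze_zero_norm (fun n => norm_exp_apply_le (hA n) hs _) ?_
      have h3 := ((hS t ht x).sub_const (S t x)).norm.const_mul (Real.exp (κ * s))
      simpa using h3
    simpa using h2.add (hS s hs (S t x))
  · intro x y hy t ht
    have h1 : ∀ n, ∫ s in (0 : ℝ)..t, NormedSpace.exp (s • A n) (A n x)
        = NormedSpace.exp (t • A n) x - x := fun n => by
      rw [intervalIntegral.integral_eq_sub_of_hasDerivAt
        (fun s _ => hasDerivAt_exp_apply (A n) x s)]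
      · simp
      · refine Continuous.intervalIntegrable ?_ _ _
        exact continuous_iff_continuousAt.2 fun s =>
          (hasDerivAt_exp_apply (A n) (A n x) s).continuousAt
    obtain ⟨B, hB⟩ := hy.norm.bddAbove_range
    have hB' : ∀ n, ‖A n x‖ ≤ B := fun n => hB ⟨n, rfl⟩
    have h2 : Tendsto (fun n => ∫ s in (0 : ℝ)..t, NormedSpace.exp (s • A n) (A n x)) atTop
        (𝓝 (∫ s in (0 : ℝ)..t, S s y)) := by
      refine intervalIntegral.tendsto_integral_filter_of_dominated_convergence
        (fun _ => Real.exp (κ * t) * B) ?_ ?_ (by simp) ?_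
      · refine Eventually.of_forall fun n => Continuous.aestronglyMeasurable ?_
        exact continuous_iff_continuousAt.2 fun s =>
          (hasDerivAt_exp_apply (A n) (A n x) s).continuousAt
      · refine Eventually.of_forall fun n => Eventually.of_forall fun s hs => ?_
        rw [uIoc_of_le ht] at hs
        refine (norm_exp_apply_le (hA n) hs.1.le _).trans ?_
        have := hs.2
        gcongr
        exact hB' n
      · refine Eventually.of_forall fun s hs => ?_
        rw [uIoc_of_le ht] at hs
        have h3 : Tendsto (fun n => NormedSpace.exp (s • A n) (A n x - y)) atTop (𝓝 0) := by
          refine squeeze_zero_norm (fun n => norm_exp_apply_le (hA n) hs.1.le _) ?_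
          simpa using (hy.sub_const y).norm.const_mul (Real.exp (κ * s))
        simpa using h3.add (hS s hs.1.le y)
    simp only [h1] at h2
    exact tendsto_nhds_unique h2 ((hS t ht x).sub_const x)

/-- In a Hilbert space the domain of a quasi-dissipative operator with a resolvent is dense: for
`z` orthogonal to the domain, dissipativity at `x = (c - A)⁻¹ z` gives `x = 0`, hence `z = 0`. -/
lemma QuasiDissipative.dense_domain [CompleteSpace H] {κ c : ℝ} {G : Submodule ℝ (H × H)}
    (hG : QuasiDissipative κ G) (hsv : ∀ y, ((0 : H), y) ∈ G → y = 0) (hc : κ < c)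
    {R : H →L[ℝ] H} (hR : IsResolvent G c R) : Dense {x : H | ∃ y, (x, y) ∈ G} := by
  have hset : {x : H | ∃ y, (x, y) ∈ G} = (G.map (LinearMap.fst ℝ H H) : Set H) := by
    ext x; simp
  rw [hset, Submodule.dense_iff_topologicalClosure_eq_top, Submodule.topologicalClosure_eq_top_iff,
    Submodule.eq_bot_iff]
  intro z hz
  have hz' : ∀ x y : H, (x, y) ∈ G → ⟪x, z⟫ = 0 := fun x y hxy =>
    (Submodule.mem_orthogonal _ _).1 hz _ ⟨(x, y), hxy, rfl⟩
  have h1 := (hR z _).2 rfl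
  have h2 := hG _ _ h1
  rw [inner_sub_left, real_inner_smul_left, real_inner_self_eq_norm_sq, real_inner_comm (R z) z,
    hz' _ _ h1, sub_zero] at h2
  have h3 : R z = 0 := by
    by_contra hne
    have : 0 < ‖R z‖ ^ 2 := by have := norm_pos_iff.2 hne; positivity
    nlinarith
  rw [h3, smul_zero, zero_sub] at h1
  simpa using hsv _ h1

/-- Yosida approximation: `c (c - A)⁻¹ → 1` strongly as `c → ∞`. -/
lemma tendsto_smul_resolvent {κ : ℝ} {G : Submodule ℝ (H × H)} {c : ℕ → ℝ}
    {R : ℕ → H →L[ℝ] H} (hκ : 0 ≤ κ) (hc : ∀ n, 2 * κ < c n) (hct : Tendsto c atTop atTop)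
    (hR : ∀ n, IsResolvent G (c n) (R n)) (hRb : ∀ n f, ‖R n f‖ ≤ (c n - κ)⁻¹ * ‖f‖)
    (hD : Dense {x : H | ∃ y, (x, y) ∈ G}) (y : H) :
    Tendsto (fun n => c n • R n y) atTop (𝓝 y) := by
  have hpos : ∀ n, 0 < c n - κ := fun n => by linarith [hc n]
  have hb : ∀ n f, ‖c n • R n f‖ ≤ 2 * ‖f‖ := fun n f => by
    rw [norm_smul, Real.norm_eq_abs, abs_of_nonneg (by linarith [hc n])]
    have h1 := hRb n f
    rw [← div_eq_inv_mul, le_div_iff₀ (hpos n)] at h1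
    have h2 := norm_nonneg (R n f)
    nlinarith [hc n]
  rw [Metric.tendsto_atTop]
  intro ε hε
  obtain ⟨x, ⟨z, hxz⟩, hyx⟩ := hD.exists_dist_lt y (show 0 < ε / 4 by positivity)
  have hx : ∀ n, c n • R n x - x = R n z := fun n => by
    have : x = R n (c n • x - z) := (hR n _ _).1 (by simpa using hxz)
    nth_rewrite 2 [this]
    rw [map_sub, map_smul]; abel
  have ht : Tendsto (fun n => (c n - κ)⁻¹ * ‖z‖) atTop (𝓝 0) := by
    have h := (tendsto_inv_atTop_zero.comp
      (tendsto_atTop_add_const_right atTop (-κ) hct)).mul_const ‖z‖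
    simpa [Function.comp_def, sub_eq_add_neg] using h
  obtain ⟨N, hN⟩ := Metric.tendsto_atTop.1 ht (ε / 4) (by positivity)
  refine ⟨N, fun n hn => ?_⟩
  have h1 := (le_abs_self _).trans_lt ((Real.dist_0_eq_abs _).symm.trans_lt (hN n hn))
  rw [dist_eq_norm] at hyx ⊢
  have h2 : c n • R n y - y = c n • R n (y - x) + (c n • R n x - x) - (y - x) := by
    rw [map_sub]; module
  rw [h2, hx]
  have h3 := norm_sub_le (c n • R n (y - x) + R n z) (y - x)
  have h4 := norm_add_le (c n • R n (y - x)) (R n z)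
  linarith [hb n (y - x), hRb n z]

/-- **Generation theorem** in a Hilbert space: a closed quasi-dissipative operator, given by its
graph `G`, such that `c - A` has dense range for large `c`, generates a strongly continuous
semigroup. -/
theorem exists_semigroup_of_quasiDissipative [CompleteSpace H] {κ : ℝ} {G : Submodule ℝ (H × H)}
    (hκ : 0 ≤ κ) (hG : QuasiDissipative κ G) (hcl : IsClosed (G : Set (H × H)))
    (hsv : ∀ y, ((0 : H), y) ∈ G → y = 0)
    (hdense : ∀ c, κ < c → ∀ g : H, (∀ x y : H, (x, y) ∈ G → ⟪c • x - y, g⟫ = 0) → g = 0) :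
    ∃ S : ℝ → H →L[ℝ] H, IsC0Semigroup S ∧ (∀ x, ContinuousOn (fun t => S t x) (Ici 0)) ∧
      ∀ x y : H, (x, y) ∈ G ↔ Tendsto (fun t : ℝ => t⁻¹ • (S t x - x)) (𝓝[>] 0) (𝓝 y) := by
  set c : ℕ → ℝ := fun n => 2 * κ + 1 + n with hcdef
  have hc2 : ∀ n, 2 * κ < c n := fun n => by
    have : (0 : ℝ) ≤ n := Nat.cast_nonneg n
    simp only [hcdef]; linarith
  have hc : ∀ n, κ < c n := fun n => by linarith [hc2 n]
  have hct : Tendsto c atTop atTop :=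
    tendsto_atTop_add_const_left _ _ tendsto_natCast_atTop_atTop
  choose R hR hRb using fun n => exists_resolvent hG hcl (hc n) (hdense _ (hc n))
  have hD := hG.dense_domain hsv (hc 0) (hR 0)
  have hone := tendsto_smul_resolvent hκ hc2 hct hR hRb hD
  -- The Yosida approximations `c A (c - A)⁻¹ = c² (c - A)⁻¹ - c`.
  let A : ℕ → H →L[ℝ] H := fun n => (c n) ^ 2 • R n - c n • (1 : H →L[ℝ] H)
  have hAx : ∀ n x, A n x = (c n) ^ 2 • R n x - c n • x := fun n x => rfl
  have hcomm : ∀ m n, Commute (A m) (A n) := fun m n => by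
    have h := (hR m).commute (hR n)
    refine ((h.smul_left _).smul_right _ |>.sub_right ?_).sub_left (Commute.sub_right ?_ ?_)
    · exact ((Commute.one_right _).smul_right _).smul_left _
    · exact ((Commute.one_left _).smul_left _).smul_right _
    · exact ((Commute.one_left _).smul_left _).smul_right _
  have hA : ∀ n x, ⟪A n x, x⟫ ≤ 2 * κ * ‖x‖ ^ 2 := fun n x => by
    rw [hAx, inner_sub_left, real_inner_smul_left, real_inner_smul_left,
      real_inner_self_eq_norm_sq]
    have h1 : ⟪R n x, x⟫ ≤ (c n - κ)⁻¹ * ‖x‖ ^ 2 := by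
      refine (real_inner_le_norm _ _).trans ?_
      have := mul_le_mul_of_nonneg_right (hRb n x) (norm_nonneg x)
      linarith
    have h2 : (c n) ^ 2 * (c n - κ)⁻¹ ≤ c n + 2 * κ := by
      rw [← div_eq_mul_inv, div_le_iff₀ (by linarith [hc n])]
      nlinarith [hc2 n]
    have h3 : (c n) ^ 2 * ⟪R n x, x⟫ ≤ (c n) ^ 2 * ((c n - κ)⁻¹ * ‖x‖ ^ 2) := by gcongr
    nlinarith [sq_nonneg ‖x‖]
  have hAG : ∀ x y, (x, y) ∈ G → Tendsto (fun n => A n x) atTop (𝓝 y) := fun x y hxy => by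
    refine (hone y).congr fun n => ?_
    have : x = R n (c n • x - y) := (hR n _ _).1 (by simpa using hxy)
    rw [hAx]
    nth_rewrite 2 [this]
    rw [map_sub, map_smul]; module
  obtain ⟨S, hS0, hSadd, hSb, hScont, hSint⟩ := exists_limit_semigroup (by positivity) hcomm hA hD
    fun x ⟨y, hxy⟩ => ⟨y, hAG x y hxy⟩
  have hgen : ∀ x y, (x, y) ∈ G → Tendsto (fun t : ℝ => t⁻¹ • (S t x - x)) (𝓝[>] 0) (𝓝 y) := by
    intro x y hxy
    have h1 : HasDerivWithinAt (fun t => ∫ s in (0 : ℝ)..t, S s y) (S 0 y) (Ioi 0) 0 := by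
      refine (intervalIntegral.integral_hasDerivWithinAt_right (s := Ici 0) (t := Ioi 0) (by simp)
        ?_ ?_).mono Ioi_subset_Ici_self
      · exact ⟨Ioi 0, self_mem_nhdsWithin,
          ((hScont y).mono Ioi_subset_Ici_self).aestronglyMeasurable measurableSet_Ioi⟩
      · exact ((hScont y) 0 (mem_Ici.2 le_rfl)).mono Ioi_subset_Ici_self
    rw [hasDerivWithinAt_iff_tendsto_slope' (by simp)] at h1
    rw [hS0] at h1
    refine h1.congr' ?_
    filter_upwards [self_mem_nhdsWithin] with t ht
    rw [slope_def_module, hSint x y (hAG x y hxy) t (le_of_lt ht)]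
    simp
  refine ⟨S, ⟨hS0, hSadd, fun x => ?_⟩, hScont, fun x y => ⟨hgen x y, fun h => ?_⟩⟩
  · have := (hScont x 0 (mem_Ici.2 le_rfl)).tendsto
    simp only [hS0] at this
    exact this.mono_left (nhdsWithin_mono _ Ioi_subset_Ici_self)
  · -- Compare with the element of the domain that has the same image under `c - A`.
    set x' := R 0 (c 0 • x - y) with hx'
    have h1 := (hR 0 (c 0 • x - y) x').2 rfl
    have h2 := h.sub (hgen _ _ h1)
    have h3 : Tendsto (fun t : ℝ => t⁻¹ • (S t (x - x') - (x - x'))) (𝓝[>] 0)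
        (𝓝 (c 0 • (x - x'))) := by
      convert h2 using 2
      · rw [map_sub]; module
      · module
    have h4 := h3.inner (𝕜 := ℝ) (tendsto_const_nhds (x := x - x'))
    have h5 : Tendsto (fun t : ℝ => t⁻¹ * (Real.exp (2 * κ * t) - 1) * ‖x - x'‖ ^ 2) (𝓝[>] 0)
        (𝓝 (2 * κ * ‖x - x'‖ ^ 2)) := by
      refine Tendsto.mul_const _ ?_
      have h6 : HasDerivAt (fun t : ℝ => Real.exp (2 * κ * t)) (2 * κ) 0 := by
        have := ((hasDerivAt_id (0 : ℝ)).const_mul (2 * κ)).exp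
        simpa using this
      have h7 := (hasDerivWithinAt_iff_tendsto_slope' (s := Ioi 0) (by simp)).1 h6.hasDerivWithinAt
      refine h7.congr fun t => ?_
      rw [slope_def_module]; simp
    have h8 : ⟪c 0 • (x - x'), x - x'⟫ ≤ 2 * κ * ‖x - x'‖ ^ 2 := by
      refine le_of_tendsto_of_tendsto h4 h5 ?_
      filter_upwards [self_mem_nhdsWithin] with t ht
      have ht' : (0 : ℝ) < t := ht
      rw [real_inner_smul_left, inner_sub_left, real_inner_self_eq_norm_sq, mul_assoc]
      gcongr
      have h9 := (real_inner_le_norm (S t (x - x')) (x - x')).trans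
        (mul_le_mul_of_nonneg_right (hSb t ht'.le (x - x')) (norm_nonneg _))
      nlinarith
    rw [real_inner_smul_left, real_inner_self_eq_norm_sq] at h8
    have h10 : x - x' = 0 := by
      by_contra hne
      have : 0 < ‖x - x'‖ ^ 2 := by have := norm_pos_iff.2 hne; positivity
      nlinarith [hc2 0]
    rw [← sub_eq_zero.1 h10] at h1
    simpa using h1

end Semigroup

section Semigroup

/-! ### Classical and integrated solutions -/

lemma intervalIntegrable_of_continuousOn_Ici {X : Type*} [NormedAddCommGroup X] {f : ℝ → X}
    (hf : ContinuousOn f (Ici 0)) {s t : ℝ} (hs : 0 ≤ s) (ht : 0 ≤ t) :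
    IntervalIntegrable f volume s t :=
  (hf.mono fun _ hx => (le_min hs ht).trans hx.1).intervalIntegrable

variable {X : Type*} [NormedAddCommGroup X] [NormedSpace ℝ X]

lemma hasDerivWithinAt_integral_Ici [CompleteSpace X] {f : ℝ → X} (hf : ContinuousOn f (Ici 0))
    {t : ℝ} (ht : 0 ≤ t) : HasDerivWithinAt (fun t => ∫ s in (0 : ℝ)..t, f s) (f t) (Ici 0) t := by
  have hg : Continuous fun s => f (max 0 s) :=
    hf.comp_continuous (by fun_prop) fun s => mem_Ici.2 (le_max_left _ _)
  have h := (hg.integral_hasStrictDerivAt 0 t).hasDerivAt.hasDerivWithinAt (s := Ici 0)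
  simp only [max_eq_right ht] at h
  have e : ∀ x ∈ Ici (0 : ℝ), ∫ s in (0 : ℝ)..x, f s = ∫ s in (0 : ℝ)..x, f (max 0 s) :=
    fun x hx => by
      refine intervalIntegral.integral_congr fun s hs => ?_
      rw [uIcc_of_le hx] at hs
      simp only [max_eq_right hs.1]
  exact h.congr e (e t ht)

/-- `S` is a strongly continuous semigroup, continuous on `[0, ∞)`, whose generator has the
graph `G`. -/
structure GeneratedBy (G : Submodule ℝ (X × X)) (S : ℝ → X →L[ℝ] X) : Prop where
  semigroup : IsC0Semigroup S
  continuousOn : ∀ x, ContinuousOn (fun t => S t x) (Ici 0)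
  mem_iff : ∀ x y : X, (x, y) ∈ G ↔ Tendsto (fun t : ℝ => t⁻¹ • (S t x - x)) (𝓝[>] 0) (𝓝 y)

variable {G : Submodule ℝ (X × X)} {S : ℝ → X →L[ℝ] X}

lemma GeneratedBy.mem_orbit (h : GeneratedBy G S) {x y : X} (hxy : (x, y) ∈ G) {t : ℝ}
    (ht : 0 ≤ t) : (S t x, S t y) ∈ G := by
  rw [h.mem_iff] at hxy ⊢
  refine (((S t).continuous.tendsto y).comp hxy).congr' ?_
  filter_upwards [self_mem_nhdsWithin] with s hs
  have e : S s (S t x) = S t (S s x) := by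
    rw [← ContinuousLinearMap.comp_apply, ← ContinuousLinearMap.comp_apply,
      ← h.semigroup.add s t (le_of_lt hs) ht, ← h.semigroup.add t s ht (le_of_lt hs), add_comm]
  rw [e]
  simp

/-- Orbits starting in the domain are continuously differentiable: the right derivative of the
orbit of `x` is the orbit of `A x`, which is continuous. -/
lemma GeneratedBy.hasDerivWithinAt [CompleteSpace X] (h : GeneratedBy G S) {x y : X}
    (hxy : (x, y) ∈ G) {t : ℝ} (ht : 0 ≤ t) :
    HasDerivWithinAt (fun t => S t x) (S t y) (Ici 0) t := by
  have hright : ∀ s, 0 ≤ s → HasDerivWithinAt (fun t => S t x) (S s y) (Ioi s) s := fun s hs => by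
    rw [hasDerivWithinAt_iff_tendsto_slope' (by simp)]
    have h1 := ((S s).continuous.tendsto y).comp ((h.mem_iff x y).1 hxy)
    have h2 : Tendsto (fun t => t - s) (𝓝[>] s) (𝓝[>] 0) := by
      refine tendsto_nhdsWithin_iff.2 ⟨?_, ?_⟩
      · have : Tendsto (fun t : ℝ => t - s) (𝓝 s) (𝓝 (s - s)) := tendsto_id.sub_const s
        rw [sub_self] at this
        exact this.mono_left nhdsWithin_le_nhds
      · filter_upwards [self_mem_nhdsWithin] with t ht using sub_pos.2 (show s < t from ht)
    refine (h1.comp h2).congr' ?_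
    filter_upwards [self_mem_nhdsWithin] with t ht
    have ht' : s < t := ht
    have e : S t x = S s (S (t - s) x) := by
      rw [← ContinuousLinearMap.comp_apply, ← h.semigroup.add s (t - s) hs (sub_pos.2 ht').le,
        add_sub_cancel]
    rw [slope_def_module, e]
    simp
  have hint : ∀ s, 0 ≤ s → S s x = x + ∫ τ in (0 : ℝ)..s, S τ y := fun s hs => by
    rw [intervalIntegral.integral_eq_sub_of_hasDeriv_right (f := fun t => S t x)
      ((h.continuousOn x).mono fun τ hτ => ?_) (fun τ hτ => hright τ ?_)
      (intervalIntegrable_of_continuousOn_Ici (h.continuousOn y) le_rfl hs), h.semigroup.zero]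
    · simp
    · rw [uIcc_of_le hs] at hτ; exact hτ.1
    · rw [min_eq_left hs] at hτ; exact hτ.1.le
  exact ((hasDerivWithinAt_integral_Ici (h.continuousOn y) ht).const_add x).congr
    hint (hint t ht)

/-- The integrated orbit `∫₀ᵗ S s x ds` lies in the domain, and the generator maps it to
`S t x - x`. -/
lemma GeneratedBy.mem_integral [CompleteSpace X] (h : GeneratedBy G S) (x : X) {t : ℝ}
    (ht : 0 ≤ t) : (∫ s in (0 : ℝ)..t, S s x, S t x - x) ∈ G := by
  rw [h.mem_iff]
  have hc := h.continuousOn x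
  have hI : ∀ {p q : ℝ}, 0 ≤ p → 0 ≤ q → IntervalIntegrable (fun s => S s x) volume p q :=
    fun hp hq => intervalIntegrable_of_continuousOn_Ici hc hp hq
  have hslope : ∀ s, 0 ≤ s →
      Tendsto (fun r : ℝ => r⁻¹ • ∫ τ in s..(s + r), S τ x) (𝓝[>] 0) (𝓝 (S s x)) := fun s hs => by
    have h1 := (hasDerivWithinAt_integral_Ici hc hs).mono
      (Ioi_subset_Ici_self.trans (Ici_subset_Ici.2 hs) : Ioi s ⊆ Ici 0)
    rw [hasDerivWithinAt_iff_tendsto_slope' (by simp)] at h1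
    have h2 : Tendsto (fun r => s + r) (𝓝[>] (0 : ℝ)) (𝓝[>] s) := by
      refine tendsto_nhdsWithin_iff.2 ⟨?_, ?_⟩
      · have : Tendsto (fun r : ℝ => s + r) (𝓝 0) (𝓝 (s + 0)) := tendsto_id.const_add s
        rw [add_zero] at this
        exact this.mono_left nhdsWithin_le_nhds
      · filter_upwards [self_mem_nhdsWithin] with t ht using lt_add_of_pos_right s ht
    refine (h1.comp h2).congr' ?_
    filter_upwards [self_mem_nhdsWithin] with r hr
    have hr' : (0 : ℝ) < r := hr
    rw [Function.comp_apply, slope_def_module,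
      intervalIntegral.integral_interval_sub_left (hI le_rfl (by positivity)) (hI le_rfl hs),
      add_sub_cancel_left]
  have h3 := (hslope t ht).sub (hslope 0 le_rfl)
  rw [h.semigroup.zero, ContinuousLinearMap.id_apply] at h3
  refine h3.congr' ?_
  filter_upwards [self_mem_nhdsWithin] with r hr
  have hr' : (0 : ℝ) ≤ r := le_of_lt hr
  rw [← smul_sub]
  congr 1
  have e1 : S r (∫ s in (0 : ℝ)..t, S s x) = ∫ s in r..(t + r), S s x := by
    rw [← ContinuousLinearMap.intervalIntegral_comp_comm _ (hI le_rfl ht)]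
    have : ∫ s in (0 : ℝ)..t, S r (S s x) = ∫ s in (0 : ℝ)..t, S (s + r) x := by
      refine intervalIntegral.integral_congr fun s hs => ?_
      rw [uIcc_of_le ht] at hs
      rw [add_comm, h.semigroup.add r s hr' hs.1, ContinuousLinearMap.comp_apply]
    rw [this, intervalIntegral.integral_comp_add_right (fun s => S s x), zero_add]
  rw [e1, zero_add,
    ← intervalIntegral.integral_add_adjacent_intervals (hI le_rfl hr') (hI hr' ht),
    ← intervalIntegral.integral_add_adjacent_intervals (hI hr' ht) (hI ht (by positivity))]
  abel

variable {H : Type*} [NormedAddCommGroup H] [InnerProductSpace ℝ H]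

/-- Uniqueness for `V' = A V` by the energy `‖T V‖²`. -/
lemma eqOn_zero_of_hasDerivWithinAt {T : X ≃L[ℝ] H} {κ : ℝ}
    (hdis : ∀ x y, (x, y) ∈ G → ⟪T y, T x⟫ ≤ κ * ‖T x‖ ^ 2) {V V' : ℝ → X} (h0 : V 0 = 0)
    (hV : ∀ t, 0 ≤ t → (V t, V' t) ∈ G ∧ HasDerivWithinAt V (V' t) (Ici 0) t) {t : ℝ}
    (ht : 0 ≤ t) : V t = 0 := by
  have h1 := norm_le_exp_mul_of_inner_deriv_le (F := fun t => T (V t)) (F' := fun t => T (V' t))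
    (fun t ht => (T : X →L[ℝ] H).hasFDerivAt.comp_hasDerivWithinAt t (hV t ht).2)
    (fun t ht => hdis _ _ (hV t ht).1) ht
  rw [h0, map_zero, norm_zero, mul_zero] at h1
  simpa using h1

lemma GeneratedBy.isClassicalSolution [CompleteSpace X] {A : X →ₗ.[ℝ] X}
    (h : GeneratedBy A.graph S) {x : X} (hx : x ∈ A.domain) :
    IsClassicalSolution A x (fun t => S t x) := by
  have hg : (x, A ⟨x, hx⟩) ∈ A.graph := A.mem_graph ⟨x, hx⟩
  exact ⟨by simp [h.semigroup.zero], h.continuousOn x, fun t => S t (A ⟨x, hx⟩),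
    h.continuousOn _, fun t ht => ⟨h.mem_orbit hg ht, h.hasDerivWithinAt hg ht⟩⟩

lemma IsClassicalSolution.eqOn {A : X →ₗ.[ℝ] X} {T : X ≃L[ℝ] H} {κ : ℝ}
    (hdis : ∀ x y, (x, y) ∈ A.graph → ⟪T y, T x⟫ ≤ κ * ‖T x‖ ^ 2) {x : X} {U V : ℝ → X}
    (hU : IsClassicalSolution A x U) (hV : IsClassicalSolution A x V) : EqOn U V (Ici 0) := by
  obtain ⟨hU0, -, F, -, hF⟩ := hU
  obtain ⟨hV0, -, K, -, hK⟩ := hV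
  intro t ht
  refine sub_eq_zero.1 (eqOn_zero_of_hasDerivWithinAt hdis (V := fun t => U t - V t)
    (V' := fun t => F t - K t) (by simp [hU0, hV0]) (fun t ht => ⟨?_, ?_⟩) ht)
  · exact A.graph.sub_mem (hF t ht).1 (hK t ht).1
  · exact (hF t ht).2.sub (hK t ht).2

/-- Uniqueness of integrated solutions: the primitive of the difference of two of them is a
classical solution with zero initial value. -/
lemma eqOn_of_integral_mem [CompleteSpace X] {T : X ≃L[ℝ] H} {κ : ℝ}
    (hdis : ∀ x y, (x, y) ∈ G → ⟪T y, T x⟫ ≤ κ * ‖T x‖ ^ 2) {x : X} {U V : ℝ → X}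
    (hU : ContinuousOn U (Ici 0)) (hV : ContinuousOn V (Ici 0))
    (hUG : ∀ t, 0 ≤ t → (∫ s in (0 : ℝ)..t, U s, U t - x) ∈ G)
    (hVG : ∀ t, 0 ≤ t → (∫ s in (0 : ℝ)..t, V s, V t - x) ∈ G) : EqOn U V (Ici 0) := by
  have hW : ∀ t, 0 ≤ t →
      HasDerivWithinAt (fun t => ∫ s in (0 : ℝ)..t, (U s - V s)) (U t - V t) (Ici 0) t :=
    fun t ht => hasDerivWithinAt_integral_Ici (hU.sub hV) ht
  have hz : ∀ t, 0 ≤ t → ∫ s in (0 : ℝ)..t, (U s - V s) = 0 := fun t ht => by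
    refine eqOn_zero_of_hasDerivWithinAt hdis (V := fun t => ∫ s in (0 : ℝ)..t, (U s - V s))
      (V' := fun t => U t - V t) (by simp) (fun t ht => ⟨?_, hW t ht⟩) ht
    convert G.sub_mem (hUG t ht) (hVG t ht) using 1
    ext
    · simp only [Prod.fst_sub]
      exact intervalIntegral.integral_sub (intervalIntegrable_of_continuousOn_Ici hU le_rfl ht)
        (intervalIntegrable_of_continuousOn_Ici hV le_rfl ht)
    · simp
  intro t ht
  have h1 := ((hasDerivWithinAt_const t (Ici 0) (0 : X)).congr hz (hz t ht))
  exact sub_eq_zero.1 ((uniqueDiffOn_Ici 0 t ht).eq_deriv _ (hW t ht) h1)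

/-- The generation theorem for an operator that is quasi-dissipative with respect to the inner
product pulled back from a Hilbert space along an isomorphism `T`. -/
theorem exists_generatedBy [CompleteSpace H] {T : X ≃L[ℝ] H} {κ : ℝ} (hκ : 0 ≤ κ)
    (hdis : ∀ x y, (x, y) ∈ G → ⟪T y, T x⟫ ≤ κ * ‖T x‖ ^ 2) (hcl : IsClosed (G : Set (X × X)))
    (hsv : ∀ y, ((0 : X), y) ∈ G → y = 0)
    (hdense : ∀ c, κ < c → ∀ g : H, (∀ x y : X, (x, y) ∈ G → ⟪T (c • x - y), g⟫ = 0) → g = 0) :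
    ∃ S : ℝ → X →L[ℝ] X, GeneratedBy G S := by
  let P : H × H →L[ℝ] X × X :=
    (T.symm : H →L[ℝ] X).prodMap (T.symm : H →L[ℝ] X)
  let G' : Submodule ℝ (H × H) := G.comap (P : H × H →ₗ[ℝ] X × X)
  have hG' : ∀ x y, (x, y) ∈ G' ↔ (T.symm x, T.symm y) ∈ G := fun x y => Iff.rfl
  obtain ⟨S, hS, hcont, hgen⟩ := exists_semigroup_of_quasiDissipative (G := G') hκ
    (fun x y hxy => by simpa using hdis _ _ hxy) (hcl.preimage P.continuous)
    (fun y hy => by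
      rw [hG', map_zero] at hy
      simpa using hsv _ hy)
    (fun c hc g hg => hdense c hc g fun x y hxy => by
      have := hg (T x) (T y) (by rw [hG']; simpa using hxy)
      simpa using this)
  refine ⟨fun t => (T.symm : H →L[ℝ] X) ∘L S t ∘L (T : X →L[ℝ] H), ⟨?_, ?_, ?_⟩, ?_, ?_⟩
  · ext x; simp [hS.zero]
  · intro s t hs ht
    ext x; simp [hS.add s t hs ht]
  · intro x
    have := (T.symm.continuous.tendsto _).comp (hS.tendsto (T x))
    simpa [Function.comp_def] using this
  · intro x
    exact T.symm.continuous.comp_continuousOn (hcont (T x))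
  · intro x y
    have h1 : (x, y) ∈ G ↔ (T x, T y) ∈ G' := by rw [hG']; simp
    rw [h1, hgen]
    constructor
    · intro h
      have := (T.symm.continuous.tendsto _).comp h
      simpa [Function.comp_def] using this
    · intro h
      have := (T.continuous.tendsto _).comp h
      simpa [Function.comp_def] using this

end Semigroup

section WeightedSpace

variable {b : ℝ}

/-! ### The weighted space and its pairings -/

instance isLocallyFiniteMeasure_katoMeasure (b : ℝ) : IsLocallyFiniteMeasure (katoMeasure b) :=
  IsLocallyFiniteMeasure.withDensity_ofReal (by fun_prop)

lemma integrable_katoMeasure {f : ℝ → ℝ} : Integrable f (katoMeasure b) ↔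
    IntegrableOn (fun x => Real.exp (2 * b * x) * f x) (Ioi 0) := by
  rw [katoMeasure, integrable_withDensity_iff_integrable_smul' (by fun_prop) (by simp)]
  simp [IntegrableOn, ENNReal.toReal_ofReal (Real.exp_nonneg _)]

lemma integral_katoMeasure (f : ℝ → ℝ) : ∫ x, f x ∂(katoMeasure b)
    = ∫ x in Ioi (0 : ℝ), Real.exp (2 * b * x) * f x := by
  rw [katoMeasure, integral_withDensity_eq_integral_toReal_smul (by fun_prop) (by simp)]
  simp [ENNReal.toReal_ofReal (Real.exp_nonneg _)]

lemma ae_Ioi_of_ae_kato {p : ℝ → Prop} (h : ∀ᵐ x ∂(katoMeasure b), p x) :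
    ∀ᵐ x ∂(volume.restrict (Ioi (0 : ℝ))), p x :=
  (ac_katoMeasure b).ae_le h

lemma integrableOn_mul_of_memLp {f g : ℝ → ℝ} (hf : MemLp f 2 (katoMeasure b))
    (hg : MemLp g 2 (katoMeasure b)) :
    IntegrableOn (fun x => Real.exp (2 * b * x) * (f x * g x)) (Ioi 0) :=
  integrable_katoMeasure.1 (hf.integrable_mul hg)

lemma inner_eq_integral {u v : L2b b} {f g : ℝ → ℝ} (hu : u =ᵐ[katoMeasure b] f)
    (hv : v =ᵐ[katoMeasure b] g) :
    ⟪u, v⟫ = ∫ x in Ioi (0 : ℝ), Real.exp (2 * b * x) * (f x * g x) := by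
  rw [L2.inner_def, ← integral_katoMeasure]
  refine integral_congr_ae ?_
  filter_upwards [hu, hv] with x hx hx'
  rw [hx, hx']; simp [mul_comm]

/-- The Riesz representative of `u ↦ ∫ u φ`. -/
lemma exists_inner_eq_integral (b : ℝ) {φ : ℝ → ℝ} (hφ : Continuous φ) (hs : HasCompactSupport φ) :
    ∃ z : L2b b, (z =ᵐ[katoMeasure b] fun x => φ x * Real.exp (-(2 * b * x))) ∧
      ∀ u : L2b b, ⟪u, z⟫ = ∫ x in Ioi (0 : ℝ), u x * φ x := by
  have hm : MemLp (fun x => φ x * Real.exp (-(2 * b * x))) 2 (katoMeasure b) :=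
    (show Continuous fun x => φ x * Real.exp (-(2 * b * x)) by fun_prop).memLp_of_hasCompactSupport
      hs.mul_right
  refine ⟨hm.toLp _, hm.coeFn_toLp, fun u => ?_⟩
  rw [inner_eq_integral (ae_eq_refl _) hm.coeFn_toLp]
  congr 1
  ext x
  rw [Real.exp_neg]
  have := Real.exp_pos (2 * b * x)
  field_simp

/-- Smooth functions with compact support inside the open half-line. -/
structure IsInteriorTest (φ : ℝ → ℝ) : Prop where
  smooth : ContDiff ℝ ∞ φ
  compact : HasCompactSupport φ
  subset : tsupport φ ⊆ Ioi (0 : ℝ)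

lemma IsInteriorTest.of_Icc {φ : ℝ → ℝ} (h : ContDiff ℝ ∞ φ) {δ R : ℝ} (hδ : 0 < δ)
    (h0 : ∀ x ∉ Icc δ R, φ x = 0) : IsInteriorTest φ := by
  have hsub : tsupport φ ⊆ Icc δ R := closure_minimal
    (fun x hx => by_contra fun hx' => hx (h0 x hx')) isClosed_Icc
  exact ⟨h, HasCompactSupport.intro isCompact_Icc h0, fun x hx => hδ.trans_le (hsub hx).1⟩

lemma IsInteriorTest.exists_Icc {φ : ℝ → ℝ} (h : IsInteriorTest φ) :
    ∃ δ R, 0 < δ ∧ 0 ≤ R ∧ ∀ x ∉ Icc δ R, φ x = 0 := by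
  rcases (tsupport φ).eq_empty_or_nonempty with he | hne
  · refine ⟨1, 0, one_pos, le_rfl, fun x _ => ?_⟩
    exact image_eq_zero_of_notMem_tsupport (by simp [he])
  · obtain ⟨δ, hδ⟩ := h.compact.isCompact.exists_isLeast hne
    obtain ⟨R, hR⟩ := h.compact.isCompact.exists_isGreatest hne
    exact ⟨δ, R, h.subset hδ.1, (le_of_lt (h.subset hR.1)), fun x hx =>
      image_eq_zero_of_notMem_tsupport fun hx' => hx ⟨hδ.2 hx', hR.2 hx'⟩⟩

lemma IsInteriorTest.apply_zero {φ : ℝ → ℝ} (h : IsInteriorTest φ) : φ 0 = 0 :=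
  image_eq_zero_of_notMem_tsupport fun h' => lt_irrefl (0 : ℝ) (h.subset h')

lemma IsInteriorTest.deriv {φ : ℝ → ℝ} (h : IsInteriorTest φ) : IsInteriorTest (deriv φ) :=
  ⟨(contDiff_infty_iff_deriv.1 h.smooth).2, h.compact.deriv,
    tsupport_deriv_subset.trans h.subset⟩

lemma IsInteriorTest.iteratedDeriv {φ : ℝ → ℝ} (h : IsInteriorTest φ) (i : ℕ) :
    IsInteriorTest (iteratedDeriv i φ) := by
  induction i with
  | zero => simpa using h
  | succ i ih => rw [iteratedDeriv_succ]; exact ih.deriv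

lemma IsInteriorTest.add {φ ψ : ℝ → ℝ} (h : IsInteriorTest φ) (h' : IsInteriorTest ψ) :
    IsInteriorTest (fun x => φ x + ψ x) :=
  ⟨h.smooth.add h'.smooth, h.compact.add h'.compact,
    (tsupport_add φ ψ).trans (union_subset h.subset h'.subset)⟩

lemma IsInteriorTest.const_mul {φ : ℝ → ℝ} (h : IsInteriorTest φ) (c : ℝ) :
    IsInteriorTest (fun x => c * φ x) :=
  ⟨contDiff_const.mul h.smooth, h.compact.mul_left,
    (tsupport_mul_subset_right (f := fun _ => c) (g := φ)).trans h.subset⟩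

lemma eq_zero_of_forall_integral_eq_zero {q : L2b b}
    (h : ∀ φ, IsInteriorTest φ → ∫ x in Ioi (0 : ℝ), q x * φ x = 0) : q = 0 := by
  have h1 : HasWeakDeriv 0 (0 : L2b b) q := fun φ h1 h2 h3 => by
    obtain ⟨z, -, hz⟩ := exists_inner_eq_integral b (hφ := h1.continuous) h2
    simp only [iteratedDeriv_zero]
    rw [h φ ⟨h1, h2, h3⟩, ← hz]; simp
  have h2 : HasWeakDeriv 0 (0 : L2b b) 0 := fun φ _ _ _ => by simp
  exact h1.unique h2

/-- The elements of `L²_b` represented by a smooth function compactly supported in `(0, ∞)`. -/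
def smoothSubmodule (b : ℝ) : Submodule ℝ (L2b b) where
  carrier := {u | ∃ φ, IsInteriorTest φ ∧ u =ᵐ[katoMeasure b] φ}
  zero_mem' := ⟨fun _ => 0, .of_Icc contDiff_const one_pos (R := 0) (by simp), Lp.coeFn_zero _ _ _⟩
  add_mem' := by
    rintro u v ⟨φ, hφ, hu⟩ ⟨ψ, hψ, hv⟩
    refine ⟨_, hφ.add hψ, ?_⟩
    filter_upwards [Lp.coeFn_add u v, hu, hv] with x h1 h2 h3
    rw [h1, Pi.add_apply, h2, h3]
  smul_mem' := by
    rintro c u ⟨φ, hφ, hu⟩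
    refine ⟨_, hφ.const_mul c, ?_⟩
    filter_upwards [Lp.coeFn_smul c u, hu] with x h1 h2
    rw [h1, Pi.smul_apply, h2, smul_eq_mul]

lemma dense_smoothSubmodule (b : ℝ) : Dense (smoothSubmodule b : Set (L2b b)) := by
  rw [Submodule.dense_iff_topologicalClosure_eq_top, Submodule.topologicalClosure_eq_top_iff,
    Submodule.eq_bot_iff]
  refine fun q hq => eq_zero_of_forall_integral_eq_zero fun φ hφ => ?_
  obtain ⟨z, hz, hz'⟩ := exists_inner_eq_integral b hφ.smooth.continuous hφ.compact
  rw [← hz', real_inner_comm]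
  refine (Submodule.mem_orthogonal _ _).1 hq z ⟨_, ?_, hz⟩
  exact ⟨hφ.smooth.mul (by fun_prop), hφ.compact.mul_right,
    (tsupport_mul_subset_left).trans hφ.subset⟩

/-- For `b > 0` the decaying exponential `e^{-2bx}`, which represents `u ↦ ∫₀^∞ u`. -/
lemma memLp_exp (hb : 0 < b) : MemLp (fun x => Real.exp (-(2 * b * x))) 2 (katoMeasure b) := by
  rw [memLp_two_iff_integrable_sq (by fun_prop), integrable_katoMeasure]
  refine (integrableOn_exp_mul_Ioi (a := -(2 * b)) (by linarith) 0).congr_fun (fun x _ => ?_)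
    measurableSet_Ioi
  simp only
  rw [sq, ← Real.exp_add, ← Real.exp_add]; ring_nf

lemma integrableOn_of_memLp (hb : 0 < b) {f : ℝ → ℝ} (hf : MemLp f 2 (katoMeasure b)) :
    IntegrableOn f (Ioi 0) := by
  refine (integrableOn_mul_of_memLp hf (memLp_exp hb)).congr_fun (fun x _ => ?_) measurableSet_Ioi
  simp only
  rw [mul_left_comm, ← Real.exp_add]; simp

/-- `∫₀^∞ |w| ≤ C ‖w‖`, by Cauchy–Schwarz. -/
lemma integral_abs_le (hb : 0 < b) (w : L2b b) :
    ∫ x in Ioi (0 : ℝ), |w x| ≤ ‖w‖ * ‖(memLp_exp hb).toLp _‖ := by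
  have h := real_inner_le_norm |w| ((memLp_exp hb).toLp _)
  rw [norm_abs_eq_norm, inner_eq_integral (Lp.coeFn_abs w) (memLp_exp hb).coeFn_toLp] at h
  refine le_of_eq_of_le ?_ h
  congr 1
  ext x
  rw [mul_left_comm, ← Real.exp_add]; simp

/-! ### A function is determined by its weak derivatives -/

/-- If `q` annihilates all `(i+1)`-st derivatives of test functions, it annihilates all `i`-th
derivatives: a test function minus a translated bump of the same integral is a derivative, and
the contribution of the bump vanishes as it escapes to infinity, because `q` is integrable. -/
lemma forall_integral_iteratedDeriv_of_succ (hb : 0 < b) {q : L2b b} {i : ℕ}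
    (h : ∀ φ, IsInteriorTest φ → ∫ x in Ioi (0 : ℝ), q x * iteratedDeriv (i + 1) φ x = 0)
    {χ : ℝ → ℝ} (hχ : IsInteriorTest χ) : ∫ x in Ioi (0 : ℝ), q x * iteratedDeriv i χ x = 0 := by
  set β : ContDiffBump (2 : ℝ) := ⟨1 / 2, 1, by norm_num, by norm_num⟩
  set ρ : ℝ → ℝ := β.normed volume with hρdef
  have hρ0 : ∀ x ∉ Icc (1 : ℝ) 3, ρ x = 0 := fun x hx => by
    by_contra hne
    have h1 : x ∈ Function.support ρ := hne
    rw [hρdef, β.support_normed_eq, Real.ball_eq_Ioo] at h1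
    exact hx ⟨by have := h1.1; norm_num at this; linarith,
      by have := h1.2; norm_num at this; linarith⟩
  have hρs : ContDiff ℝ ∞ ρ := β.contDiff_normed
  have hρ : IsInteriorTest ρ := .of_Icc hρs one_pos hρ0
  have hρ1 : ∫ x, ρ x = 1 := β.integral_normed
  obtain ⟨δ, R, hδ, hR, hχ0⟩ := hχ.exists_Icc
  set m := ∫ x, χ x with hm
  have hshift : ∀ n : ℕ, ∫ x in Ioi (0 : ℝ), q x * iteratedDeriv i χ x
      = m * ∫ x in Ioi (0 : ℝ), q x * iteratedDeriv i ρ (x - n) := fun n => by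
    have hn : (0 : ℝ) ≤ n := Nat.cast_nonneg n
    set ψ : ℝ → ℝ := fun x => χ x - m * ρ (x - n) with hψ
    have hρn : ContDiff ℝ ∞ fun x => ρ (x - n) := hρs.comp (contDiff_id.sub contDiff_const)
    have hψs : ContDiff ℝ ∞ ψ := hχ.smooth.sub (contDiff_const.mul hρn)
    have hχi : Integrable χ := hχ.smooth.continuous.integrable_of_hasCompactSupport hχ.compact
    have hρi : Integrable ρ := hρs.continuous.integrable_of_hasCompactSupport hρ.compact
    set d := min δ 1 with hd
    set r := max R (n + 3) with hr
    have hψ0 : ∀ x ∉ Icc d r, ψ x = 0 := fun x hx => by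
      have h1 : χ x = 0 := hχ0 x fun h' => hx ⟨(min_le_left _ _).trans h'.1,
        h'.2.trans (le_max_left _ _)⟩
      have h2 : ρ (x - n) = 0 := hρ0 _ fun h' => hx ⟨(min_le_right _ _).trans (by linarith [h'.1]),
        le_trans (by linarith [h'.2]) (le_max_right _ _)⟩
      simp [hψ, h1, h2]
    have hψint : ∫ x, ψ x = 0 := by
      rw [integral_sub hχi ((hρi.comp_sub_right _).const_mul _), integral_const_mul,
        integral_sub_right_eq_self ρ, hρ1, mul_one, sub_self]
    have hψi : Integrable ψ := hχi.sub ((hρi.comp_sub_right _).const_mul _)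
    set φ : ℝ → ℝ := fun x => ∫ s in (0 : ℝ)..x, ψ s with hφ
    have hφd : ∀ x, HasDerivAt φ (ψ x) x := fun x =>
      (hψs.continuous.integral_hasStrictDerivAt 0 x).hasDerivAt
    have hφ' : deriv φ = ψ := funext fun x => (hφd x).deriv
    have hdpos : 0 < d := lt_min hδ one_pos
    have hφt : IsInteriorTest φ := by
      refine .of_Icc ?_ hdpos (R := r) fun x hx => ?_
      · rw [contDiff_infty_iff_deriv, hφ']
        exact ⟨fun x => (hφd x).differentiableAt, hψs⟩
      · rcases lt_or_ge x d with hxd | hxd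
        · refine intervalIntegral.integral_zero_ae (Eventually.of_forall fun s hs => hψ0 s ?_)
          exact fun h' => (hs.2.trans_lt (max_lt hdpos hxd)).not_ge h'.1
        · have hxr : r < x := by
            by_contra h'; exact hx ⟨hxd, not_lt.1 h'⟩
          have h1 : ∫ s in Ioc (0 : ℝ) x, ψ s = ∫ s, ψ s :=
            setIntegral_eq_integral_of_forall_compl_eq_zero fun s hs => hψ0 s fun h' =>
              hs ⟨hdpos.trans_le h'.1, h'.2.trans hxr.le⟩
          change ∫ s in (0 : ℝ)..x, ψ s = 0
          rw [intervalIntegral.integral_of_le (hdpos.le.trans hxd), h1, hψint]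
    have h1 := h φ hφt
    rw [iteratedDeriv_succ', hφ'] at h1
    have h2 : ∀ x, iteratedDeriv i ψ x = iteratedDeriv i χ x - m * iteratedDeriv i ρ (x - n) :=
      fun x => by
        have hi : ((i : ℕ∞) : WithTop ℕ∞) ≤ ∞ := by exact_mod_cast le_top
        have h3 := iteratedDeriv_fun_sub (n := i) (x := x) ((hχ.smooth.of_le hi).contDiffAt)
          (((contDiff_const (c := m)).mul hρn).of_le hi).contDiffAt
        rw [hψ, h3, iteratedDeriv_const_mul_field m fun x => ρ (x - n)]
        rw [iteratedDeriv_comp_sub_const]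
    have hqi : ∀ {g : ℝ → ℝ}, IsInteriorTest g → IntegrableOn (fun x => q x * g x) (Ioi 0) :=
      fun hg => integrable_mul_of_compact q hg.smooth.continuous hg.compact
    have hρnt : IsInteriorTest fun x => iteratedDeriv i ρ (x - n) := by
      have h4 : IsInteriorTest fun x => ρ (x - n) := .of_Icc hρn (δ := n + 1) (R := n + 3)
        (by positivity) fun x hx => hρ0 _ fun h' => hx ⟨by linarith [h'.1], by linarith [h'.2]⟩
      have h5 := h4.iteratedDeriv i
      rwa [iteratedDeriv_comp_sub_const] at h5
    simp only [h2] at h1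
    have h6 : ∫ x in Ioi (0 : ℝ), q x * (iteratedDeriv i χ x - m * iteratedDeriv i ρ (x - n))
        = (∫ x in Ioi (0 : ℝ), q x * iteratedDeriv i χ x)
          - m * ∫ x in Ioi (0 : ℝ), q x * iteratedDeriv i ρ (x - n) := by
      rw [← integral_const_mul, ← integral_sub (hqi (hχ.iteratedDeriv i))
        ((hqi hρnt).const_mul m)]
      congr 1; ext x; ring
    rw [h6] at h1
    exact sub_eq_zero.1 h1
  have hlim : Tendsto (fun n : ℕ => ∫ x in Ioi (0 : ℝ), q x * iteratedDeriv i ρ (x - n)) atTop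
      (𝓝 (∫ _ in Ioi (0 : ℝ), (0 : ℝ))) := by
    have hρi := hρ.iteratedDeriv i
    obtain ⟨C, hC⟩ := hρi.compact.exists_bound_of_continuous hρi.smooth.continuous
    have hqi : IntegrableOn q (Ioi 0) := integrableOn_of_memLp hb (Lp.memLp q)
    refine tendsto_integral_of_dominated_convergence (fun x => ‖q x‖ * C) (fun n => ?_)
      (hqi.norm.mul_const C) (fun n => Eventually.of_forall fun x => ?_)
      (Eventually.of_forall fun x => ?_)
    · exact hqi.aestronglyMeasurable.mul (hρi.smooth.continuous.comp
        (continuous_id.sub continuous_const)).aestronglyMeasurable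
    · rw [norm_mul]; exact mul_le_mul_of_nonneg_left (hC _) (norm_nonneg _)
    · refine tendsto_const_nhds.congr' ?_
      filter_upwards [eventually_ge_atTop ⌈x⌉₊] with n hn
      have : iteratedDeriv i ρ (x - n) = 0 := image_eq_zero_of_notMem_tsupport fun h' => by
        have h1 : 0 < x - n := hρi.subset h'
        have h2 : x ≤ n := (Nat.le_ceil x).trans (by exact_mod_cast hn)
        linarith
      rw [this, mul_zero]
  have h7 := hlim.const_mul m
  simp only [← hshift] at h7
  simpa using tendsto_nhds_unique tendsto_const_nhds h7

lemma eq_zero_of_forall_integral_iteratedDeriv (hb : 0 < b) {q : L2b b} (i : ℕ)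
    (h : ∀ φ, IsInteriorTest φ → ∫ x in Ioi (0 : ℝ), q x * iteratedDeriv i φ x = 0) : q = 0 := by
  induction i with
  | zero => exact eq_zero_of_forall_integral_eq_zero (by simpa using h)
  | succ i ih => exact ih fun χ hχ => forall_integral_iteratedDeriv_of_succ hb h hχ

/-! ### The primitive vanishing at infinity -/

/-- The primitive of `f` on `[0, ∞)` that vanishes at infinity, `x ↦ -∫ₓ^∞ f`, written as a
primitive from `0` so that for continuous `f` it is differentiable on all of `ℝ`. -/
noncomputable def decayPrim (f : ℝ → ℝ) (x : ℝ) : ℝ :=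
  (∫ s in (0 : ℝ)..x, f s) - ∫ s in Ioi (0 : ℝ), f s

lemma decayPrim_zero (f : ℝ → ℝ) : decayPrim f 0 = -∫ s in Ioi (0 : ℝ), f s := by
  simp [decayPrim]

lemma decayPrim_eq {f : ℝ → ℝ} (hf : IntegrableOn f (Ioi 0)) {x : ℝ} (hx : 0 ≤ x) :
    decayPrim f x = -∫ s in Ioi x, f s := by
  rw [decayPrim, intervalIntegral.integral_of_le hx, ← Ioc_union_Ioi_eq_Ioi hx,
    setIntegral_union (Ioc_disjoint_Ioi le_rfl) measurableSet_Ioi (hf.mono_set Ioc_subset_Ioi_self)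
      (hf.mono_set (Ioi_subset_Ioi hx))]
  ring

lemma intervalIntegrable_of_Ioi {f : ℝ → ℝ} (hf : IntegrableOn f (Ioi 0)) {x : ℝ} (hx : 0 ≤ x) :
    IntervalIntegrable f volume 0 x :=
  (intervalIntegrable_iff_integrableOn_Ioc_of_le hx).2 (hf.mono_set Ioc_subset_Ioi_self)

lemma continuousOn_decayPrim {f : ℝ → ℝ} (hf : IntegrableOn f (Ioi 0)) :
    ContinuousOn (decayPrim f) (Ici 0) := fun x hx => by
  have hx' : (0 : ℝ) ≤ x := hx
  have h1 : IntegrableOn f (uIcc 0 (x + 1)) := by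
    rw [uIcc_of_le (by linarith), integrableOn_Icc_iff_integrableOn_Ioc]
    exact hf.mono_set Ioc_subset_Ioi_self
  have h2 := (intervalIntegral.continuousOn_primitive_interval h1).sub
    (continuousOn_const (c := ∫ s in Ioi (0 : ℝ), f s))
  rw [uIcc_of_le (by linarith)] at h2
  refine (h2 x ⟨hx', by linarith⟩).mono_of_mem_nhdsWithin ?_
  filter_upwards [self_mem_nhdsWithin, mem_nhdsWithin_of_mem_nhds (Iio_mem_nhds (lt_add_one x))]
    with s hs hs' using ⟨hs, le_of_lt hs'⟩

lemma decayPrim_add {f g : ℝ → ℝ} (hf : IntegrableOn f (Ioi 0)) (hg : IntegrableOn g (Ioi 0))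
    {x : ℝ} (hx : 0 ≤ x) : decayPrim (fun s => f s + g s) x = decayPrim f x + decayPrim g x := by
  simp only [decayPrim]
  rw [integral_add hf hg, intervalIntegral.integral_add (intervalIntegrable_of_Ioi hf hx)
    (intervalIntegrable_of_Ioi hg hx)]
  ring

lemma decayPrim_const_mul (c : ℝ) (f : ℝ → ℝ) (x : ℝ) :
    decayPrim (fun s => c * f s) x = c * decayPrim f x := by
  simp only [decayPrim]
  rw [integral_const_mul, intervalIntegral.integral_const_mul]
  ring

lemma decayPrim_congr {f g : ℝ → ℝ} (h : f =ᵐ[volume.restrict (Ioi 0)] g) {x : ℝ} (hx : 0 ≤ x) :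
    decayPrim f x = decayPrim g x := by
  simp only [decayPrim]
  rw [integral_congr_ae h, intervalIntegral.integral_of_le hx, intervalIntegral.integral_of_le hx,
    integral_congr_ae (ae_restrict_of_ae_restrict_of_subset Ioc_subset_Ioi_self h)]

lemma abs_decayPrim_le {f : ℝ → ℝ} (hf : IntegrableOn f (Ioi 0)) {x : ℝ} (hx : 0 ≤ x) :
    |decayPrim f x| ≤ ∫ s in Ioi (0 : ℝ), |f s| := by
  rw [decayPrim_eq hf hx, abs_neg]
  exact (abs_integral_le_integral_abs).trans (setIntegral_mono_set hf.abs
    (Eventually.of_forall fun _ => abs_nonneg _) (Ioi_subset_Ioi hx).eventuallyLE)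

lemma IsInteriorTest.integrable {χ : ℝ → ℝ} (h : IsInteriorTest χ) : Integrable χ :=
  h.smooth.continuous.integrable_of_hasCompactSupport h.compact

lemma IsInteriorTest.hasDerivAt_decayPrim {χ : ℝ → ℝ} (h : IsInteriorTest χ) (x : ℝ) :
    HasDerivAt (decayPrim χ) (χ x) x :=
  ((h.smooth.continuous.integral_hasStrictDerivAt 0 x).hasDerivAt).sub_const _

lemma IsInteriorTest.exists_decayPrim_eq_zero {χ : ℝ → ℝ} (h : IsInteriorTest χ) :
    ∃ R, 0 ≤ R ∧ ∀ x, R ≤ x → decayPrim χ x = 0 := by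
  obtain ⟨δ, R, -, hR, h0⟩ := h.exists_Icc
  refine ⟨R, hR, fun x hx => ?_⟩
  rw [decayPrim_eq h.integrable.integrableOn (hR.trans hx),
    setIntegral_eq_zero_of_forall_eq_zero, neg_zero]
  exact fun s hs => h0 s fun h' => absurd (h'.2.trans hx) (not_le.2 hs)

lemma IsInteriorTest.continuous_decayPrim {χ : ℝ → ℝ} (h : IsInteriorTest χ) :
    Continuous (decayPrim χ) :=
  continuous_iff_continuousAt.2 fun x => (h.hasDerivAt_decayPrim x).continuousAt

lemma ae_katoMeasure_pos (b : ℝ) : ∀ᵐ x ∂(katoMeasure b), 0 < x :=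
  (katoMeasure_ac b).ae_le (ae_restrict_mem measurableSet_Ioi)

lemma IsInteriorTest.memLp {χ : ℝ → ℝ} (h : IsInteriorTest χ) : MemLp χ 2 (katoMeasure b) :=
  h.smooth.continuous.memLp_of_hasCompactSupport h.compact

lemma IsInteriorTest.memLp_decayPrim {χ : ℝ → ℝ} (h : IsInteriorTest χ) :
    MemLp (decayPrim χ) 2 (katoMeasure b) := by
  obtain ⟨R, hR, h0⟩ := h.exists_decayPrim_eq_zero
  -- On the half-line the primitive agrees with a compactly supported even function.
  have h1 : MemLp (fun x => decayPrim χ |x|) 2 (katoMeasure b) := by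
    refine (h.continuous_decayPrim.comp continuous_abs).memLp_of_hasCompactSupport
      (HasCompactSupport.intro (isCompact_Icc (a := -R) (b := R)) fun x hx => h0 _ ?_)
    by_contra hlt
    exact hx (abs_le.1 (not_le.1 hlt).le)
  refine h1.ae_eq ?_
  filter_upwards [ae_katoMeasure_pos b] with x hx
  rw [abs_of_pos hx]

/-- Integration by parts: `∫₀^∞ (e^{2bx} F G)' = -F(0) G(0)`. -/
lemma IsInteriorTest.integral_polar {χ η : ℝ → ℝ} (hχ : IsInteriorTest χ)
    (hη : IsInteriorTest η) :
    (∫ x in Ioi (0 : ℝ), Real.exp (2 * b * x) * (decayPrim χ x * η x))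
      + (∫ x in Ioi (0 : ℝ), Real.exp (2 * b * x) * (χ x * decayPrim η x))
      + 2 * b * (∫ x in Ioi (0 : ℝ), Real.exp (2 * b * x) * (decayPrim χ x * decayPrim η x))
      = -(decayPrim χ 0 * decayPrim η 0) := by
  have i1 := integrableOn_mul_of_memLp (b := b) hχ.memLp_decayPrim hη.memLp
  have i2 := integrableOn_mul_of_memLp (b := b) hχ.memLp hη.memLp_decayPrim
  have i3 := integrableOn_mul_of_memLp (b := b) hχ.memLp_decayPrim hη.memLp_decayPrim
  have i12 : IntegrableOn (fun x => Real.exp (2 * b * x) * (decayPrim χ x * η x)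
      + Real.exp (2 * b * x) * (χ x * decayPrim η x)) (Ioi 0) := i1.add i2
  rw [← integral_const_mul, ← integral_add i1 i2, ← integral_add i12 (i3.const_mul _)]
  have hd : ∀ x, HasDerivAt (fun x => Real.exp (2 * b * x) * (decayPrim χ x * decayPrim η x))
      (Real.exp (2 * b * x) * (decayPrim χ x * η x) + Real.exp (2 * b * x) * (χ x * decayPrim η x)
        + 2 * b * (Real.exp (2 * b * x) * (decayPrim χ x * decayPrim η x))) x := fun x => by
    have h1 : HasDerivAt (fun x : ℝ => Real.exp (2 * b * x)) (Real.exp (2 * b * x) * (2 * b)) x :=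
        by
      simpa using ((hasDerivAt_id x).const_mul (2 * b)).exp
    refine (h1.mul ((hχ.hasDerivAt_decayPrim x).mul (hη.hasDerivAt_decayPrim x))).congr_deriv ?_
    simp only [Pi.mul_apply]
    ring
  obtain ⟨R, -, h0⟩ := hχ.exists_decayPrim_eq_zero
  have := integral_Ioi_of_hasDerivAt_of_tendsto (m := 0) (a := 0)
    (hd 0).continuousAt.continuousWithinAt (fun x _ => hd x)
    (i12.add (i3.const_mul _)) (tendsto_const_nhds.congr' (by
      filter_upwards [eventually_ge_atTop R] with x hx
      rw [h0 x hx, zero_mul, mul_zero]))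
  simpa using this

lemma integrableOn_coe (hb : 0 < b) (w : L2b b) : IntegrableOn w (Ioi 0) :=
  integrableOn_of_memLp hb (Lp.memLp w)

lemma norm_decayPrim_smooth_le (hb : 0 < b) {χ : ℝ → ℝ} (h : IsInteriorTest χ) {u w : L2b b}
    (hu : u =ᵐ[katoMeasure b] decayPrim χ) (hw : w =ᵐ[katoMeasure b] χ) : ‖u‖ ≤ b⁻¹ * ‖w‖ := by
  have h1 := h.integral_polar (b := b) h
  rw [← inner_eq_integral hu hw, ← inner_eq_integral hw hu, ← inner_eq_integral hu hu,
    real_inner_self_eq_norm_sq, real_inner_comm] at h1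
  have h2 := neg_le_of_abs_le (abs_real_inner_le_norm w u)
  have h3 := mul_self_nonneg (decayPrim χ 0)
  rw [← div_eq_inv_mul, le_div_iff₀ hb]
  rcases (norm_nonneg u).eq_or_lt with h0 | h0
  · rw [← h0, zero_mul]; exact norm_nonneg w
  · refine le_of_mul_le_mul_right ?_ h0
    have h4 : ⟪u, w⟫ = ⟪w, u⟫ := real_inner_comm _ _
    nlinarith

lemma abs_decayPrim_coe_le (hb : 0 < b) (w : L2b b) {x : ℝ} (hx : 0 ≤ x) :
    |decayPrim w x| ≤ ‖w‖ * ‖(memLp_exp hb).toLp _‖ :=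
  (abs_decayPrim_le (integrableOn_coe hb w) hx).trans (integral_abs_le hb w)

lemma decayPrim_coe_add (hb : 0 < b) (u v : L2b b) {x : ℝ} (hx : 0 ≤ x) :
    decayPrim (u + v : L2b b) x = decayPrim u x + decayPrim v x := by
  rw [decayPrim_congr (coe_add u v) hx,
    decayPrim_add (integrableOn_coe hb u) (integrableOn_coe hb v) hx]

lemma decayPrim_coe_smul (c : ℝ) (u : L2b b) {x : ℝ} (hx : 0 ≤ x) :
    decayPrim (c • u : L2b b) x = c * decayPrim u x := by
  rw [decayPrim_congr (coe_smul c u) hx, decayPrim_const_mul]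

lemma aestronglyMeasurable_decayPrim (hb : 0 < b) (w : L2b b) :
    AEStronglyMeasurable (decayPrim w) (katoMeasure b) :=
  (((continuousOn_decayPrim (integrableOn_coe hb w)).mono
    Ioi_subset_Ici_self).aestronglyMeasurable measurableSet_Ioi).mono_ac (katoMeasure_ac b)

/-- The decaying primitive maps `L²_b` to itself, with norm at most `1/b`; this passes from smooth
functions to all of `L²_b` by Fatou's lemma. -/
lemma eLpNorm_decayPrim_le (hb : 0 < b) (w : L2b b) :
    eLpNorm (decayPrim w) 2 (katoMeasure b) ≤ ENNReal.ofReal (b⁻¹ * ‖w‖) := by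
  obtain ⟨s, hs, hsw⟩ := mem_closure_iff_seq_limit.1 (dense_smoothSubmodule b w)
  have hpt : ∀ᵐ x ∂(katoMeasure b),
      Tendsto (fun n => decayPrim (s n) x) atTop (𝓝 (decayPrim w x)) := by
    filter_upwards [ae_katoMeasure_pos b] with x hx
    rw [tendsto_iff_norm_sub_tendsto_zero]
    refine squeeze_zero (fun _ => norm_nonneg _) (fun n => ?_)
      (g := fun n => ‖s n - w‖ * ‖(memLp_exp hb).toLp _‖) ?_
    · have h1 := abs_decayPrim_coe_le hb (s n - w) hx.le
      have h2 := decayPrim_coe_add hb (s n - w) w hx.le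
      rw [sub_add_cancel] at h2
      rwa [h2, add_sub_cancel_right, Real.norm_eq_abs]
    · simpa using (tendsto_iff_norm_sub_tendsto_zero.1 hsw).mul_const _
  refine (Lp.eLpNorm_lim_le_liminf_eLpNorm (fun n => aestronglyMeasurable_decayPrim hb (s n)) _
    hpt).trans ?_
  have h3 : ∀ n, eLpNorm (decayPrim (s n)) 2 (katoMeasure b) ≤ ENNReal.ofReal (b⁻¹ * ‖s n‖) :=
    fun n => by
      obtain ⟨χ, hχ, hsχ⟩ := hs n
      have h4 : decayPrim (s n) =ᵐ[katoMeasure b] decayPrim χ := by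
        filter_upwards [ae_katoMeasure_pos b] with x hx
        exact decayPrim_congr (ae_Ioi_of_ae_kato hsχ) hx.le
      have h5 := norm_decayPrim_smooth_le hb hχ (hχ.memLp_decayPrim (b := b)).coeFn_toLp hsχ
      rw [eLpNorm_congr_ae h4]
      rw [Lp.norm_toLp] at h5
      exact (ENNReal.le_ofReal_iff_toReal_le hχ.memLp_decayPrim.2.ne (by positivity)).2 h5
  have h6 : Tendsto (fun n => ENNReal.ofReal (b⁻¹ * ‖s n‖)) atTop
      (𝓝 (ENNReal.ofReal (b⁻¹ * ‖w‖))) :=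
    ENNReal.tendsto_ofReal (hsw.norm.const_mul _)
  rw [← h6.liminf_eq]
  exact liminf_le_liminf (Eventually.of_forall h3)

lemma memLp_decayPrim (hb : 0 < b) (w : L2b b) : MemLp (decayPrim w) 2 (katoMeasure b) :=
  ⟨aestronglyMeasurable_decayPrim hb w,
    (eLpNorm_decayPrim_le hb w).trans_lt ENNReal.ofReal_lt_top⟩

/-- The bounded operator `(I w)(x) = -∫ₓ^∞ w` on `L²_b(ℝ⁺)`, a right inverse of `∂ₓ`. -/
noncomputable def primOp (hb : 0 < b) : L2b b →L[ℝ] L2b b :=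
  LinearMap.mkContinuous
    { toFun := fun w => (memLp_decayPrim hb w).toLp _
      map_add' := fun u v => by
        rw [← MemLp.toLp_add]
        refine MemLp.toLp_congr _ _ ?_
        filter_upwards [ae_katoMeasure_pos b] with x hx
        exact decayPrim_coe_add hb u v hx.le
      map_smul' := fun c u => by
        rw [RingHom.id_apply, ← MemLp.toLp_const_smul]
        refine MemLp.toLp_congr _ _ ?_
        filter_upwards [ae_katoMeasure_pos b] with x hx
        exact decayPrim_coe_smul c u hx.le }
    b⁻¹ fun w => by
      change ‖(memLp_decayPrim hb w).toLp _‖ ≤ _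
      rw [Lp.norm_toLp]
      exact ENNReal.toReal_le_of_le_ofReal (by positivity) (eLpNorm_decayPrim_le hb w)

lemma primOp_ae (hb : 0 < b) (w : L2b b) : primOp hb w =ᵐ[katoMeasure b] decayPrim w :=
  (memLp_decayPrim hb w).coeFn_toLp

/-- The vector `-e^{-2bx}`, which represents the trace functional `w ↦ (I w)(0)`. -/
noncomputable def traceVec (hb : 0 < b) : L2b b := -(memLp_exp hb).toLp _

lemma inner_traceVec (hb : 0 < b) (w : L2b b) : ⟪traceVec hb, w⟫ = decayPrim w 0 := by
  rw [traceVec, inner_neg_left, inner_eq_integral (memLp_exp hb).coeFn_toLp (ae_eq_refl _),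
    decayPrim_zero]
  congr 2
  ext x
  rw [← mul_assoc, ← Real.exp_add]; simp

/-- Integration by parts in `L²_b`. -/
lemma primOp_polar (hb : 0 < b) (w z : L2b b) :
    ⟪primOp hb w, z⟫ + ⟪w, primOp hb z⟫ + 2 * b * ⟪primOp hb w, primOp hb z⟫
      = -(⟪traceVec hb, w⟫ * ⟪traceVec hb, z⟫) := by
  refine isClosed_property2 (dense_smoothSubmodule b).denseRange_val
    (p := fun w z => ⟪primOp hb w, z⟫ + ⟪w, primOp hb z⟫ + 2 * b * ⟪primOp hb w, primOp hb z⟫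
      = -(⟪traceVec hb, w⟫ * ⟪traceVec hb, z⟫)) (isClosed_eq (by fun_prop) (by fun_prop)) ?_ w z
  rintro ⟨w, χ, hχ, hw⟩ ⟨z, η, hη, hz⟩
  have hIw : primOp hb w =ᵐ[katoMeasure b] decayPrim χ := by
    filter_upwards [ae_katoMeasure_pos b, primOp_ae hb w] with x hx h1
    rw [h1, decayPrim_congr (ae_Ioi_of_ae_kato hw) hx.le]
  have hIz : primOp hb z =ᵐ[katoMeasure b] decayPrim η := by
    filter_upwards [ae_katoMeasure_pos b, primOp_ae hb z] with x hx h1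
    rw [h1, decayPrim_congr (ae_Ioi_of_ae_kato hz) hx.le]
  simp only
  rw [inner_eq_integral hIw hz, inner_eq_integral hw hIz, inner_eq_integral hIw hIz,
    inner_traceVec, inner_traceVec, decayPrim_congr (ae_Ioi_of_ae_kato hw) le_rfl,
    decayPrim_congr (ae_Ioi_of_ae_kato hz) le_rfl]
  exact hχ.integral_polar hη

/-- Integration by parts against a test function that need not vanish at `0`. -/
lemma integral_primOp_mul_deriv (hb : 0 < b) (w : L2b b) {φ : ℝ → ℝ} (hφ : ContDiff ℝ ∞ φ)
    (hs : HasCompactSupport φ) :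
    ∫ x in Ioi (0 : ℝ), primOp hb w x * deriv φ x
      = -(∫ x in Ioi (0 : ℝ), w x * φ x) - ⟪traceVec hb, w⟫ * φ 0 := by
  have hφ' : Continuous (deriv φ) := (contDiff_infty_iff_deriv.1 hφ).2.continuous
  obtain ⟨z, -, hz⟩ := exists_inner_eq_integral b hφ.continuous hs
  obtain ⟨z', -, hz'⟩ := exists_inner_eq_integral b hφ' hs.deriv
  rw [← hz, ← hz']
  refine isClosed_property (dense_smoothSubmodule b).denseRange_val
    (p := fun w => ⟪primOp hb w, z'⟫ = -⟪w, z⟫ - ⟪traceVec hb, w⟫ * φ 0)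
    (isClosed_eq (by fun_prop) (by fun_prop)) ?_ w
  rintro ⟨w, χ, hχ, hw⟩
  simp only
  rw [hz, hz', inner_traceVec, decayPrim_congr (ae_Ioi_of_ae_kato hw) le_rfl]
  have e1 : ∫ x in Ioi (0 : ℝ), primOp hb w x * deriv φ x
      = ∫ x in Ioi (0 : ℝ), decayPrim χ x * deriv φ x := by
    refine integral_congr_ae ?_
    filter_upwards [ae_restrict_mem measurableSet_Ioi, ae_Ioi_of_ae_kato (primOp_ae hb w)]
      with x hx h1
    rw [h1, decayPrim_congr (ae_Ioi_of_ae_kato hw) (le_of_lt hx)]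
  have e2 : ∫ x in Ioi (0 : ℝ), w x * φ x = ∫ x in Ioi (0 : ℝ), χ x * φ x := by
    refine integral_congr_ae ?_
    filter_upwards [ae_Ioi_of_ae_kato hw] with x h1
    rw [h1]
  rw [e1, e2]
  have i1 : IntegrableOn (fun x => decayPrim χ x * deriv φ x) (Ioi 0) :=
    ((hχ.continuous_decayPrim.mul hφ').integrable_of_hasCompactSupport
      hs.deriv.mul_left).integrableOn
  have i2 : IntegrableOn (fun x => χ x * φ x) (Ioi 0) :=
    ((hχ.smooth.continuous.mul hφ.continuous).integrable_of_hasCompactSupport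
      hs.mul_left).integrableOn
  have hd : ∀ x, HasDerivAt (fun x => decayPrim χ x * φ x)
      (χ x * φ x + decayPrim χ x * deriv φ x) x := fun x =>
    (hχ.hasDerivAt_decayPrim x).mul
      ((contDiff_infty_iff_deriv.1 hφ).1 x).hasDerivAt
  obtain ⟨R, -, h0⟩ := hχ.exists_decayPrim_eq_zero
  have := integral_Ioi_of_hasDerivAt_of_tendsto (m := 0) (a := 0)
    (hd 0).continuousAt.continuousWithinAt (fun x _ => hd x) (i2.add i1)
    (tendsto_const_nhds.congr' (by
      filter_upwards [eventually_ge_atTop R] with x hx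
      rw [h0 x hx, zero_mul]))
  have h3 := integral_add i2 i1
  rw [this] at h3
  linarith

/-! ### Weak derivatives and traces through the primitive -/

lemma integral_iterate_primOp (hb : 0 < b) (w : L2b b) (i : ℕ) {φ : ℝ → ℝ}
    (hφ : IsInteriorTest φ) :
    ∫ x in Ioi (0 : ℝ), ((primOp hb)^[i] w) x * iteratedDeriv i φ x
      = (-1) ^ i * ∫ x in Ioi (0 : ℝ), w x * φ x := by
  induction i with
  | zero => simp
  | succ i ih =>
    have h := hφ.iteratedDeriv i
    rw [Function.iterate_succ_apply', iteratedDeriv_succ,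
      integral_primOp_mul_deriv hb _ h.smooth h.compact, ih, h.apply_zero, pow_succ]
    ring

/-- The weak derivatives of order `i` are inverted by the `i`-th power of the decaying primitive:
functions in `L²_b` with the same weak derivative of order `i` agree. -/
lemma hasWeakDeriv_iff (hb : 0 < b) {i : ℕ} {u w : L2b b} :
    HasWeakDeriv i u w ↔ u = (primOp hb)^[i] w := by
  constructor
  · intro h
    refine sub_eq_zero.1 (eq_zero_of_forall_integral_iteratedDeriv hb i fun φ hφ => ?_)
    obtain ⟨z, -, hz⟩ := exists_inner_eq_integral b (hφ.iteratedDeriv i).smooth.continuous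
      (hφ.iteratedDeriv i).compact
    rw [← hz, inner_sub_left, hz, hz, h φ hφ.smooth hφ.compact hφ.subset,
      integral_iterate_primOp hb w i hφ, sub_self]
  · rintro rfl φ h1 h2 h3
    exact integral_iterate_primOp hb w i ⟨h1, h2, h3⟩

lemma vanishesAtZero_primOp_iff (hb : 0 < b) {w : L2b b} :
    VanishesAtZero (primOp hb w) ↔ ⟪traceVec hb, w⟫ = 0 := by
  have hc := continuousOn_decayPrim (integrableOn_coe hb w)
  have hae := ae_Ioi_of_ae_kato (primOp_ae hb w)
  rw [inner_traceVec]
  constructor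
  · rintro ⟨g, hg, hg0, hgw⟩
    have h1 : decayPrim w =ᵐ[volume.restrict (Ici (0 : ℝ))] g := by
      rw [Measure.restrict_congr_set Ioi_ae_eq_Ici.symm]
      filter_upwards [hae, hgw] with x h1 h2
      rw [← h1, h2]
    have h2 := Measure.eqOn_of_ae_eq h1 hc hg (by rw [interior_Ici, closure_Ioi])
    rw [h2 (mem_Ici.2 le_rfl), hg0]
  · exact fun h => ⟨_, hc, h, hae⟩

lemma mem_scalarDomain_iff (hb : 0 < b) {u : L2b b} : u ∈ scalarDomain b ↔
    ∃ w, u = primOp hb (primOp hb (primOp hb w)) ∧ ⟪traceVec hb, primOp hb (primOp hb w)⟫ = 0 := by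
  constructor
  · rintro ⟨hd, hu⟩
    obtain ⟨w, hw⟩ := hd 3 (by norm_num) le_rfl
    rw [hasWeakDeriv_iff hb] at hw
    refine ⟨w, hw, ?_⟩
    rw [hw] at hu
    exact (vanishesAtZero_primOp_iff hb).1 hu
  · rintro ⟨w, rfl, hw⟩
    refine ⟨fun i h1 h3 => ?_, (vanishesAtZero_primOp_iff hb).2 hw⟩
    simp only [hasWeakDeriv_iff hb]
    interval_cases i
    · exact ⟨primOp hb (primOp hb w), rfl⟩
    · exact ⟨primOp hb w, rfl⟩
    · exact ⟨w, rfl⟩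

lemma weakDeriv_primOp (hb : 0 < b) (w : L2b b) : weakDeriv 1 (primOp hb w) = w :=
  ((hasWeakDeriv_iff hb (i := 1)).2 rfl).weakDeriv_eq

lemma weakDeriv_three_primOp (hb : 0 < b) (w : L2b b) :
    weakDeriv 3 (primOp hb (primOp hb (primOp hb w))) = w :=
  ((hasWeakDeriv_iff hb (i := 3)).2 rfl).weakDeriv_eq

/-- The adjoint of the decaying primitive `I` satisfies `I* + I + 2b I I* = 0`. Formally `I*` is
the inverse of `-(∂ₓ + 2b)` with zero boundary values, so no boundary term appears; it suffices to
test on the dense set of all `φ' e^{-2bx}`, which `I*` maps to `-φ e^{-2bx}`. -/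
lemma adjoint_primOp_add (hb : 0 < b) (w : L2b b) :
    (primOp hb).adjoint w + primOp hb w + (2 * b) • primOp hb ((primOp hb).adjoint w) = 0 := by
  set K := (primOp hb).adjoint with hK
  have hKin : ∀ x y, ⟪K x, y⟫ = ⟪x, primOp hb y⟫ := fun x y =>
    ContinuousLinearMap.adjoint_inner_left _ _ _
  have hKin' : ∀ x y, ⟪x, K y⟫ = ⟪primOp hb x, y⟫ := fun x y =>
    ContinuousLinearMap.adjoint_inner_right _ _ _
  have hKz : ∀ {φ : ℝ → ℝ} (_ : IsInteriorTest φ) {z p : L2b b},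
      (∀ u : L2b b, ⟪u, z⟫ = ∫ x in Ioi (0 : ℝ), u x * deriv φ x) →
      (∀ u : L2b b, ⟪u, p⟫ = ∫ x in Ioi (0 : ℝ), u x * φ x) → K z = -p := by
    intro φ hφ z p hz hp
    refine ext_inner_right ℝ fun u => ?_
    rw [hKin, real_inner_comm, hz, integral_primOp_mul_deriv hb u hφ.smooth hφ.compact,
      inner_neg_left, real_inner_comm u p, hp, hφ.apply_zero]
    ring
  have hsep : ∀ q : L2b b, (∀ (ψ : ℝ → ℝ) (z : L2b b), IsInteriorTest ψ →
      (∀ u : L2b b, ⟪u, z⟫ = ∫ x in Ioi (0 : ℝ), u x * deriv ψ x) → ⟪q, z⟫ = 0) → q = 0 := by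
    intro q hq
    refine eq_zero_of_forall_integral_iteratedDeriv hb 1 fun ψ hψ => ?_
    obtain ⟨z, -, hz⟩ := exists_inner_eq_integral b hψ.deriv.smooth.continuous hψ.deriv.compact
    rw [iteratedDeriv_one, ← hz]
    exact hq ψ z hψ hz
  have hform : ∀ x y, ⟪K x + primOp hb x + (2 * b) • primOp hb (K x), y⟫
      = ⟪K x, y⟫ + ⟪x, K y⟫ + 2 * b * ⟪K x, K y⟫ := fun x y => by
    rw [inner_add_left, inner_add_left, real_inner_smul_left, hKin', hKin']
  -- The form vanishes when both arguments have the special shape.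
  have hspecial : ∀ (φ ψ : ℝ → ℝ) (x y : L2b b), IsInteriorTest φ → IsInteriorTest ψ →
      (∀ u : L2b b, ⟪u, x⟫ = ∫ t in Ioi (0 : ℝ), u t * deriv φ t) →
      (∀ u : L2b b, ⟪u, y⟫ = ∫ t in Ioi (0 : ℝ), u t * deriv ψ t) →
      ⟪K x, y⟫ + ⟪x, K y⟫ + 2 * b * ⟪K x, K y⟫ = 0 := by
    intro φ ψ x y hφ hψ hx hy
    obtain ⟨p, hp, hp'⟩ := exists_inner_eq_integral b hφ.smooth.continuous hφ.compact
    obtain ⟨s, hs, hs'⟩ := exists_inner_eq_integral b hψ.smooth.continuous hψ.compact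
    rw [hKz hφ hx hp', hKz hψ hy hs', inner_neg_right x, real_inner_comm s x, hx,
      inner_neg_neg, hs',
      inner_neg_left, hy]
    have hφd : ∀ t, HasDerivAt φ (deriv φ t) t := fun t =>
      ((contDiff_infty_iff_deriv.1 hφ.smooth).1 t).hasDerivAt
    have hψd : ∀ t, HasDerivAt ψ (deriv ψ t) t := fun t =>
      ((contDiff_infty_iff_deriv.1 hψ.smooth).1 t).hasDerivAt
    have hE : ∀ t, HasDerivAt (fun t : ℝ => Real.exp (-(2 * b * t)))
        (Real.exp (-(2 * b * t)) * (-(2 * b))) t := fun t => by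
      simpa using ((hasDerivAt_id t).const_mul (2 * b)).neg.exp
    have hd : ∀ t, HasDerivAt (fun t => φ t * Real.exp (-(2 * b * t)) * ψ t)
        (φ t * Real.exp (-(2 * b * t)) * deriv ψ t + ψ t * Real.exp (-(2 * b * t)) * deriv φ t
          - 2 * b * (φ t * Real.exp (-(2 * b * t)) * ψ t)) t := fun t => by
      refine (((hφd t).mul (hE t)).mul (hψd t)).congr_deriv ?_
      simp only [Pi.mul_apply]
      ring
    have e1 : ∫ t in Ioi (0 : ℝ), p t * deriv ψ t
        = ∫ t in Ioi (0 : ℝ), φ t * Real.exp (-(2 * b * t)) * deriv ψ t :=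
      integral_congr_ae (by filter_upwards [ae_Ioi_of_ae_kato hp] with t ht; rw [ht])
    have e2 : ∫ t in Ioi (0 : ℝ), s t * deriv φ t
        = ∫ t in Ioi (0 : ℝ), ψ t * Real.exp (-(2 * b * t)) * deriv φ t :=
      integral_congr_ae (by filter_upwards [ae_Ioi_of_ae_kato hs] with t ht; rw [ht])
    have e3 : ∫ t in Ioi (0 : ℝ), p t * ψ t
        = ∫ t in Ioi (0 : ℝ), φ t * Real.exp (-(2 * b * t)) * ψ t :=
      integral_congr_ae (by filter_upwards [ae_Ioi_of_ae_kato hp] with t ht; rw [ht])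
    have hEc : Continuous fun t : ℝ => Real.exp (-(2 * b * t)) := by fun_prop
    have i1 : IntegrableOn (fun t => φ t * Real.exp (-(2 * b * t)) * deriv ψ t) (Ioi 0) :=
      (((hφ.smooth.continuous.mul hEc).mul
        hψ.deriv.smooth.continuous).integrable_of_hasCompactSupport
          hψ.deriv.compact.mul_left).integrableOn
    have i2 : IntegrableOn (fun t => ψ t * Real.exp (-(2 * b * t)) * deriv φ t) (Ioi 0) :=
      (((hψ.smooth.continuous.mul hEc).mul
        hφ.deriv.smooth.continuous).integrable_of_hasCompactSupport
          hφ.deriv.compact.mul_left).integrableOn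
    have i3 : IntegrableOn (fun t => φ t * Real.exp (-(2 * b * t)) * ψ t) (Ioi 0) :=
      (((hφ.smooth.continuous.mul hEc).mul
        hψ.smooth.continuous).integrable_of_hasCompactSupport hψ.compact.mul_left).integrableOn
    have i12 : IntegrableOn (fun t => φ t * Real.exp (-(2 * b * t)) * deriv ψ t
        + ψ t * Real.exp (-(2 * b * t)) * deriv φ t) (Ioi 0) := i1.add i2
    obtain ⟨δ, R, hδ, -, h0⟩ := hψ.exists_Icc
    have h1 := integral_Ioi_of_hasDerivAt_of_tendsto (m := 0) (a := 0)
      (hd 0).continuousAt.continuousWithinAt (fun t _ => hd t) (i12.sub (i3.const_mul (2 * b)))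
      (tendsto_const_nhds.congr' (by
        filter_upwards [eventually_gt_atTop R] with t ht
        rw [h0 t fun h' => absurd h'.2 (not_le.2 ht), mul_zero]))
    rw [integral_sub i12 (i3.const_mul (2 * b)), integral_add i1 i2, integral_const_mul,
      h0 0 fun h' => absurd h'.1 (not_le.2 hδ)] at h1
    rw [e1, e2, e3]
    linarith
  refine hsep _ fun ψ y hψ hy => ?_
  rw [hform]
  -- By symmetry of the form, now vary the first argument.
  have hy0 : K y + primOp hb y + (2 * b) • primOp hb (K y) = 0 := by
    refine hsep _ fun φ x hφ hx => ?_
    rw [hform]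
    exact hspecial ψ φ y x hψ hφ hy hx
  have h1 := hform y w
  rw [hy0, inner_zero_left] at h1
  rw [real_inner_comm (K w) (K y), real_inner_comm w (K y), real_inner_comm (K w) y] at h1
  linarith

end WeightedSpace

section Algebra

/-! ### Energy identities -/

/-- A vector orthogonal to everything orthogonal to `f` is a multiple of `f`. -/
lemma exists_eq_smul_of_forall_inner {L : Type*} [NormedAddCommGroup L] [InnerProductSpace ℝ L]
    {f x : L} (hx : ∀ w, ⟪f, w⟫ = 0 → ⟪x, w⟫ = 0) :
    ∃ c : ℝ, x = c • f := by
  have h1 : x ∈ (Submodule.span ℝ {f})ᗮᗮ := by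
    refine (Submodule.mem_orthogonal _ _).2 fun w hw => ?_
    rw [real_inner_comm]
    exact hx w ((Submodule.mem_orthogonal _ _).1 hw f (Submodule.mem_span_singleton_self f))
  rw [Submodule.orthogonal_orthogonal] at h1
  obtain ⟨c, hc⟩ := Submodule.mem_span_singleton.1 h1
  exact ⟨c, hc.symm⟩

variable {L : Type*} [NormedAddCommGroup L] [InnerProductSpace ℝ L] [CompleteSpace L]

/-- The algebraic properties of the decaying primitive `I` on `L²_b` and of the vector `e`
representing the trace `w ↦ (I w)(0)`: integration by parts for `I` and for its adjoint. -/
structure IsDecayingPrimitive (b : ℝ) (I : L →L[ℝ] L) (e : L) : Prop where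
  pos : 0 < b
  polar : ∀ w z, ⟪I w, z⟫ + ⟪w, I z⟫ + 2 * b * ⟪I w, I z⟫ = -(⟪e, w⟫ * ⟪e, z⟫)
  adjoint_add : ∀ w, I.adjoint w + I w + (2 * b) • I (I.adjoint w) = 0

namespace IsDecayingPrimitive

variable {b : ℝ} {I : L →L[ℝ] L} {e : L}

/-- Dissipativity of `-∂ₓ³`: with `u = I³ w`, so `u''' = w`, and `u(0) = 0`, one has
`⟪u''', u⟫ = 3b ‖u'‖² - 4b³ ‖u‖² + u'(0)² / 2`. -/
lemma neg_inner_le (h : IsDecayingPrimitive b I e) {w : L} (hw : ⟪e, I (I w)⟫ = 0) :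
    -⟪w, I (I (I w))⟫ ≤ 4 * b ^ 3 * ‖I (I (I w))‖ ^ 2 := by
  have h1 := h.polar w (I (I w))
  have h2 := h.polar (I w) (I w)
  have h3 := h.polar (I w) (I (I w))
  have h4 := h.polar (I (I w)) (I (I w))
  rw [hw, mul_zero, neg_zero] at h1 h3 h4
  rw [real_inner_self_eq_norm_sq] at h2 h3 h4
  rw [real_inner_comm (I (I w)) (I w)] at h2
  rw [real_inner_comm (I (I w)) (I w)] at h1
  rw [real_inner_comm (I (I w)) (I (I (I w)))] at h4
  have h5 := h.pos
  have h6 := mul_self_nonneg ⟪e, I w⟫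
  have h7 : ⟪I (I w), I (I (I w))⟫ = -b * ‖I (I (I w))‖ ^ 2 := by linarith
  have h8 : ⟪I w, I (I (I w))⟫ = 2 * b ^ 2 * ‖I (I (I w))‖ ^ 2 - ‖I (I w)‖ ^ 2 := by
    rw [h7] at h3; linarith
  rw [h8] at h1
  have h9 : 0 ≤ b * ‖I (I w)‖ ^ 2 := by positivity
  linarith

/-- Since `u(0) = 0`, the first-order term contributes `-⟪u', u⟫ = b ‖u‖²`. -/
lemma inner_deriv_eq (h : IsDecayingPrimitive b I e) {p : L} (hp : ⟪e, p⟫ = 0) :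
    ⟪p, I p⟫ = -(b * ‖I p‖ ^ 2) := by
  have h1 := h.polar p p
  rw [hp, mul_zero, neg_zero, real_inner_self_eq_norm_sq, real_inner_comm p (I p)] at h1
  linarith

lemma adjoint_polar (h : IsDecayingPrimitive b I e) (x y : L) :
    ⟪I.adjoint x, y⟫ + ⟪x, I.adjoint y⟫ + 2 * b * ⟪I.adjoint x, I.adjoint y⟫ = 0 := by
  have h1 := congrArg (fun z => ⟪z, y⟫) (h.adjoint_add x)
  simp only [inner_add_left, real_inner_smul_left, inner_zero_left] at h1
  rwa [ContinuousLinearMap.adjoint_inner_right, ContinuousLinearMap.adjoint_inner_right]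

/-- `e` is an eigenvector of `I`: the operator `1 + 2b I` is a co-isometry whose initial
projection is `1 - 2b ⟪e, ·⟫ e`, so it annihilates `e`. -/
lemma trace_add (h : IsDecayingPrimitive b I e) : e + (2 * b) • I e = 0 := by
  have hS : ∀ w z : L, ⟪w + (2 * b) • I w, z + (2 * b) • I z⟫
      = ⟪w, z⟫ - 2 * b * (⟪e, w⟫ * ⟪e, z⟫) := fun w z => by
    have h1 := h.polar w z
    simp only [inner_add_left, inner_add_right, real_inner_smul_left, real_inner_smul_right]
    linear_combination (2 * b) * h1
  have hco : ∀ x, (I.adjoint x) + I x + (2 * b) • I (I.adjoint x) = 0 := h.adjoint_add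
  set f := e + (2 * b) • I e with hf
  have hadj : ∀ x, ⟪e, x + (2 * b) • I.adjoint x⟫ = ⟪f, x⟫ := fun x => by
    rw [hf, inner_add_right, inner_add_left, real_inner_smul_left, real_inner_smul_right,
      ContinuousLinearMap.adjoint_inner_right]
  have h1 := hS e (f + (2 * b) • I.adjoint f)
  have h2 : f + (2 * b) • I.adjoint f + (2 * b) • I (f + (2 * b) • I.adjoint f) = f := by
    have h3 := hco f
    have h4 : ∀ x y : L, x + (2 * b) • y + (2 * b) • I (x + (2 * b) • y)
        = x + (2 * b) • (y + I x + (2 * b) • I y) := fun x y => by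
      rw [map_add, map_smul]; module
    rw [h4, h3, smul_zero, add_zero]
  rw [h2, ← hf, hadj, real_inner_self_eq_norm_sq, real_inner_self_eq_norm_sq] at h1
  have h5 : b * (‖e‖ ^ 2 * ‖f‖ ^ 2) = 0 := by linarith
  rcases mul_eq_zero.1 ((mul_eq_zero.1 h5).resolve_left h.pos.ne') with h6 | h6
  · have h7 : e = 0 := by simpa using h6
    rw [hf, h7]; simp
  · simpa using h6

/-- Dissipativity of the adjoint of `-∂ₓ³`, tested on `I*² η`. -/
lemma inner_adjoint_le (h : IsDecayingPrimitive b I e) (η : L) :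
    ⟪η + (2 * b) • I η, I.adjoint η⟫ ≤ 4 * b ^ 3 * ‖I.adjoint (I.adjoint η)‖ ^ 2 := by
  set K := I.adjoint
  have h1 := h.adjoint_polar η η
  have h2 := h.adjoint_polar η (K η)
  have h3 := h.adjoint_polar (K η) (K η)
  have h4 : ⟪I η, K η⟫ = ⟪η, K (K η)⟫ := (ContinuousLinearMap.adjoint_inner_right _ _ _).symm
  change ⟪K η, η⟫ + ⟪η, K η⟫ + 2 * b * ⟪K η, K η⟫ = 0 at h1
  change ⟪K η, K η⟫ + ⟪η, K (K η)⟫ + 2 * b * ⟪K η, K (K η)⟫ = 0 at h2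
  change ⟪K (K η), K η⟫ + ⟪K η, K (K η)⟫ + 2 * b * ⟪K (K η), K (K η)⟫ = 0 at h3
  rw [real_inner_self_eq_norm_sq] at h1 h2 h3
  rw [real_inner_comm η (K η)] at h1
  rw [real_inner_comm (K η) (K (K η))] at h3
  rw [inner_add_left, real_inner_smul_left, h4]
  have h5 := h.pos
  have h6 : ⟪K η, K (K η)⟫ = -b * ‖K (K η)‖ ^ 2 := by linarith
  rw [h6] at h2
  have h7 : ⟪η, K (K η)⟫ = 2 * b ^ 2 * ‖K (K η)‖ ^ 2 - ‖K η‖ ^ 2 := by linarith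
  rw [h7]
  have h9 : 0 ≤ b * ‖K η‖ ^ 2 := by positivity
  linarith

/-- If `I* G + h + r g` is a multiple of `e`, pairings of `G` with the range of `I*²` can be
computed from `h` and `g`. -/
lemma inner_adjoint_eq (hI : IsDecayingPrimitive b I e) {G h g : L} {c r : ℝ}
    (hG : I.adjoint G + h + r • g = c • e) (η : L) :
    ⟪G, I.adjoint (I.adjoint η)⟫ = ⟪h + (2 * b) • I h, I.adjoint η⟫
      + r * ⟪g + (2 * b) • I g, I.adjoint η⟫ := by
  have h1 : I G = (h + (2 * b) • I h) + r • (g + (2 * b) • I g) := by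
    have h2 : I.adjoint G = c • e - h - r • g := by rw [← hG]; abel
    have h3 : I G = -(I.adjoint G + (2 * b) • I (I.adjoint G)) := by
      rw [eq_neg_iff_add_eq_zero, ← hI.adjoint_add G]; abel
    have h4 : c • e + (2 * b) • I (c • e) = 0 := by
      have := congrArg (fun z => c • z) hI.trace_add
      simp only [smul_zero] at this
      rw [← this, map_smul]; module
    rw [h3, h2, ← sub_eq_zero, ← neg_eq_zero, ← h4]
    simp only [map_sub, map_smul]
    module
  rw [ContinuousLinearMap.adjoint_inner_right, h1, inner_add_left, real_inner_smul_left]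

/-- The first-order term of the adjoint, tested on `g = I* y`. -/
lemma inner_adjoint_first_order (h : IsDecayingPrimitive b I e) (y : L) :
    ⟪I.adjoint y + (2 * b) • I (I.adjoint y), y⟫ = b * ‖I.adjoint y‖ ^ 2 := by
  have h1 : I.adjoint y + (2 * b) • I (I.adjoint y) = -I y := by
    rw [eq_neg_iff_add_eq_zero, ← h.adjoint_add y]; abel
  have h2 := h.adjoint_polar y y
  rw [h1, inner_neg_left, ← ContinuousLinearMap.adjoint_inner_right]
  rw [real_inner_comm y, real_inner_self_eq_norm_sq] at h2
  linarith

/-- Dissipativity of the coupled system in the energy `b₂ ‖u‖² + b₁ ‖v‖²`, for which the coupling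
matrix becomes symmetric and, since `a₃² b₂ < 1`, positive definite. -/
lemma system_inner_le (h : IsDecayingPrimitive b I e) {M : L →ₗ[ℝ] L} {N : ℝ}
    (hM : ∀ x, |⟪M x, x⟫| ≤ N * ‖x‖ ^ 2) {a₃ b₂ r : ℝ} (hb₂ : 0 < b₂)
    (ha₃ : a₃ ^ 2 * b₂ < 1) {w₁ w₂ u v : L} (hu : u = I (I (I w₁))) (hv : v = I (I (I w₂)))
    (h1 : ⟪e, I (I w₁)⟫ = 0) (h2 : ⟪e, I (I w₂)⟫ = 0) :
    b₂ * ⟪-w₁ - a₃ • w₂ - M u, u⟫ + ⟪-w₂ - (a₃ * b₂) • w₁ - r • I (I w₂) - M v, v⟫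
      ≤ (12 * b ^ 3 + N) * (b₂ * ‖u‖ ^ 2) + (8 * b ^ 3 + N + r * b) * ‖v‖ ^ 2 := by
  -- The coupling form is completed to a sum of two squares.
  have d1 := h.neg_inner_le h1
  have hsum : I (I (I ((a₃ * b₂) • w₁ + w₂))) = (a₃ * b₂) • u + v := by
    simp only [map_add, map_smul, hu, hv]
  have d2 := h.neg_inner_le (w := (a₃ * b₂) • w₁ + w₂) (by
    simp only [map_add, map_smul, inner_add_right, real_inner_smul_right, h1, h2]; ring)
  have d3 := h.inner_deriv_eq h2
  rw [hsum] at d2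
  rw [← hu] at d1
  rw [← hv] at d3
  have m1 := neg_le_of_abs_le (hM u)
  have m2 := neg_le_of_abs_le (hM v)
  have hn : ‖(a₃ * b₂) • u + v‖ ^ 2 ≤ 2 * (b₂ * ‖u‖ ^ 2) + 2 * ‖v‖ ^ 2 := by
    have h3 := parallelogram_law_with_norm ℝ ((a₃ * b₂) • u) v
    have h4 : ‖(a₃ * b₂) • u‖ * ‖(a₃ * b₂) • u‖ ≤ b₂ * ‖u‖ ^ 2 := by
      rw [norm_smul, Real.norm_eq_abs]
      have h5 : |a₃ * b₂| * ‖u‖ * (|a₃ * b₂| * ‖u‖) = (a₃ ^ 2 * b₂) * (b₂ * ‖u‖ ^ 2) := by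
        rw [show |a₃ * b₂| * ‖u‖ * (|a₃ * b₂| * ‖u‖) = |a₃ * b₂| ^ 2 * ‖u‖ ^ 2 by ring, sq_abs]
        ring
      rw [h5]
      exact mul_le_of_le_one_left (by positivity) ha₃.le
    nlinarith [sq_nonneg ‖(a₃ * b₂) • u - v‖]
  simp only [inner_add_left, inner_add_right, inner_sub_left, inner_neg_left,
    real_inner_smul_left, real_inner_smul_right] at d2 ⊢
  have hpos := h.pos
  have hΔ : 0 ≤ b₂ * (1 - a₃ ^ 2 * b₂) := mul_nonneg hb₂.le (by linarith)
  have d1' := mul_le_mul_of_nonneg_left d1 hΔ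
  have d2' : 4 * b ^ 3 * ‖(a₃ * b₂) • u + v‖ ^ 2
      ≤ 4 * b ^ 3 * (2 * (b₂ * ‖u‖ ^ 2) + 2 * ‖v‖ ^ 2) := by gcongr
  have d4 : b₂ * (1 - a₃ ^ 2 * b₂) * (4 * b ^ 3 * ‖u‖ ^ 2) ≤ 4 * b ^ 3 * (b₂ * ‖u‖ ^ 2) := by
    have : 0 ≤ a₃ ^ 2 * b₂ * (4 * b ^ 3 * (b₂ * ‖u‖ ^ 2)) := by positivity
    linarith
  have m1' := mul_le_mul_of_nonneg_left m1 hb₂.le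
  have d3' : r * ⟪I (I w₂), v⟫ = r * -(b * ‖v‖ ^ 2) := by rw [d3]
  linarith

/-- Dissipativity of the adjoint system. Since `I*` is formally the inverse of `-(∂ₓ + 2b)`, the
vectors `h₁, h₂` stand for `(∂ₓ + 2b)²` applied to `g₁ + a₃ b₂ g₂` and `a₃ g₁ + g₂`. -/
lemma system_adjoint_le (h : IsDecayingPrimitive b I e) {a₃ b₂ r c₁ c₂ : ℝ} (hb₂ : 0 < b₂)
    (ha₃ : a₃ ^ 2 * b₂ < 1) {g₁ g₂ G₁ G₂ h₁ h₂ : L} (hh₁ : I.adjoint G₁ + h₁ = c₁ • e)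
    (hh₂ : I.adjoint G₂ + h₂ + r • g₂ = c₂ • e)
    (hp₁ : I.adjoint (I.adjoint h₁) = g₁ + (a₃ * b₂) • g₂)
    (hp₂ : I.adjoint (I.adjoint h₂) = a₃ • g₁ + g₂) :
    ⟪G₁, g₁⟫ + b₂ * ⟪G₂, g₂⟫
      ≤ 12 * b ^ 3 * ‖g₁‖ ^ 2 + b₂ * ((8 * b ^ 3 + r * b) * ‖g₂‖ ^ 2) := by
  obtain ⟨Δ, hΔdef⟩ : ∃ Δ, Δ = 1 - a₃ ^ 2 * b₂ := ⟨_, rfl⟩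
  have hΔ : 0 < Δ := by linarith
  have hq₁ : I.adjoint (I.adjoint (h₁ - (a₃ * b₂) • h₂)) = Δ • g₁ := by
    rw [map_sub, map_sub, map_smul, map_smul, hp₁, hp₂, hΔdef]; module
  have hq₂ : I.adjoint (I.adjoint (h₂ - a₃ • h₁)) = Δ • g₂ := by
    rw [map_sub, map_sub, map_smul, map_smul, hp₁, hp₂, hΔdef]; module
  have e1 := h.inner_adjoint_eq (G := G₁) (h := h₁) (g := 0) (c := c₁) (r := 0)
    (by simpa using hh₁) (h₁ - (a₃ * b₂) • h₂)
  have e2 := h.inner_adjoint_eq (G := G₂) (h := h₂) (g := g₂) (c := c₂) (r := r) hh₂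
    (h₂ - a₃ • h₁)
  have e3 := h.inner_adjoint_first_order (I.adjoint (h₂ - a₃ • h₁))
  rw [hq₁] at e1
  rw [hq₂] at e2 e3
  have t1 := h.inner_adjoint_le (h₁ - (a₃ * b₂) • h₂)
  have t2 := h.inner_adjoint_le h₂
  rw [hq₁] at t1
  rw [hp₂] at t2
  rw [map_smul, smul_comm (2 * b) Δ, ← smul_add, real_inner_smul_left] at e3
  have hy : ⟪g₂ + (2 * b) • I g₂, I.adjoint (h₂ - a₃ • h₁)⟫ = b * (Δ * ‖g₂‖ ^ 2) := by
    refine mul_left_cancel₀ hΔ.ne' ?_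
    rw [e3, norm_smul, Real.norm_eq_abs, abs_of_pos hΔ]; ring
  rw [hy] at e2
  simp only [zero_mul, add_zero, map_sub, map_smul, inner_sub_right, inner_sub_left, inner_add_left,
    real_inner_smul_left, real_inner_smul_right, norm_smul, Real.norm_eq_abs, abs_of_pos hΔ]
    at e1 e2 t1 t2
  have hpos := h.pos
  have key : ⟪G₁, g₁⟫ + b₂ * ⟪G₂, g₂⟫ ≤ 4 * b ^ 3 * (Δ * ‖g₁‖ ^ 2)
      + b₂ * (4 * b ^ 3 * ‖a₃ • g₁ + g₂‖ ^ 2) + b₂ * (r * (b * ‖g₂‖ ^ 2)) := by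
    refine le_of_mul_le_mul_left ?_ hΔ
    have t2' := mul_le_mul_of_nonneg_left t2 (mul_nonneg hb₂.le hΔ.le)
    -- The quadratic form `x² - 2 a₃ b₂ x y + b₂ y²` equals `(x - a₃ b₂ y)² + b₂ Δ y²`.
    subst hΔdef
    linear_combination e1 + b₂ * e2 + t1 + t2'
  have hp2 : ‖a₃ • g₁ + g₂‖ ^ 2 ≤ 2 * (a₃ ^ 2 * ‖g₁‖ ^ 2) + 2 * ‖g₂‖ ^ 2 := by
    have h3 := parallelogram_law_with_norm ℝ (a₃ • g₁) g₂
    have h4 : ‖a₃ • g₁‖ * ‖a₃ • g₁‖ = a₃ ^ 2 * ‖g₁‖ ^ 2 := by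
      rw [norm_smul, Real.norm_eq_abs, ← sq_abs a₃]; ring
    nlinarith [sq_nonneg ‖a₃ • g₁ - g₂‖]
  have hp2' : b₂ * (4 * b ^ 3 * ‖a₃ • g₁ + g₂‖ ^ 2)
      ≤ b₂ * (4 * b ^ 3 * (2 * (a₃ ^ 2 * ‖g₁‖ ^ 2) + 2 * ‖g₂‖ ^ 2)) := by gcongr
  have k1 : 4 * b ^ 3 * (Δ * ‖g₁‖ ^ 2) ≤ 4 * b ^ 3 * ‖g₁‖ ^ 2 := by
    have : Δ ≤ 1 := by
      have : 0 ≤ a₃ ^ 2 * b₂ := by positivity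
      linarith
    gcongr
    exact mul_le_of_le_one_left (by positivity) this
  have k2 : b ^ 3 * ((a₃ ^ 2 * b₂) * ‖g₁‖ ^ 2) ≤ b ^ 3 * ‖g₁‖ ^ 2 := by
    gcongr
    exact mul_le_of_le_one_left (by positivity) ha₃.le
  linear_combination key + hp2' + k1 + 8 * k2

/-- The adjoint of `c - A` is injective for large `c`. -/
lemma system_adjoint_eq_zero (h : IsDecayingPrimitive b I e) {M : L →ₗ[ℝ] L} {N : ℝ}
    (hMs : ∀ x y, ⟪M x, y⟫ = ⟪x, M y⟫) (hM : ∀ x, |⟪M x, x⟫| ≤ N * ‖x‖ ^ 2)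
    {a₃ b₁ b₂ r c : ℝ} (hb₂ : 0 < b₂) (ha₃ : a₃ ^ 2 * b₂ < 1)
    (hc₁ : 12 * b ^ 3 + N < c) (hc₂ : 8 * b ^ 3 + N + r * b < c * b₁) {g₁ g₂ : L}
    (hg : ∀ w₁ w₂, ⟪e, I (I w₁)⟫ = 0 → ⟪e, I (I w₂)⟫ = 0 →
      ⟪g₁, c • I (I (I w₁)) + w₁ + a₃ • w₂ + M (I (I (I w₁)))⟫
        + ⟪g₂, (c * b₁) • I (I (I w₂)) + w₂ + (a₃ * b₂) • w₁ + r • I (I w₂) + M (I (I (I w₂)))⟫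
        = 0) : g₁ = 0 ∧ g₂ = 0 := by
  have hKin : ∀ x y, ⟪I.adjoint x, y⟫ = ⟪x, I y⟫ := fun x y =>
    ContinuousLinearMap.adjoint_inner_left _ _ _
  obtain ⟨G₁, hG₁⟩ : ∃ G, G = c • g₁ + M g₁ := ⟨_, rfl⟩
  obtain ⟨G₂, hG₂⟩ : ∃ G, G = (c * b₁) • g₂ + M g₂ := ⟨_, rfl⟩
  -- The two components of the adjoint equation, each up to a multiple of the trace functional.
  obtain ⟨c₁, hc1⟩ := exists_eq_smul_of_forall_inner (f := I.adjoint (I.adjoint e))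
    (x := I.adjoint (I.adjoint (I.adjoint G₁)) + (g₁ + (a₃ * b₂) • g₂)) fun w hw => by
      rw [hKin, hKin] at hw
      have h1 := hg w 0 hw (by simp)
      simp only [map_zero, smul_zero, add_zero, zero_add] at h1
      simp only [inner_add_right, real_inner_smul_right, ← hMs] at h1
      simp only [inner_add_left, real_inner_smul_left, hKin, hG₁]
      linarith
  obtain ⟨c₂, hc2⟩ := exists_eq_smul_of_forall_inner (f := I.adjoint (I.adjoint e))
    (x := I.adjoint (I.adjoint (I.adjoint G₂)) + (a₃ • g₁ + g₂) + r • I.adjoint (I.adjoint g₂))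
    fun w hw => by
      rw [hKin, hKin] at hw
      have h1 := hg 0 w (by simp) hw
      simp only [map_zero, smul_zero, add_zero, zero_add] at h1
      simp only [inner_add_right, real_inner_smul_right, ← hMs] at h1
      simp only [inner_add_left, real_inner_smul_left, hKin, hG₂]
      linarith
  have key := h.system_adjoint_le hb₂ ha₃ (g₁ := g₁) (g₂ := g₂) (G₁ := G₁) (G₂ := G₂) (r := r)
    (h₁ := c₁ • e - I.adjoint G₁) (h₂ := c₂ • e - I.adjoint G₂ - r • g₂) (c₁ := c₁) (c₂ := c₂)
    (by abel) (by abel)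
    (by rw [map_sub, map_sub, map_smul, map_smul, ← hc1]; abel)
    (by simp only [map_sub, map_smul, ← hc2]; abel)
  have m1 := neg_le_of_abs_le (hM g₁)
  have m2 := mul_le_mul_of_nonneg_left (neg_le_of_abs_le (hM g₂)) hb₂.le
  rw [hG₁, hG₂, inner_add_left, inner_add_left, real_inner_smul_left, real_inner_smul_left,
    real_inner_self_eq_norm_sq, real_inner_self_eq_norm_sq] at key
  have hfin : (c - (12 * b ^ 3 + N)) * ‖g₁‖ ^ 2
      + b₂ * ((c * b₁ - (8 * b ^ 3 + N + r * b)) * ‖g₂‖ ^ 2) ≤ 0 := by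
    linear_combination key + m1 + m2
  have q1 : 0 ≤ (c - (12 * b ^ 3 + N)) * ‖g₁‖ ^ 2 := mul_nonneg (by linarith) (sq_nonneg _)
  have q2 : 0 ≤ b₂ * ((c * b₁ - (8 * b ^ 3 + N + r * b)) * ‖g₂‖ ^ 2) :=
    mul_nonneg hb₂.le (mul_nonneg (by linarith) (sq_nonneg _))
  constructor
  · have := (mul_eq_zero.1 (le_antisymm (by linarith) q1)).resolve_left (by linarith)
    simpa using this
  · have := (mul_eq_zero.1 (le_antisymm (by linarith) q2)).resolve_left hb₂.ne'
    have := (mul_eq_zero.1 this).resolve_left (by linarith)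
    simpa using this

end IsDecayingPrimitive

end Algebra

section Operator

/-! ### The operator and its weak form -/

variable {b a₃ b₁ b₂ r : ℝ} {a : ℝ → ℝ}

lemma isDecayingPrimitive_primOp (hb : 0 < b) :
    IsDecayingPrimitive b (primOp hb) (traceVec hb) :=
  ⟨hb, primOp_polar hb, adjoint_primOp_add hb⟩

lemma primOp_injective (hb : 0 < b) : Function.Injective (primOp hb) := fun w z h => by
  rw [← weakDeriv_primOp hb w, h, weakDeriv_primOp]

lemma mulMap_ae (ha : MemLp a ⊤ (volume.restrict (Ioi (0 : ℝ)))) (u : L2b b) :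
    mulMap b a ha u =ᵐ[katoMeasure b] fun x => a x * u x :=
  (memLp_mul ha u).coeFn_toLp

lemma mulMap_symm (ha : MemLp a ⊤ (volume.restrict (Ioi (0 : ℝ)))) (u v : L2b b) :
    ⟪mulMap b a ha u, v⟫ = ⟪u, mulMap b a ha v⟫ := by
  rw [inner_eq_integral (mulMap_ae ha u) (ae_eq_refl _),
    inner_eq_integral (ae_eq_refl _) (mulMap_ae ha v)]
  congr 1; ext x; ring

lemma exists_abs_inner_mulMap_le (b : ℝ) (ha : MemLp a ⊤ (volume.restrict (Ioi (0 : ℝ)))) :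
    ∃ N, 0 ≤ N ∧ ∀ u : L2b b, |⟪mulMap b a ha u, u⟫| ≤ N * ‖u‖ ^ 2 := by
  -- A symmetric operator that is defined everywhere is bounded, by Hellinger–Toeplitz.
  have hc : Continuous (mulMap b a ha) :=
    LinearMap.IsSymmetric.continuous fun u v => mulMap_symm ha u v
  let M : L2b b →L[ℝ] L2b b := ⟨mulMap b a ha, hc⟩
  refine ⟨‖M‖, norm_nonneg _, fun u => (abs_real_inner_le_norm _ _).trans ?_⟩
  have := mul_le_mul_of_nonneg_right (M.le_opNorm u) (norm_nonneg u)
  calc _ ≤ ‖M‖ * ‖u‖ * ‖u‖ := this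
    _ = _ := by ring

lemma integral_mulMap (ha : MemLp a ⊤ (volume.restrict (Ioi (0 : ℝ)))) (u : L2b b) (φ : ℝ → ℝ) :
    ∫ x in Ioi (0 : ℝ), mulMap b a ha u x * φ x = ∫ x in Ioi (0 : ℝ), a x * u x * φ x := by
  refine integral_congr_ae ?_
  filter_upwards [ae_Ioi_of_ae_kato (mulMap_ae ha u)] with x hx
  rw [hx]

/-- The graph of the operator, with elements of `D(A)` written through their third derivatives. -/
lemma mem_graph_kdvOp_iff (hb : 0 < b) (ha : MemLp a ⊤ (volume.restrict (Ioi (0 : ℝ))))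
    (U F : L2bSq b) : (U, F) ∈ (kdvOp b a₃ b₁ b₂ r a ha).graph ↔
      ∃ w₁ w₂, U.fst = primOp hb (primOp hb (primOp hb w₁)) ∧
        U.snd = primOp hb (primOp hb (primOp hb w₂)) ∧
        ⟪traceVec hb, primOp hb (primOp hb w₁)⟫ = 0 ∧
        ⟪traceVec hb, primOp hb (primOp hb w₂)⟫ = 0 ∧
        F.fst = -w₁ - a₃ • w₂ - mulMap b a ha U.fst ∧
        F.snd = (1 / b₁) • (-w₂ - (a₃ * b₂) • w₁ - r • primOp hb (primOp hb w₂)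
          - mulMap b a ha U.snd) := by
  have happ : ∀ (V : L2bSq b) (hV : V ∈ (kdvOp b a₃ b₁ b₂ r a ha).domain) (w₁ w₂ : L2b b),
      V.fst = primOp hb (primOp hb (primOp hb w₁)) →
      V.snd = primOp hb (primOp hb (primOp hb w₂)) →
      kdvOp b a₃ b₁ b₂ r a ha ⟨V, hV⟩ = WithLp.toLp 2 (-w₁ - a₃ • w₂ - mulMap b a ha V.fst,
        (1 / b₁) • (-w₂ - (a₃ * b₂) • w₁ - r • primOp hb (primOp hb w₂)
          - mulMap b a ha V.snd)) := by
    intro V hV w₁ w₂ h1 h2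
    have e1 : weakDeriv 3 V.fst = w₁ := by rw [h1, weakDeriv_three_primOp]
    have e2 : weakDeriv 3 V.snd = w₂ := by rw [h2, weakDeriv_three_primOp]
    have e3 : weakDeriv 1 V.snd = primOp hb (primOp hb w₂) := by rw [h2, weakDeriv_primOp]
    rw [kdvOp_apply]
    simp only [e1, e2, e3]
    congr 2
    module
  rw [LinearPMap.mem_graph_iff]
  constructor
  · rintro ⟨⟨V, hV⟩, rfl, hF⟩
    obtain ⟨w₁, hw₁, ht₁⟩ := (mem_scalarDomain_iff hb).1 hV.1
    obtain ⟨w₂, hw₂, ht₂⟩ := (mem_scalarDomain_iff hb).1 hV.2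
    refine ⟨w₁, w₂, hw₁, hw₂, ht₁, ht₂, ?_⟩
    rw [happ V hV w₁ w₂ hw₁ hw₂] at hF
    exact ⟨congrArg WithLp.fst hF.symm, congrArg WithLp.snd hF.symm⟩
  · rintro ⟨w₁, w₂, hw₁, hw₂, ht₁, ht₂, hF₁, hF₂⟩
    have hU : U ∈ (kdvOp b a₃ b₁ b₂ r a ha).domain :=
      ⟨(mem_scalarDomain_iff hb).2 ⟨w₁, hw₁, ht₁⟩, (mem_scalarDomain_iff hb).2 ⟨w₂, hw₂, ht₂⟩⟩
    refine ⟨⟨U, hU⟩, rfl, ?_⟩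
    rw [happ U hU w₁ w₂ hw₁ hw₂, ← hF₁, ← hF₂]
    rfl

lemma IsInteriorTest.isTestFunction {φ : ℝ → ℝ} (h : IsInteriorTest φ) : IsTestFunction φ :=
  ⟨h.smooth, h.compact, h.apply_zero, h.deriv.apply_zero⟩

lemma IsTestFunction.contDiff_iteratedDeriv {φ : ℝ → ℝ} (h : IsTestFunction φ) (i : ℕ) :
    ContDiff ℝ ∞ (iteratedDeriv i φ) := by
  induction i with
  | zero => simpa using h.smooth
  | succ i ih => rw [iteratedDeriv_succ]; exact (contDiff_infty_iff_deriv.1 ih).2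

/-- A test function with `φ''(0) ≠ 0`, which detects the boundary value. -/
lemma exists_isTestFunction : ∃ φ, IsTestFunction φ ∧ iteratedDeriv 2 φ 0 ≠ 0 := by
  let β : ContDiffBump (0 : ℝ) := ⟨1, 2, one_pos, one_lt_two⟩
  have hev : (fun x => x ^ 2 * β x) =ᶠ[𝓝 0] fun x => x ^ 2 := by
    filter_upwards [β.eventuallyEq_one] with x hx
    rw [hx, Pi.one_apply, mul_one]
  refine ⟨fun x => x ^ 2 * β x, ⟨?_, ?_, by simp, ?_⟩, ?_⟩
  · exact (contDiff_id.pow 2).mul β.contDiff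
  · exact β.hasCompactSupport.mul_left
  · rw [hev.deriv_eq]; simp
  · rw [hev.iteratedDeriv_eq]
    simp

lemma integral_primOp_three (hb : 0 < b) (w : L2b b) {φ : ℝ → ℝ} (hφ : IsTestFunction φ) :
    ∫ x in Ioi (0 : ℝ), primOp hb (primOp hb (primOp hb w)) x * iteratedDeriv 3 φ x
      = -(∫ x in Ioi (0 : ℝ), w x * φ x)
        - ⟪traceVec hb, primOp hb (primOp hb w)⟫ * iteratedDeriv 2 φ 0 := by
  rw [iteratedDeriv_succ, integral_primOp_mul_deriv hb _ (hφ.contDiff_iteratedDeriv 2)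
    (hasCompactSupport_iteratedDeriv hφ.compact 2), iteratedDeriv_succ,
    integral_primOp_mul_deriv hb _ (hφ.contDiff_iteratedDeriv 1)
    (hasCompactSupport_iteratedDeriv hφ.compact 1), iteratedDeriv_one,
    integral_primOp_mul_deriv hb _ hφ.smooth hφ.compact, hφ.zero, hφ.deriv_zero]
  ring

/-- The right-hand side of the first weak equation, as a function of the state. -/
noncomputable def weakForm₁ (a₃ : ℝ) (a φ : ℝ → ℝ) (U : L2bSq b) : ℝ :=
  ∫ x in Ioi (0 : ℝ), ((U.fst x + a₃ * U.snd x) * iteratedDeriv 3 φ x - a x * U.fst x * φ x)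

/-- The right-hand side of the second weak equation, as a function of the state. -/
noncomputable def weakForm₂ (a₃ b₂ r : ℝ) (a ψ : ℝ → ℝ) (U : L2bSq b) : ℝ :=
  ∫ x in Ioi (0 : ℝ), ((U.snd x + b₂ * a₃ * U.fst x) * iteratedDeriv 3 ψ x
    + r * U.snd x * deriv ψ x - a x * U.snd x * ψ x)

lemma IsTestFunction.integrableOn_mul {φ : ℝ → ℝ} (hφ : IsTestFunction φ) (u : L2b b) (i : ℕ) :
    IntegrableOn (fun x => u x * iteratedDeriv i φ x) (Ioi 0) :=
  integrable_mul_of_compact u (hφ.contDiff_iteratedDeriv i).continuous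
    (hasCompactSupport_iteratedDeriv hφ.compact i)

lemma IsTestFunction.integrableOn_mulMap {φ : ℝ → ℝ} (hφ : IsTestFunction φ)
    (ha : MemLp a ⊤ (volume.restrict (Ioi (0 : ℝ)))) (u : L2b b) :
    IntegrableOn (fun x => a x * u x * φ x) (Ioi 0) := by
  refine (integrable_mul_of_compact (mulMap b a ha u) hφ.smooth.continuous hφ.compact).congr ?_
  filter_upwards [ae_Ioi_of_ae_kato (mulMap_ae ha u)] with x hx
  rw [hx]

lemma weakForm₁_eq (ha : MemLp a ⊤ (volume.restrict (Ioi (0 : ℝ)))) {φ : ℝ → ℝ}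
    (hφ : IsTestFunction φ) (U : L2bSq b) : weakForm₁ a₃ a φ U
      = (∫ x in Ioi (0 : ℝ), U.fst x * iteratedDeriv 3 φ x)
        + a₃ * (∫ x in Ioi (0 : ℝ), U.snd x * iteratedDeriv 3 φ x)
        - ∫ x in Ioi (0 : ℝ), mulMap b a ha U.fst x * φ x := by
  have i1 := hφ.integrableOn_mul U.fst 3
  have i2 := (hφ.integrableOn_mul U.snd 3).const_mul a₃
  have i3 := hφ.integrableOn_mulMap ha U.fst
  have i12 : IntegrableOn (fun x => U.fst x * iteratedDeriv 3 φ x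
    + a₃ * (U.snd x * iteratedDeriv 3 φ x)) (Ioi 0) := i1.add i2
  rw [integral_mulMap, ← integral_const_mul, ← integral_add i1 i2, ← integral_sub i12 i3, weakForm₁]
  congr 1; ext x; ring

lemma weakForm₂_eq (ha : MemLp a ⊤ (volume.restrict (Ioi (0 : ℝ)))) {ψ : ℝ → ℝ}
    (hψ : IsTestFunction ψ) (U : L2bSq b) : weakForm₂ a₃ b₂ r a ψ U
      = (∫ x in Ioi (0 : ℝ), U.snd x * iteratedDeriv 3 ψ x)
        + b₂ * a₃ * (∫ x in Ioi (0 : ℝ), U.fst x * iteratedDeriv 3 ψ x)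
        + r * (∫ x in Ioi (0 : ℝ), U.snd x * deriv ψ x)
        - ∫ x in Ioi (0 : ℝ), mulMap b a ha U.snd x * ψ x := by
  have i1 := hψ.integrableOn_mul U.snd 3
  have i2 := (hψ.integrableOn_mul U.fst 3).const_mul (b₂ * a₃)
  have i3 := hψ.integrableOn_mulMap ha U.snd
  have i4 := (hψ.integrableOn_mul U.snd 1).const_mul r
  rw [iteratedDeriv_one] at i4
  have i12 : IntegrableOn (fun x => U.snd x * iteratedDeriv 3 ψ x
    + b₂ * a₃ * (U.fst x * iteratedDeriv 3 ψ x)) (Ioi 0) := i1.add i2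
  have i124 : IntegrableOn (fun x => U.snd x * iteratedDeriv 3 ψ x
    + b₂ * a₃ * (U.fst x * iteratedDeriv 3 ψ x) + r * (U.snd x * deriv ψ x)) (Ioi 0) := i12.add i4
  rw [integral_mulMap, ← integral_const_mul, ← integral_const_mul, ← integral_add i1 i2,
    ← integral_add i12 i4, ← integral_sub i124 i3, weakForm₂]
  congr 1; ext x; ring

lemma exists_inner_eq_weakForm₁ (b a₃ : ℝ) (ha : MemLp a ⊤ (volume.restrict (Ioi (0 : ℝ))))
    {φ : ℝ → ℝ} (hφ : IsTestFunction φ) :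
    ∃ ζ : L2bSq b, ∀ U, weakForm₁ a₃ a φ U = ⟪ζ, U⟫ := by
  obtain ⟨z, -, hz⟩ := exists_inner_eq_integral b hφ.smooth.continuous hφ.compact
  obtain ⟨z3, -, hz3⟩ := exists_inner_eq_integral b (hφ.contDiff_iteratedDeriv 3).continuous
    (hasCompactSupport_iteratedDeriv hφ.compact 3)
  refine ⟨WithLp.toLp 2 (z3 - mulMap b a ha z, a₃ • z3), fun U => ?_⟩
  rw [weakForm₁_eq ha hφ, ← hz, ← hz3, ← hz3, real_inner_comm U, WithLp.prod_inner_apply,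
    mulMap_symm]
  change _ = ⟪U.fst, z3 - mulMap b a ha z⟫ + ⟪U.snd, a₃ • z3⟫
  simp only [inner_sub_right, real_inner_smul_right]
  ring

lemma exists_inner_eq_weakForm₂ (b a₃ b₂ r : ℝ) (ha : MemLp a ⊤ (volume.restrict (Ioi (0 : ℝ))))
    {ψ : ℝ → ℝ} (hψ : IsTestFunction ψ) :
    ∃ ζ : L2bSq b, ∀ U, weakForm₂ a₃ b₂ r a ψ U = ⟪ζ, U⟫ := by
  obtain ⟨z, -, hz⟩ := exists_inner_eq_integral b hψ.smooth.continuous hψ.compact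
  obtain ⟨z1, -, hz1⟩ := exists_inner_eq_integral b (hψ.contDiff_iteratedDeriv 1).continuous
    (hasCompactSupport_iteratedDeriv hψ.compact 1)
  obtain ⟨z3, -, hz3⟩ := exists_inner_eq_integral b (hψ.contDiff_iteratedDeriv 3).continuous
    (hasCompactSupport_iteratedDeriv hψ.compact 3)
  rw [iteratedDeriv_one] at hz1
  refine ⟨WithLp.toLp 2 ((b₂ * a₃) • z3, z3 + r • z1 - mulMap b a ha z), fun U => ?_⟩
  rw [weakForm₂_eq ha hψ, ← hz, ← hz1, ← hz3, ← hz3, real_inner_comm U,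
    WithLp.prod_inner_apply, mulMap_symm]
  change _ = ⟪U.fst, (b₂ * a₃) • z3⟫ + ⟪U.snd, z3 + r • z1 - mulMap b a ha z⟫
  simp only [inner_add_right, inner_sub_right, real_inner_smul_right]
  ring

/-- The operator coincides with its weak form: `U ∈ D(A)` and `A U = F` as soon as the equations
hold when tested against all admissible functions. Interior tests give the regularity, through the
invertibility of the coupling matrix; a test function with `φ''(0) ≠ 0` gives the boundary
condition. -/
theorem mem_graph_kdvOp_iff_weak (hb : 0 < b) (hb₁ : 0 < b₁) (ha₃ : a₃ ^ 2 * b₂ < 1)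
    (ha : MemLp a ⊤ (volume.restrict (Ioi (0 : ℝ)))) (U F : L2bSq b) :
    (U, F) ∈ (kdvOp b a₃ b₁ b₂ r a ha).graph ↔
      ∀ φ, IsTestFunction φ →
        ∫ x in Ioi (0 : ℝ), F.fst x * φ x = weakForm₁ a₃ a φ U ∧
        b₁ * (∫ x in Ioi (0 : ℝ), F.snd x * φ x) = weakForm₂ a₃ b₂ r a φ U := by
  have hΔ : (1 - a₃ ^ 2 * b₂) ≠ 0 := by linarith
  rw [mem_graph_kdvOp_iff hb]
  constructor
  · rintro ⟨w₁, w₂, hU₁, hU₂, ht₁, ht₂, hF₁, hF₂⟩ φ hφ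
    obtain ⟨z, -, hz⟩ := exists_inner_eq_integral b hφ.smooth.continuous hφ.compact
    have d₁ := integral_primOp_three hb w₁ hφ
    have d₂ := integral_primOp_three hb w₂ hφ
    have d₃ := integral_primOp_mul_deriv hb (primOp hb (primOp hb w₂)) hφ.smooth hφ.compact
    rw [← hU₁, ht₁, ← hz] at d₁
    rw [← hU₂, ht₂, ← hz] at d₂
    rw [← hU₂, hφ.zero, ← hz] at d₃
    rw [weakForm₁_eq ha hφ, weakForm₂_eq ha hφ, d₁, d₂, d₃, ← hz, ← hz, ← hz, ← hz, hF₁, hF₂]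
    simp only [inner_sub_left, inner_neg_left, real_inner_smul_left]
    constructor
    · ring
    · field_simp; ring
  · intro h
    set I := primOp hb with hI
    -- Regularity from interior test functions.
    have r₁ : HasWeakDeriv 3 (U.fst + a₃ • U.snd) (-(F.fst + mulMap b a ha U.fst)) := by
      intro φ h1 h2 h3
      have hφ : IsInteriorTest φ := ⟨h1, h2, h3⟩
      have e := (h φ hφ.isTestFunction).1
      rw [weakForm₁_eq ha hφ.isTestFunction] at e
      obtain ⟨z, -, hz⟩ := exists_inner_eq_integral b h1.continuous h2
      obtain ⟨z3, -, hz3⟩ := exists_inner_eq_integral b (hφ.iteratedDeriv 3).smooth.continuous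
        (hφ.iteratedDeriv 3).compact
      rw [← hz, ← hz3, ← hz3, ← hz] at e
      rw [← hz, ← hz3, inner_add_left, inner_neg_left, inner_add_left, real_inner_smul_left]
      linarith
    have r₂ : HasWeakDeriv 3 (U.snd + (b₂ * a₃) • U.fst + r • I (I U.snd))
        (-(b₁ • F.snd + mulMap b a ha U.snd)) := by
      intro φ h1 h2 h3
      have hφ : IsInteriorTest φ := ⟨h1, h2, h3⟩
      have e := (h φ hφ.isTestFunction).2
      rw [weakForm₂_eq ha hφ.isTestFunction] at e
      have e' : ∫ x in Ioi (0 : ℝ), I (I U.snd) x * iteratedDeriv 3 φ x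
          = ∫ x in Ioi (0 : ℝ), U.snd x * deriv φ x := by
        have := integral_iterate_primOp hb U.snd 2 hφ.deriv
        rw [← iteratedDeriv_succ'] at this
        simpa using this
      obtain ⟨z, -, hz⟩ := exists_inner_eq_integral b h1.continuous h2
      obtain ⟨z3, -, hz3⟩ := exists_inner_eq_integral b (hφ.iteratedDeriv 3).smooth.continuous
        (hφ.iteratedDeriv 3).compact
      rw [← e', ← hz, ← hz3, ← hz3, ← hz3, ← hz] at e
      rw [← hz, ← hz3, inner_add_left, inner_add_left, inner_neg_left, inner_add_left,
        real_inner_smul_left, real_inner_smul_left, real_inner_smul_left]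
      linarith
    rw [hasWeakDeriv_iff hb] at r₁ r₂
    obtain ⟨f₁, hf₁⟩ : ∃ f, f = -(F.fst + mulMap b a ha U.fst) := ⟨_, rfl⟩
    obtain ⟨f₂, hf₂⟩ : ∃ f, f = -(b₁ • F.snd + mulMap b a ha U.snd) := ⟨_, rfl⟩
    rw [← hf₁] at r₁
    rw [← hf₂] at r₂
    change U.fst + a₃ • U.snd = I (I (I f₁)) at r₁
    change U.snd + (b₂ * a₃) • U.fst + r • I (I U.snd) = I (I (I f₂)) at r₂
    have hfst : U.fst = I (I (I f₁)) - a₃ • U.snd := eq_sub_of_add_eq r₁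
    -- First gain two derivatives on the second component, then three.
    have hsnd : (1 - a₃ ^ 2 * b₂) • U.snd
        = I (I (I f₂)) - r • I (I U.snd) - (b₂ * a₃) • I (I (I f₁)) := by
      rw [← r₂, hfst]; module
    obtain ⟨q, hq⟩ : ∃ q, U.snd = I (I q) := by
      refine ⟨(1 - a₃ ^ 2 * b₂)⁻¹ • (I f₂ - r • U.snd - (b₂ * a₃) • I f₁), ?_⟩
      rw [map_smul, map_smul, eq_inv_smul_iff₀ hΔ, hsnd]
      simp only [map_sub, map_smul]
    obtain ⟨w₂, hw₂⟩ : ∃ w, U.snd = I (I (I w)) := by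
      refine ⟨(1 - a₃ ^ 2 * b₂)⁻¹ • (f₂ - r • I q - (b₂ * a₃) • f₁), ?_⟩
      rw [map_smul, map_smul, map_smul, eq_inv_smul_iff₀ hΔ, hsnd]
      simp only [map_sub, map_smul, ← hq]
    have hw₁ : U.fst = I (I (I (f₁ - a₃ • w₂))) := by
      rw [hfst, hw₂]; simp only [map_sub, map_smul]
    obtain ⟨w₁, hw₁'⟩ : ∃ w, w = f₁ - a₃ • w₂ := ⟨_, rfl⟩
    rw [← hw₁'] at hw₁
    have hf₂' : f₂ = w₂ + (a₃ * b₂) • w₁ + r • I (I w₂) := by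
      refine primOp_injective hb (primOp_injective hb (primOp_injective hb ?_))
      rw [← hI, ← r₂, hw₁, hw₂]
      simp only [map_add, map_smul, mul_comm]
    have hF₁ : F.fst = -w₁ - a₃ • w₂ - mulMap b a ha U.fst := by
      have : F.fst = -f₁ - mulMap b a ha U.fst := by rw [hf₁]; abel
      rw [this, hw₁']; abel
    have hF₂ : b₁ • F.snd = -w₂ - (a₃ * b₂) • w₁ - r • I (I w₂) - mulMap b a ha U.snd := by
      have : b₁ • F.snd = -f₂ - mulMap b a ha U.snd := by rw [hf₂]; abel
      rw [this, hf₂']; abel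
    have ht : ⟪traceVec hb, I (I w₁)⟫ = 0 ∧ ⟪traceVec hb, I (I w₂)⟫ = 0 := by
      obtain ⟨φ, hφ, hφ2⟩ := exists_isTestFunction
      obtain ⟨z, -, hz⟩ := exists_inner_eq_integral b hφ.smooth.continuous hφ.compact
      obtain ⟨e₁, e₂⟩ := h φ hφ
      have d₁ := integral_primOp_three hb w₁ hφ
      have d₂ := integral_primOp_three hb w₂ hφ
      have d₃ := integral_primOp_mul_deriv hb (I (I w₂)) hφ.smooth hφ.compact
      rw [← hI, ← hw₁, ← hz] at d₁
      rw [← hI, ← hw₂, ← hz] at d₂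
      rw [← hI, ← hw₂, hφ.zero, ← hz] at d₃
      rw [weakForm₁_eq ha hφ, d₁, d₂, ← hz, ← hz, hF₁] at e₁
      rw [weakForm₂_eq ha hφ, d₁, d₂, d₃, ← hz, ← hz, ← real_inner_smul_left, hF₂] at e₂
      simp only [inner_sub_left, inner_neg_left, real_inner_smul_left] at e₁ e₂
      set τ₁ := ⟪traceVec hb, I (I w₁)⟫
      set τ₂ := ⟪traceVec hb, I (I w₂)⟫
      have s₁ : (τ₁ + a₃ * τ₂) * iteratedDeriv 2 φ 0 = 0 := by linear_combination e₁
      have s₂ : (τ₂ + a₃ * b₂ * τ₁) * iteratedDeriv 2 φ 0 = 0 := by linear_combination e₂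
      have s₁' := (mul_eq_zero.1 s₁).resolve_right hφ2
      have s₂' := (mul_eq_zero.1 s₂).resolve_right hφ2
      constructor
      · refine (mul_eq_zero.1 (?_ : (1 - a₃ ^ 2 * b₂) * τ₁ = 0)).resolve_left hΔ
        linear_combination s₁' - a₃ * s₂'
      · refine (mul_eq_zero.1 (?_ : (1 - a₃ ^ 2 * b₂) * τ₂ = 0)).resolve_left hΔ
        linear_combination s₂' - a₃ * b₂ * s₁'
    refine ⟨w₁, w₂, hw₁, hw₂, ht.1, ht.2, hF₁, ?_⟩
    rw [← hF₂, smul_smul, one_div, inv_mul_cancel₀ hb₁.ne', one_smul]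

end Operator

section Generation

/-! ### The semigroup of the system and its weak solutions -/

variable {b a₃ b₁ b₂ r : ℝ} {a : ℝ → ℝ}

/-- The scaling `(u, v) ↦ (√b₂ u, √b₁ v)`, which turns the norm of `[L²_b]²` into the energy
`b₂ ‖u‖² + b₁ ‖v‖²`. -/
noncomputable def energyEquiv (b : ℝ) {b₁ b₂ : ℝ} (hb₁ : 0 < b₁) (hb₂ : 0 < b₂) :
    L2bSq b ≃L[ℝ] L2bSq b :=
  (WithLp.prodContinuousLinearEquiv 2 ℝ (L2b b) (L2b b)).trans <|
    ((ContinuousLinearEquiv.smulLeft (Units.mk0 (√b₂) (Real.sqrt_ne_zero'.2 hb₂))).prodCongr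
      (ContinuousLinearEquiv.smulLeft (Units.mk0 (√b₁) (Real.sqrt_ne_zero'.2 hb₁)))).trans
      (WithLp.prodContinuousLinearEquiv 2 ℝ (L2b b) (L2b b)).symm

lemma inner_energyEquiv_left (hb₁ : 0 < b₁) (hb₂ : 0 < b₂) (U G : L2bSq b) :
    ⟪energyEquiv b hb₁ hb₂ U, G⟫ = √b₂ * ⟪U.fst, G.fst⟫ + √b₁ * ⟪U.snd, G.snd⟫ := by
  rw [WithLp.prod_inner_apply, ← real_inner_smul_left, ← real_inner_smul_left]
  rfl

lemma inner_energyEquiv (hb₁ : 0 < b₁) (hb₂ : 0 < b₂) (U V : L2bSq b) :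
    ⟪energyEquiv b hb₁ hb₂ U, energyEquiv b hb₁ hb₂ V⟫
      = b₂ * ⟪U.fst, V.fst⟫ + b₁ * ⟪U.snd, V.snd⟫ := by
  rw [inner_energyEquiv_left]
  change √b₂ * ⟪U.fst, √b₂ • V.fst⟫ + √b₁ * ⟪U.snd, √b₁ • V.snd⟫ = _
  rw [real_inner_smul_right, real_inner_smul_right, ← mul_assoc, ← mul_assoc,
    Real.mul_self_sqrt hb₂.le, Real.mul_self_sqrt hb₁.le]

lemma isClosed_graph_kdvOp (hb : 0 < b) (hb₁ : 0 < b₁) (ha₃ : a₃ ^ 2 * b₂ < 1)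
    (ha : MemLp a ⊤ (volume.restrict (Ioi (0 : ℝ)))) :
    IsClosed ((kdvOp b a₃ b₁ b₂ r a ha).graph : Set (L2bSq b × L2bSq b)) := by
  have hset : ((kdvOp b a₃ b₁ b₂ r a ha).graph : Set (L2bSq b × L2bSq b))
      = ⋂ (φ : ℝ → ℝ) (_ : IsTestFunction φ),
        {p | ∫ x in Ioi (0 : ℝ), p.2.fst x * φ x = weakForm₁ a₃ a φ p.1} ∩
        {p | b₁ * (∫ x in Ioi (0 : ℝ), p.2.snd x * φ x) = weakForm₂ a₃ b₂ r a φ p.1} := by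
    ext ⟨U, F⟩
    simp only [mem_iInter]
    exact mem_graph_kdvOp_iff_weak hb hb₁ ha₃ ha U F
  rw [hset]
  refine isClosed_iInter fun φ => isClosed_iInter fun hφ => ?_
  obtain ⟨z, -, hz⟩ := exists_inner_eq_integral b hφ.smooth.continuous hφ.compact
  obtain ⟨ζ₁, hζ₁⟩ := exists_inner_eq_weakForm₁ b a₃ ha hφ
  obtain ⟨ζ₂, hζ₂⟩ := exists_inner_eq_weakForm₂ b a₃ b₂ r ha hφ
  simp only [← hz, hζ₁, hζ₂]
  have hfst : Continuous fun p : L2bSq b × L2bSq b => p.2.fst := by fun_prop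
  have hsnd : Continuous fun p : L2bSq b × L2bSq b => p.2.snd := by fun_prop
  exact (isClosed_eq (hfst.inner continuous_const) (continuous_const.inner continuous_fst)).inter
    (isClosed_eq (continuous_const.mul (hsnd.inner continuous_const))
      (continuous_const.inner continuous_fst))

/-- The operator generates a strongly continuous semigroup, and it is quasi-dissipative with
respect to an equivalent inner product. -/
theorem exists_generatedBy_kdvOp (hb : 0 < b) (hb₁ : 0 < b₁) (hb₂ : 0 < b₂) (hr : 0 < r)
    (ha₃ : a₃ ^ 2 * b₂ < 1) (ha : MemLp a ⊤ (volume.restrict (Ioi (0 : ℝ)))) :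
    (∃ κ : ℝ, ∀ U F : L2bSq b, (U, F) ∈ (kdvOp b a₃ b₁ b₂ r a ha).graph →
      ⟪energyEquiv b hb₁ hb₂ F, energyEquiv b hb₁ hb₂ U⟫ ≤ κ * ‖energyEquiv b hb₁ hb₂ U‖ ^ 2) ∧
    ∃ S, GeneratedBy (kdvOp b a₃ b₁ b₂ r a ha).graph S := by
  obtain ⟨N, hN, hM⟩ := exists_abs_inner_mulMap_le b ha
  have hI := isDecayingPrimitive_primOp hb
  set I := primOp hb
  obtain ⟨κ₁, hκ₁⟩ : ∃ k, k = 12 * b ^ 3 + N := ⟨_, rfl⟩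
  obtain ⟨κ₂, hκ₂⟩ : ∃ k, k = (8 * b ^ 3 + N + r * b) / b₁ := ⟨_, rfl⟩
  have hκ₁0 : 0 ≤ κ₁ := by rw [hκ₁]; positivity
  have hκ₂0 : 0 ≤ κ₂ := by rw [hκ₂]; positivity
  have hκ₂' : 8 * b ^ 3 + N + r * b = κ₂ * b₁ := by rw [hκ₂]; field_simp
  have hdis : ∀ U F : L2bSq b, (U, F) ∈ (kdvOp b a₃ b₁ b₂ r a ha).graph →
      ⟪energyEquiv b hb₁ hb₂ F, energyEquiv b hb₁ hb₂ U⟫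
        ≤ (κ₁ + κ₂) * ‖energyEquiv b hb₁ hb₂ U‖ ^ 2 := by
    intro U F hUF
    obtain ⟨w₁, w₂, hU₁, hU₂, ht₁, ht₂, hF₁, hF₂⟩ := (mem_graph_kdvOp_iff hb ha U F).1 hUF
    have key := hI.system_inner_le hM hb₂ ha₃ (r := r) hU₁ hU₂ ht₁ ht₂
    rw [← real_inner_self_eq_norm_sq, inner_energyEquiv, inner_energyEquiv, hF₁, hF₂,
      real_inner_smul_left, real_inner_self_eq_norm_sq, real_inner_self_eq_norm_sq,
      ← mul_assoc b₁, mul_one_div_cancel hb₁.ne', one_mul]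
    refine key.trans ?_
    rw [hκ₂', ← hκ₁]
    have h1 : 0 ≤ κ₁ * (b₁ * ‖U.snd‖ ^ 2) := by positivity
    have h2 : 0 ≤ κ₂ * (b₂ * ‖U.fst‖ ^ 2) := by positivity
    linarith
  refine ⟨⟨_, hdis⟩, exists_generatedBy (add_nonneg hκ₁0 hκ₂0) hdis
    (isClosed_graph_kdvOp hb hb₁ ha₃ ha) (fun y hy => LinearPMap.graph_fst_eq_zero_snd _ hy rfl)
    fun c hc g hg => ?_⟩
  obtain ⟨s₁, hs₁⟩ : ∃ s, s = √b₁ := ⟨_, rfl⟩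
  obtain ⟨s₂, hs₂⟩ : ∃ s, s = √b₂ := ⟨_, rfl⟩
  have hs₁0 : s₁ ≠ 0 := by rw [hs₁]; exact Real.sqrt_ne_zero'.2 hb₁
  have hs₂0 : s₂ ≠ 0 := by rw [hs₂]; exact Real.sqrt_ne_zero'.2 hb₂
  have hzero := hI.system_adjoint_eq_zero (mulMap_symm ha) hM (b₁ := b₁) (r := r) (c := c)
    (g₁ := s₂ • g.fst) (g₂ := (s₁ / b₁) • g.snd) hb₂ ha₃ (by linarith)
    (by rw [hκ₂']; exact mul_lt_mul_of_pos_right (by linarith) hb₁) ?_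
  · have e₁ := (smul_eq_zero.1 hzero.1).resolve_left hs₂0
    have e₂ := (smul_eq_zero.1 hzero.2).resolve_left (div_ne_zero hs₁0 hb₁.ne')
    exact WithLp.ofLp_injective 2 (Prod.ext e₁ e₂)
  · intro w₁ w₂ ht₁ ht₂
    have h := hg (WithLp.toLp 2 (I (I (I w₁)), I (I (I w₂)))) _
      ((mem_graph_kdvOp_iff hb ha _ (WithLp.toLp 2 (-w₁ - a₃ • w₂ - mulMap b a ha (I (I (I w₁))),
        (1 / b₁) • (-w₂ - (a₃ * b₂) • w₁ - r • I (I w₂) - mulMap b a ha (I (I (I w₂))))))).2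
        ⟨w₁, w₂, rfl, rfl, ht₁, ht₂, rfl, rfl⟩)
    rw [inner_energyEquiv_left, ← hs₁, ← hs₂] at h
    change s₂ * ⟪c • I (I (I w₁)) - (-w₁ - a₃ • w₂ - mulMap b a ha (I (I (I w₁)))), g.fst⟫
      + s₁ * ⟪c • I (I (I w₂)) - (1 / b₁) • (-w₂ - (a₃ * b₂) • w₁ - r • I (I w₂)
        - mulMap b a ha (I (I (I w₂)))), g.snd⟫ = 0 at h
    rw [real_inner_smul_left, real_inner_smul_left, ← h, real_inner_comm _ g.fst,
      real_inner_comm _ g.snd]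
    simp only [inner_add_left, inner_sub_left, inner_neg_left, real_inner_smul_left]
    field_simp
    ring

/-- Weak solutions are the integrated solutions: the space integrals are inner products with fixed
vectors, so they commute with the integral in time. -/
lemma isWeakSolution_iff (hb : 0 < b) (hb₁ : 0 < b₁) (ha₃ : a₃ ^ 2 * b₂ < 1)
    (ha : MemLp a ⊤ (volume.restrict (Ioi (0 : ℝ)))) (U₀ : L2bSq b) (U : ℝ → L2bSq b) :
    IsWeakSolution b a₃ b₁ b₂ r a U₀ U ↔ ContinuousOn U (Ici 0) ∧ ∀ t, 0 ≤ t →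
      (∫ s in (0 : ℝ)..t, U s, U t - U₀) ∈ (kdvOp b a₃ b₁ b₂ r a ha).graph := by
  have key : ContinuousOn U (Ici 0) → ∀ φ, IsTestFunction φ → ∀ t, 0 ≤ t →
      ((∫ x in Ioi (0 : ℝ), (U t - U₀).fst x * φ x = weakForm₁ a₃ a φ (∫ s in (0 : ℝ)..t, U s) ↔
        ∫ x in Ioi (0 : ℝ), (U t).fst x * φ x = (∫ x in Ioi (0 : ℝ), U₀.fst x * φ x)
          + ∫ s in (0 : ℝ)..t, weakForm₁ a₃ a φ (U s)) ∧
      (b₁ * (∫ x in Ioi (0 : ℝ), (U t - U₀).snd x * φ x)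
          = weakForm₂ a₃ b₂ r a φ (∫ s in (0 : ℝ)..t, U s) ↔
        b₁ * ∫ x in Ioi (0 : ℝ), (U t).snd x * φ x = (b₁ * ∫ x in Ioi (0 : ℝ), U₀.snd x * φ x)
          + ∫ s in (0 : ℝ)..t, weakForm₂ a₃ b₂ r a φ (U s))) := by
    intro hU φ hφ t ht
    have hint := intervalIntegrable_of_continuousOn_Ici hU le_rfl ht
    obtain ⟨z, -, hz⟩ := exists_inner_eq_integral b hφ.smooth.continuous hφ.compact
    obtain ⟨ζ₁, hζ₁⟩ := exists_inner_eq_weakForm₁ b a₃ ha hφ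
    obtain ⟨ζ₂, hζ₂⟩ := exists_inner_eq_weakForm₂ b a₃ b₂ r ha hφ
    have hcomm : ∀ ζ : L2bSq b, ∫ s in (0 : ℝ)..t, ⟪ζ, U s⟫ = ⟪ζ, ∫ s in (0 : ℝ)..t, U s⟫ :=
      fun ζ => (innerSL ℝ ζ).intervalIntegral_comp_comm hint
    simp only [← hz, hζ₁, hζ₂, hcomm, WithLp.sub_fst, WithLp.sub_snd, inner_sub_left, mul_sub]
    exact ⟨sub_eq_iff_eq_add', sub_eq_iff_eq_add'⟩
  constructor
  · intro h
    refine ⟨h.continuousOn, fun t ht => (mem_graph_kdvOp_iff_weak hb hb₁ ha₃ ha _ _).2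
      fun φ hφ => ?_⟩
    have hk := key h.continuousOn φ hφ t ht
    exact ⟨hk.1.2 (h.fst_eq φ hφ t ht), hk.2.2 (h.snd_eq φ hφ t ht)⟩
  · rintro ⟨hU, h⟩
    have h' := fun φ hφ t ht =>
      (mem_graph_kdvOp_iff_weak hb hb₁ ha₃ ha _ _).1 (h t ht) φ hφ
    exact ⟨hU, fun φ hφ t ht => (key hU φ hφ t ht).1.1 (h' φ hφ t ht).1,
      fun φ hφ t ht => (key hU φ hφ t ht).2.1 (h' φ hφ t ht).2⟩

end Generation

end KatoKdV

theorem mainTheorem3 (b a₃ b₁ b₂ r : ℝ) (a : ℝ → ℝ) (hb : 0 < b) (hb₁ : 0 < b₁) (hb₂ : 0 < b₂)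
    (hr : 0 < r) (ha₃ : a₃ ^ 2 * b₂ < 1)
    (ha : MemLp a ⊤ (volume.restrict (Ioi (0 : ℝ)))) :
    ∃ S : ℝ → KatoKdV.L2bSq b →L[ℝ] KatoKdV.L2bSq b,
      KatoKdV.IsC0Semigroup S ∧
      KatoKdV.IsInfinitesimalGenerator (KatoKdV.kdvOp b a₃ b₁ b₂ r a ha) S ∧
      (∀ U₀ : KatoKdV.L2bSq b,
        KatoKdV.IsWeakSolution b a₃ b₁ b₂ r a U₀ (fun t => S t U₀) ∧
        ∀ V : ℝ → KatoKdV.L2bSq b, KatoKdV.IsWeakSolution b a₃ b₁ b₂ r a U₀ V →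
          EqOn V (fun t => S t U₀) (Ici 0)) ∧
      (∀ U₀ ∈ (KatoKdV.kdvOp b a₃ b₁ b₂ r a ha).domain,
        KatoKdV.IsClassicalSolution (KatoKdV.kdvOp b a₃ b₁ b₂ r a ha) U₀ (fun t => S t U₀) ∧
        ∀ V : ℝ → KatoKdV.L2bSq b,
          KatoKdV.IsClassicalSolution (KatoKdV.kdvOp b a₃ b₁ b₂ r a ha) U₀ V →
          EqOn V (fun t => S t U₀) (Ici 0)) := by
  obtain ⟨⟨κ, hdis⟩, S, hS⟩ := KatoKdV.exists_generatedBy_kdvOp hb hb₁ hb₂ hr ha₃ ha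
  have hweak := KatoKdV.isWeakSolution_iff (r := r) hb hb₁ ha₃ ha
  refine ⟨S, hS.semigroup, hS.mem_iff, fun U₀ => ?_, fun U₀ hU₀ => ?_⟩
  · refine ⟨(hweak U₀ _).2 ⟨hS.continuousOn U₀, fun t ht => hS.mem_integral U₀ ht⟩,
      fun V hV => ?_⟩
    obtain ⟨hVc, hVG⟩ := (hweak U₀ V).1 hV
    exact KatoKdV.eqOn_of_integral_mem hdis hVc (hS.continuousOn U₀) hVG
      fun t ht => hS.mem_integral U₀ ht
  · have hU := hS.isClassicalSolution hU₀
    exact ⟨hU, fun V hV => hV.eqOn hdis hU⟩
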